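/- Let $\mathbb F_4$ be the field with four elements. A collineation or correlation of the projective plane $\mathrm{PG}(2,4)$ is given by an invertible $3\times 3$ matrix $A$ over $\mathbb F_4$ and an automorphism $\tau$ of $\mathbb F_4$: the collineation maps the point $\langle x\rangle$ to the point $\langle A x^{\tau}\rangle$ and the line with dual coordinates $\langle y\rangle$ to the line $\langle (A^{T})^{-1}y^{\tau}\rangle$, while the correlation maps the point $\langle x\rangle$ to the line $\langle A x^{\tau}\rangle$ and the line $\langle y\rangle$ to the point $\langle (A^{T})^{-1}y^{\tau}\rangle$. Let $\mathrm{L}_3(4){:}2^2$ denote the group of all collineations and correlations of $\mathrm{PG}(2,4)$ for which $\det A = 1$ (this does not depend on the choice of $A$), or any group isomorphic to it. Let $G=\mathrm{L}_3(4){:}2^2$. An involution of $G$ is called central if it centralizes some Sylow $2$-subgroup of $G$. Let $\mathbb O_2$ be the point-line geometry whose points are the central involutions of $G$ and whose lines are the sets $\{x,y,xy\}$, where $x$ and $y$ are two distinct commuting central involutions of $G$ with $[G:N_G(\langle x,y\rangle)]\in\{105,420\}$; incidence is containment. (This is the $\mathrm{L}_3(4)$ near octagon.) An automorphism of $\mathbb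 O_2$ is a pair consisting of a permutation of the points and a permutation of the lines which together preserve incidence and non-incidence. **Theorem.** The full automorphism group $\mathrm{Aut}(\mathbb O_2)$ is isomorphic to $\mathrm{L}_3(4){:}2^2$, and the automorphisms of $\mathbb O_2$ are precisely the conjugations by elements of $G=\mathrm{L}_3(4){:}2^2$: conjugation by any $g\in G$, acting on points and on lines, is an automorphism of $\mathbb O_2$, and every automorphism of $\mathbb O_2$ arises in this way. -/

import Mathlib

open scoped LinearAlgebra.Projectivization

/-! ### Collineations and correlations of the projective plane `PG(2, F)` -/

section ProjectivePlane

variable {F : Type*} [Field F]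

/-- The semilinear map `x ↦ A x^τ` of `F³` given by an invertible matrix `A` and an
automorphism `τ` of the field `F`. -/
def semilinMap (A : GL (Fin 3) F) (τ : F ≃+* F) :
    (Fin 3 → F) →ₛₗ[(τ : F →+* F)] (Fin 3 → F) where
  toFun x := (A : Matrix (Fin 3) (Fin 3) F).mulVec (fun i => τ (x i))
  map_add' x y := by
    rw [← Matrix.mulVec_add]
    congr 1
    funext i
    simp
  map_smul' c x := by
    have h : (fun i => τ ((c • x) i)) = τ c • (fun i => τ (x i)) := by
      funext i
      simp
    rw [h, Matrix.mulVec_smul]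
    rfl

theorem semilinMap_injective (A : GL (Fin 3) F) (τ : F ≃+* F) :
    Function.Injective (semilinMap A τ) := by
  intro x y h
  have h1 : (fun i => τ (x i)) = (fun i => τ (y i)) :=
    Matrix.mulVec_injective_of_isUnit A.isUnit h
  funext i
  exact τ.injective (congrFun h1 i)

/-- The map `⟨x⟩ ↦ ⟨A x^τ⟩` on one-dimensional subspaces of `F³`. -/
def projMap (A : GL (Fin 3) F) (τ : F ≃+* F) :
    ℙ F (Fin 3 → F) → ℙ F (Fin 3 → F) :=
  Projectivization.map (semilinMap A τ) (semilinMap_injective A τ)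

/-- The matrix `(Aᵀ)⁻¹`. -/
def invTranspose (A : GL (Fin 3) F) : GL (Fin 3) F where
  val := ((A⁻¹ : GL (Fin 3) F) : Matrix (Fin 3) (Fin 3) F).transpose
  inv := (A : Matrix (Fin 3) (Fin 3) F).transpose
  val_inv := by rw [← Matrix.transpose_mul, Units.mul_inv, Matrix.transpose_one]
  inv_val := by rw [← Matrix.transpose_mul, Units.inv_mul, Matrix.transpose_one]

/-- The set of points (left summand) and lines (right summand) of `PG(2, F)`.
A point is `⟨x⟩` for a nonzero coordinate vector `x`. A line is `⟨y⟩` for a nonzero vector `y` of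
dual coordinates; it is the line consisting of the points `⟨x⟩` with `y₁x₁ + y₂x₂ + y₃x₃ = 0`. -/
abbrev PlaneElement (F : Type*) [Field F] : Type _ :=
  ℙ F (Fin 3 → F) ⊕ ℙ F (Fin 3 → F)

/-- `θ` is the collineation determined by `A` and `τ`: it maps the point `⟨x⟩` to the point
`⟨A x^τ⟩` and the line `⟨y⟩` to the line `⟨(Aᵀ)⁻¹ y^τ⟩`. -/
def IsCollineationOf (θ : Equiv.Perm (PlaneElement F)) (A : GL (Fin 3) F) (τ : F ≃+* F) : Prop :=
  (∀ p, θ (Sum.inl p) = Sum.inl (projMap A τ p)) ∧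
  (∀ l, θ (Sum.inr l) = Sum.inr (projMap (invTranspose A) τ l))

/-- `θ` is the correlation determined by `A` and `τ`: it maps the point `⟨x⟩` to the line
`⟨A x^τ⟩` and the line `⟨y⟩` to the point `⟨(Aᵀ)⁻¹ y^τ⟩`. -/
def IsCorrelationOf (θ : Equiv.Perm (PlaneElement F)) (A : GL (Fin 3) F) (τ : F ≃+* F) : Prop :=
  (∀ p, θ (Sum.inl p) = Sum.inr (projMap A τ p)) ∧
  (∀ l, θ (Sum.inr l) = Sum.inl (projMap (invTranspose A) τ l))

/-- The matrix obtained by applying `τ` to all entries of `A`. -/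
abbrev conjMat (τ : F ≃+* F) (A : GL (Fin 3) F) : GL (Fin 3) F :=
  Matrix.GeneralLinearGroup.map (τ : F →+* F) A

theorem semilinMap_comp (A B : GL (Fin 3) F) (τ σ : F ≃+* F) (x : Fin 3 → F) :
    semilinMap A τ (semilinMap B σ x) = semilinMap (A * conjMat τ B) (τ * σ) x := by
  funext i
  simp [semilinMap, Matrix.mulVec, dotProduct, Matrix.mul_apply, Fin.sum_univ_three]
  ring

theorem projMap_comp (A B : GL (Fin 3) F) (τ σ : F ≃+* F) (p : ℙ F (Fin 3 → F)) :
    projMap A τ (projMap B σ p) = projMap (A * conjMat τ B) (τ * σ) p := by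
  induction p using Projectivization.ind with
  | h v hv =>
    simp only [projMap, Projectivization.map_mk, semilinMap_comp]

theorem projMap_one (p : ℙ F (Fin 3 → F)) : projMap 1 1 p = p := by
  induction p using Projectivization.ind with
  | h v hv =>
    simp only [projMap, Projectivization.map_mk]
    congr 1
    simp [semilinMap]

theorem projMap_inv_right (A : GL (Fin 3) F) (τ : F ≃+* F) (p : ℙ F (Fin 3 → F)) :
    projMap A τ (projMap (conjMat τ⁻¹ A⁻¹) τ⁻¹ p) = p := by
  have h : A * conjMat τ (conjMat τ⁻¹ A⁻¹) = 1 := by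
    have h1 : conjMat τ (conjMat τ⁻¹ A⁻¹) = A⁻¹ := by
      apply Units.ext
      ext i j
      exact τ.apply_symm_apply _
    rw [h1, mul_inv_cancel]
  rw [projMap_comp, h, mul_inv_cancel, projMap_one]

theorem invTranspose_inv (A : GL (Fin 3) F) : invTranspose A⁻¹ = (invTranspose A)⁻¹ := by
  apply Units.ext
  rfl

theorem invTranspose_mul (A B : GL (Fin 3) F) :
    invTranspose (A * B) = invTranspose A * invTranspose B := by
  apply Units.ext
  change Matrix.transpose _ = Matrix.transpose _ * Matrix.transpose _
  rw [← Matrix.transpose_mul, mul_inv_rev, Units.val_mul]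

theorem invTranspose_invTranspose (A : GL (Fin 3) F) : invTranspose (invTranspose A) = A := by
  apply Units.ext
  change Matrix.transpose (Matrix.transpose _) = _
  rw [Matrix.transpose_transpose]

theorem invTranspose_conjMat (τ : F ≃+* F) (A : GL (Fin 3) F) :
    invTranspose (conjMat τ A) = conjMat τ (invTranspose A) := by
  apply Units.ext
  change Matrix.transpose _ = _
  rw [← map_inv]
  rfl

theorem det_invTranspose (A : GL (Fin 3) F) (h : (A : Matrix (Fin 3) (Fin 3) F).det = 1) :
    (invTranspose A : Matrix (Fin 3) (Fin 3) F).det = 1 := by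
  have h2 : (A : Matrix (Fin 3) (Fin 3) F) * ((A⁻¹ : GL (Fin 3) F) : Matrix (Fin 3) (Fin 3) F) = 1 :=
    Units.mul_inv A
  have h3 := congrArg Matrix.det h2
  rw [Matrix.det_mul, h, one_mul, Matrix.det_one] at h3
  change (Matrix.transpose _).det = 1
  rw [Matrix.det_transpose, h3]

theorem det_mul_conjMat (A B : GL (Fin 3) F) (τ : F ≃+* F)
    (hA : (A : Matrix (Fin 3) (Fin 3) F).det = 1) (hB : (B : Matrix (Fin 3) (Fin 3) F).det = 1) :
    (((A * conjMat τ B : GL (Fin 3) F)) : Matrix (Fin 3) (Fin 3) F).det = 1 := by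
  have h : ((conjMat τ B : GL (Fin 3) F) : Matrix (Fin 3) (Fin 3) F) =
      (τ : F →+* F).mapMatrix (B : Matrix (Fin 3) (Fin 3) F) := rfl
  rw [Units.val_mul, Matrix.det_mul, hA, h, ← RingHom.map_det, hB, map_one, mul_one]

/-- The group of all collineations and correlations of `PG(2, F)` which can be represented by a
matrix of determinant `1` (together with an automorphism of `F`), as a group of permutations of
the points and lines. -/
def unimodularCorrelationGroup (F : Type*) [Field F] : Subgroup (Equiv.Perm (PlaneElement F)) where
  carrier := {θ | ∃ (A : GL (Fin 3) F) (τ : F ≃+* F), (A : Matrix (Fin 3) (Fin 3) F).det = 1 ∧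
    (IsCollineationOf θ A τ ∨ IsCorrelationOf θ A τ)}
  one_mem' := by
    refine ⟨1, 1, by simp, Or.inl ⟨fun p => by simp [projMap_one], fun l => ?_⟩⟩
    have : invTranspose (1 : GL (Fin 3) F) = 1 := by
      apply Units.ext
      change Matrix.transpose _ = _
      simp
    simp [this, projMap_one]
  mul_mem' := by
    rintro θ η ⟨A, τ, hA, h⟩ ⟨B, σ, hB, k⟩
    rcases k with k | k
    · refine ⟨A * conjMat τ B, τ * σ, det_mul_conjMat A B τ hA hB, ?_⟩
      rcases h with h | h
      · left
        constructor
        · intro p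
          rw [Equiv.Perm.mul_apply, k.1, h.1, projMap_comp]
        · intro p
          rw [Equiv.Perm.mul_apply, k.2, h.2, projMap_comp, invTranspose_mul, invTranspose_conjMat]
      · right
        constructor
        · intro p
          rw [Equiv.Perm.mul_apply, k.1, h.1, projMap_comp]
        · intro p
          rw [Equiv.Perm.mul_apply, k.2, h.2, projMap_comp, invTranspose_mul, invTranspose_conjMat]
    · refine ⟨invTranspose A * conjMat τ B, τ * σ,
        det_mul_conjMat _ B τ (det_invTranspose A hA) hB, ?_⟩
      rcases h with h | h
      · right
        constructor
        · intro p
          rw [Equiv.Perm.mul_apply, k.1, h.2, projMap_comp]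
        · intro p
          rw [Equiv.Perm.mul_apply, k.2, h.1, projMap_comp, invTranspose_mul, invTranspose_conjMat,
            invTranspose_invTranspose]
      · left
        constructor
        · intro p
          rw [Equiv.Perm.mul_apply, k.1, h.2, projMap_comp]
        · intro p
          rw [Equiv.Perm.mul_apply, k.2, h.1, projMap_comp, invTranspose_mul, invTranspose_conjMat,
            invTranspose_invTranspose]
  inv_mem' := by
    rintro θ ⟨A, τ, hA, h⟩
    have hdet : ∀ C : GL (Fin 3) F, (C : Matrix (Fin 3) (Fin 3) F).det = 1 →
        ((conjMat τ⁻¹ C⁻¹ : GL (Fin 3) F) : Matrix (Fin 3) (Fin 3) F).det = 1 := by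
      intro C hC
      have h2 : ((C⁻¹ : GL (Fin 3) F) : Matrix (Fin 3) (Fin 3) F).det = 1 := by
        have := det_invTranspose C hC
        rwa [show (invTranspose C : Matrix (Fin 3) (Fin 3) F) =
          Matrix.transpose ((C⁻¹ : GL (Fin 3) F) : Matrix (Fin 3) (Fin 3) F) from rfl,
          Matrix.det_transpose] at this
      have h3 := det_mul_conjMat 1 C⁻¹ τ⁻¹ (by simp) h2
      rwa [one_mul] at h3
    rcases h with h | h
    · refine ⟨conjMat τ⁻¹ A⁻¹, τ⁻¹, hdet A hA, Or.inl ⟨fun p => ?_, fun p => ?_⟩⟩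
      · rw [Equiv.Perm.inv_eq_iff_eq, h.1, projMap_inv_right]
      · rw [Equiv.Perm.inv_eq_iff_eq, h.2, invTranspose_conjMat, invTranspose_inv,
          projMap_inv_right]
    · refine ⟨conjMat τ⁻¹ (invTranspose A)⁻¹, τ⁻¹, hdet _ (det_invTranspose A hA),
        Or.inr ⟨fun p => ?_, fun p => ?_⟩⟩
      · rw [Equiv.Perm.inv_eq_iff_eq, h.2, projMap_inv_right]
      · rw [Equiv.Perm.inv_eq_iff_eq, h.1, invTranspose_conjMat, invTranspose_inv,
          invTranspose_invTranspose, projMap_inv_right]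

end ProjectivePlane

/-- The group `L₃(4):2²`: all collineations and correlations of `PG(2, 4)` whose matrix has
determinant `1`. Over the field with four elements all matrices representing a given collineation
or correlation have the same determinant, since `k³ = 1` for every nonzero scalar `k`. -/
abbrev L34Ext : Type :=
  unimodularCorrelationGroup (GaloisField 2 2)

/-! ### Point-line geometries and their automorphisms -/

/-- A point-line geometry: points, lines and an incidence relation. -/
structure PointLineGeometry.{u} where
  Point : Type u
  Line : Type u
  Inc : Point → Line → Prop

/-- The full automorphism group of a point-line geometry: all pairs consisting of a permutation of
the points and a permutation of the lines which preserve incidence and non-incidence. -/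
def PointLineGeometry.Aut (S : PointLineGeometry) :
    Subgroup (Equiv.Perm S.Point × Equiv.Perm S.Line) where
  carrier := {θ | ∀ p L, S.Inc (θ.1 p) (θ.2 L) ↔ S.Inc p L}
  one_mem' := fun _ _ => Iff.rfl
  mul_mem' := fun {a b} ha hb p L => (ha (b.1 p) (b.2 L)).trans (hb p L)
  inv_mem' := fun {a} ha p L => by
    have h := ha (a.1⁻¹ p) (a.2⁻¹ L)
    rw [← Equiv.Perm.mul_apply, ← Equiv.Perm.mul_apply, mul_inv_cancel, mul_inv_cancel] at h
    exact h.symm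

/-! ### The near octagon -/

section NearOctagon

variable (G : Type*) [Group G]

/-- A central involution of `G`: an element of order two which centralizes some Sylow
`2`-subgroup of `G`. -/
def IsCentralInvolution (σ : G) : Prop :=
  orderOf σ = 2 ∧ ∃ H : Sylow 2 G, σ ∈ Subgroup.centralizer (H : Set G)

/-- The sets `{x, y, xy}` where `x` and `y` are distinct commuting central involutions of `G` such
that the index of `N_G(⟨x, y⟩)` in `G` is `105` or `420`. -/
def IsOctagonLine (L : Set G) : Prop :=
  ∃ x y : G, IsCentralInvolution G x ∧ IsCentralInvolution G y ∧ x ≠ y ∧ Commute x y ∧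
    ((Subgroup.normalizer (Subgroup.closure {x, y} : Set G)).index = 105 ∨
      (Subgroup.normalizer (Subgroup.closure {x, y} : Set G)).index = 420) ∧
    L = {x, y, x * y}

/-- The point-line geometry with the central involutions of `G` as points, the sets `{x, y, xy}`
above as lines, and containment as incidence. For `G = L₃(4):2²` this is the `L₃(4)` near octagon. -/
def octagonGeometry : PointLineGeometry where
  Point := {σ : G // IsCentralInvolution G σ}
  Line := {L : Set G // IsOctagonLine G L}
  Inc p L := p.1 ∈ L.1

/-- `θ` is conjugation by `g`, on the points as well as on the lines. -/
def IsConjugationBy {G : Type*} [Group G] (g : G)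
    (θ : Equiv.Perm (octagonGeometry G).Point × Equiv.Perm (octagonGeometry G).Line) : Prop :=
  (∀ p : {σ : G // IsCentralInvolution G σ}, (θ.1 p).1 = g * p.1 * g⁻¹) ∧
  (∀ L : {L : Set G // IsOctagonLine G L}, (θ.2 L).1 = (fun x => g * x * g⁻¹) '' L.1)

end NearOctagon

namespace NearOctagon

open Matrix

local infixl:75 " ⊠ " => Matrix.vecMulVec

/-! ### Vectors in three-dimensional space -/

section Vectors

variable {F : Type*} [Field F]

/-! Write an elation of the plane as `1 + X` with `X = v ⊠ f` and `f ⬝ᵥ v = 0`; its center is ⟨v⟩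
and its axis ⟨f⟩. The central involutions are the nontrivial elations (`isCentralInvolution_iff`):
only the elations `1 + s E₀₂` and the identity commute with all unitriangular elations, the center
of a Sylow 2-subgroup is nontrivial, and all elations are conjugate.

Commuting elations have each center on the other axis, so they share the center or the axis. If they
share the center `v` and have distinct axes `f`, `g`, then `v = δ • f ⨯₃ g`. The scalar `δ` does not
depend on the chosen representatives, because nonzero scalars have cube one, and matrices of
determinant one preserve it; field automorphisms act on it. Counting orbits gives normalizer index
105 for a common center and axis, 420 for `δ = 1`, and 840 for the two other values of `δ`, which
Frobenius fuses. Hence the index condition selects exactly the relation `Adj`, and lines are triples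
`{X, Y, X + Y}` (`isOctagonLine_iff`).

An automorphism of the geometry preserves `Adj`. Pairs with the same center and axis are
recognizable from `Adj` alone: they are the collinear pairs that do not extend to a geodesic of
length two with a unique midpoint (`isScaled_iff`). Along such geodesics common center and common
axis alternate, so the image of the standard hexagon of elations comes from a basis of determinant
one (`IsHexagon.exists_frame_of_isCentered`), up to duality. Composing with a collineation or
correlation, and choosing the field automorphism according to one further elation, reduces to an
automorphism fixing the hexagon and that elation. Such an automorphism is trivial
(`LineAut.eq_self_of_hexagon`), because fixed elations propagate along lines and unique midpoints.

So every automorphism is a conjugation. The conjugation action is faithful, because only the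
identity commutes with all elations; this gives the isomorphism. These facts are packaged in
`IsOctagonal`, which is invariant under group isomorphism. -/

theorem exists_smul_of_cross_eq_zero {f g : Fin 3 → F} (hf : f ≠ 0) (h : f ⨯₃ g = 0) :
    ∃ c : F, g = c • f := by
  have h1 : ¬ LinearIndependent F ![f, g] := fun h2 =>
    crossProduct_ne_zero_iff_linearIndependent.mpr h2 h
  rw [LinearIndependent.pair_iff' hf] at h1
  push Not at h1
  obtain ⟨c, hc⟩ := h1
  exact ⟨c, hc.symm⟩

theorem exists_dot_eq_one {v : Fin 3 → F} (hv : v ≠ 0) : ∃ u : Fin 3 → F, u ⬝ᵥ v = 1 := by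
  obtain ⟨i, hi⟩ := Function.ne_iff.mp hv
  refine ⟨Pi.single i (v i)⁻¹, ?_⟩
  rw [single_dotProduct, inv_mul_cancel₀ hi]

/-- For `u` with `u ⬝ᵥ v = 1`, the triple product `v ⨯₃ (f ⨯₃ u)` collapses to `f`. In particular
every elation has the form `v ⊠ (v ⨯₃ w)`. -/
theorem exists_cross_eq {v f : Fin 3 → F} (hv : v ≠ 0) (h : f ⬝ᵥ v = 0) :
    ∃ w : Fin 3 → F, v ⨯₃ w = f := by
  obtain ⟨u, hu⟩ := exists_dot_eq_one hv
  refine ⟨f ⨯₃ u, ?_⟩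
  rw [cross_cross_eq_smul_sub_smul', dotProduct_comm v u, hu, h, one_smul, zero_smul, sub_zero]

/-- The scalar found here is what decides collinearity of two elations with a common center or axis.
-/
theorem exists_cross_eq_smul {v f g : Fin 3 → F} (hv : v ≠ 0) (hf : f ⬝ᵥ v = 0)
    (hg : g ⬝ᵥ v = 0) : ∃ c : F, f ⨯₃ g = c • v := by
  apply exists_smul_of_cross_eq_zero hv
  rw [cross_cross_eq_smul_sub_smul', dotProduct_comm v g, hg, hf, zero_smul, zero_smul, sub_zero]

theorem exists_eq_smul_add_smul {f g h : Fin 3 → F} (hfg : f ⨯₃ g ≠ 0)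
    (hh : h ⬝ᵥ f ⨯₃ g = 0) : ∃ a b : F, h = a • f + b • g := by
  obtain ⟨k, hk⟩ := exists_dot_eq_one hfg
  refine ⟨h ⬝ᵥ g ⨯₃ k, h ⬝ᵥ k ⨯₃ f, ?_⟩
  -- Cramer's rule for the triple `f`, `g`, `k`.
  have key : (k ⬝ᵥ f ⨯₃ g) • h =
      (h ⬝ᵥ g ⨯₃ k) • f + (h ⬝ᵥ k ⨯₃ f) • g + (h ⬝ᵥ f ⨯₃ g) • k := by
    simp_rw [cross_apply, vec3_dotProduct]
    ext i
    fin_cases i <;> simp <;> ring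
  rwa [hk, hh, one_smul, zero_smul, add_zero] at key

/-- A rank one matrix determines its two factors up to reciprocal scalars; the scalar is read off at
a nonzero entry. -/
theorem vecMulVec_eq_iff {v w f g : Fin 3 → F} (hv : v ≠ 0) (hf : f ≠ 0)
    (h : v ⊠ f = w ⊠ g) : ∃ c : F, c ≠ 0 ∧ w = c • v ∧ f = c • g := by
  obtain ⟨i, hi⟩ := Function.ne_iff.mp hv
  obtain ⟨j, hj⟩ := Function.ne_iff.mp hf
  have h1 : ∀ a b, v a * f b = w a * g b := fun a b => by
    simpa [vecMulVec_apply] using congrFun (congrFun h a) b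
  simp only [Pi.zero_apply] at hi hj
  have hne : w i * g j ≠ 0 := by rw [← h1]; exact mul_ne_zero hi hj
  have hw : w i ≠ 0 := left_ne_zero_of_mul hne
  have hg : g j ≠ 0 := right_ne_zero_of_mul hne
  refine ⟨w i / v i, div_ne_zero hw hi, ?_, ?_⟩
  · ext a
    have h2 := h1 a j
    have h3 := h1 i j
    simp only [Pi.smul_apply, smul_eq_mul]
    field_simp
    have : w a * v i * (g j) = w i * v a * g j := by
      calc w a * v i * g j = (w a * g j) * v i := by ring
        _ = (v i * f j) * v a := by rw [← h2]; ring
        _ = _ := by rw [h3]; ring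
    exact mul_right_cancel₀ hg this
  · ext b
    have h2 := h1 i b
    simp only [Pi.smul_apply, smul_eq_mul]
    field_simp
    linear_combination h2

theorem cross_smul_smul (a b : F) (v w : Fin 3 → F) :
    (a • v) ⨯₃ (b • w) = (a * b) • v ⨯₃ w := by
  simp [smul_smul, mul_comm]

theorem left_ne_zero_of_cross {v w : Fin 3 → F} (h : v ⨯₃ w ≠ 0) : v ≠ 0 := by
  rintro rfl; simp at h

theorem right_ne_zero_of_cross {v w : Fin 3 → F} (h : v ⨯₃ w ≠ 0) : w ≠ 0 := by
  rintro rfl; simp at h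

theorem left_dot_cross (v w : Fin 3 → F) : v ⬝ᵥ v ⨯₃ w = 0 := dot_self_cross v w

theorem right_dot_cross (v w : Fin 3 → F) : w ⬝ᵥ v ⨯₃ w = 0 := dot_cross_self v w

end Vectors

/-! ### The field with four elements -/

/-- `F` has four elements. -/
class FieldFour (F : Type*) [Field F] : Prop where
  card_eq : Nat.card F = 4

section FieldFour

variable {F : Type*} [Field F] [FieldFour F]

instance FieldFour.finite : Finite F :=
  Nat.finite_of_card_ne_zero (by rw [FieldFour.card_eq]; norm_num)

theorem pow_three {a : F} (ha : a ≠ 0) : a ^ 3 = 1 := by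
  have := Fintype.ofFinite F
  have h := FiniteField.pow_card_sub_one_eq_one a ha
  rwa [Fintype.card_eq_nat_card, FieldFour.card_eq] at h

theorem two_eq_zero : (2 : F) = 0 := by
  have := Fintype.ofFinite F
  have h : ((Fintype.card F : ℕ) : F) = 0 := Nat.cast_card_eq_zero F
  rw [Fintype.card_eq_nat_card, FieldFour.card_eq] at h
  -- The cardinality 4 vanishes in the field.
  have h2 : (2 : F) * 2 = 0 := by norm_num at h ⊢; exact h
  exact mul_self_eq_zero.mp h2

instance FieldFour.charP : CharP F 2 := CharTwo.of_one_ne_zero_of_two_eq_zero one_ne_zero two_eq_zero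

theorem eq_one_of_sq_eq_one {a : F} (h : a ^ 2 = 1) : a = 1 := by
  have h1 : (a - 1) ^ 2 = 0 := by linear_combination h + (1 - a) * two_eq_zero (F := F)
  exact sub_eq_zero.mp (pow_eq_zero_iff (two_ne_zero) |>.mp h1)

/-- Every element is a square. -/
theorem exists_sq_eq (a : F) : ∃ b : F, b ^ 2 = a := by
  by_cases ha : a = 0
  · exact ⟨0, by simp [ha]⟩
  · exact ⟨a ^ 2, by linear_combination a * pow_three ha⟩

/-- There is a primitive element. -/
theorem exists_ne_zero_ne_one : ∃ a : F, a ≠ 0 ∧ a ≠ 1 := by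
  by_contra! h
  have h1 : (Set.univ : Set F) ⊆ {0, 1} := fun a _ => by
    by_cases ha : a = 0
    · simp [ha]
    · simp [h a ha]
  have h2 := Set.ncard_le_ncard h1
  rw [Set.ncard_univ, FieldFour.card_eq] at h2
  have := Set.ncard_insert_le (0 : F) {1}
  rw [Set.ncard_singleton] at this
  omega

/-- The elements of the field besides `0` and `1` are `a` and `a ^ 2`. -/
theorem eq_one_or_eq_or_eq_sq {a b : F} (ha : a ≠ 0) (ha1 : a ≠ 1) (hb : b ≠ 0) :
    b = 1 ∨ b = a ∨ b = a ^ 2 := by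
  have h1 : a ^ 2 + a + 1 = 0 := by
    have h := pow_three ha
    have : (a - 1) * (a ^ 2 + a + 1) = 0 := by linear_combination h
    exact (mul_eq_zero.mp this).resolve_left (sub_ne_zero.mpr ha1)
  -- This product is the factorization of `b ^ 3 - 1`.
  have h2 : (b - 1) * ((b - a) * (b - a ^ 2)) = 0 := by
    linear_combination pow_three hb + (-b ^ 2 + a * b ) * h1 + (b - 1) * pow_three ha - (a ) * b* h1
      +b*h1
  rcases mul_eq_zero.mp h2 with h | h
  · exact Or.inl (sub_eq_zero.mp h)
  · rcases mul_eq_zero.mp h with h | h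
    · exact Or.inr (Or.inl (sub_eq_zero.mp h))
    · exact Or.inr (Or.inr (sub_eq_zero.mp h))

theorem neg_eq' (v : Fin 3 → F) : -v = v := by
  ext i; exact CharTwo.neg_eq (v i)

theorem cross_comm (v w : Fin 3 → F) : v ⨯₃ w = w ⨯₃ v := by
  rw [← cross_anticomm, neg_eq']

/-- The Frobenius automorphism `a ↦ a ^ 2`. -/
theorem exists_frobenius : ∃ τ : F ≃+* F, ∀ a, τ a = a ^ 2 := by
  have hb : Function.Bijective (frobenius F 2) :=
    Finite.injective_iff_bijective.mp (frobenius F 2).injective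
  exact ⟨RingEquiv.ofBijective (frobenius F 2) hb, fun a => rfl⟩

end FieldFour

/-! ### Elations and their collinearity -/

section Elations

variable {F : Type*} [Field F]

/-- `1 + X` is the matrix of a nontrivial elation. -/
def IsElation (X : Matrix (Fin 3) (Fin 3) F) : Prop :=
  ∃ v f : Fin 3 → F, v ≠ 0 ∧ f ≠ 0 ∧ f ⬝ᵥ v = 0 ∧ X = v ⊠ f

/-- `Y` is a scalar multiple of the elation `X`, that is, has the same center and axis. -/
def IsScaled (X Y : Matrix (Fin 3) (Fin 3) F) : Prop :=
  IsElation X ∧ ∃ c : F, c ≠ 0 ∧ c ≠ 1 ∧ Y = c • X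

/-- Collinear elations with the same center and distinct axes. -/
def IsCentered (X Y : Matrix (Fin 3) (Fin 3) F) : Prop :=
  ∃ f g : Fin 3 → F, f ⨯₃ g ≠ 0 ∧ X = (f ⨯₃ g) ⊠ f ∧ Y = (f ⨯₃ g) ⊠ g

/-- Collinear elations with the same axis and distinct centers. -/
def IsAxial (X Y : Matrix (Fin 3) (Fin 3) F) : Prop :=
  ∃ v w : Fin 3 → F, v ⨯₃ w ≠ 0 ∧ X = v ⊠ (v ⨯₃ w) ∧ Y = w ⊠ (v ⨯₃ w)

/-- Collinearity in the near octagon. -/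
def Adj (X Y : Matrix (Fin 3) (Fin 3) F) : Prop :=
  IsScaled X Y ∨ IsCentered X Y ∨ IsAxial X Y

theorem isElation_vecMulVec {v f : Fin 3 → F} (hv : v ≠ 0) (hf : f ≠ 0) (h : f ⬝ᵥ v = 0) :
    IsElation (v ⊠ f) := ⟨v, f, hv, hf, h, rfl⟩

theorem IsElation.ne_zero {X : Matrix (Fin 3) (Fin 3) F} (h : IsElation X) : X ≠ 0 := by
  obtain ⟨v, f, hv, hf, -, rfl⟩ := h
  exact vecMulVec_ne_zero hv hf

theorem IsElation.transpose {X : Matrix (Fin 3) (Fin 3) F} (h : IsElation X) :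
    IsElation Xᵀ := by
  obtain ⟨v, f, hv, hf, h, rfl⟩ := h
  exact ⟨f, v, hf, hv, by rw [dotProduct_comm, h], transpose_vecMulVec _ _⟩

theorem IsElation.smul {X : Matrix (Fin 3) (Fin 3) F} (h : IsElation X) {c : F} (hc : c ≠ 0) :
    IsElation (c • X) := by
  obtain ⟨v, f, hv, hf, h, rfl⟩ := h
  exact ⟨v, c • f, hv, smul_ne_zero hc hf, by rw [smul_dotProduct, h, smul_zero],
    (vecMulVec_smul _ _ _).symm⟩

theorem isCentered_of_cross {v f g : Fin 3 → F} (hv : v ≠ 0) (h : f ⨯₃ g = v) :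
    IsCentered (v ⊠ f) (v ⊠ g) := by
  subst h
  exact ⟨f, g, hv, rfl, rfl⟩

theorem isAxial_of_cross {v w f : Fin 3 → F} (hf : f ≠ 0) (h : v ⨯₃ w = f) :
    IsAxial (v ⊠ f) (w ⊠ f) := by
  subst h
  exact ⟨v, w, hf, rfl, rfl⟩

theorem adj_of_cross_center {v f g : Fin 3 → F} (hv : v ≠ 0) (h : f ⨯₃ g = v) :
    Adj (v ⊠ f) (v ⊠ g) := Or.inr (Or.inl (isCentered_of_cross hv h))

theorem adj_of_cross_axis {v w f : Fin 3 → F} (hf : f ≠ 0) (h : v ⨯₃ w = f) :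
    Adj (v ⊠ f) (w ⊠ f) := Or.inr (Or.inr (isAxial_of_cross hf h))

theorem IsScaled.transpose {X Y : Matrix (Fin 3) (Fin 3) F} (h : IsScaled X Y) :
    IsScaled Xᵀ Yᵀ := by
  obtain ⟨hX, c, h0, h1, rfl⟩ := h
  exact ⟨hX.transpose, c, h0, h1, transpose_smul _ _⟩

theorem IsCentered.transpose {X Y : Matrix (Fin 3) (Fin 3) F} (h : IsCentered X Y) :
    IsAxial Xᵀ Yᵀ := by
  obtain ⟨f, g, h, rfl, rfl⟩ := h
  exact ⟨f, g, h, transpose_vecMulVec _ _, transpose_vecMulVec _ _⟩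

theorem IsAxial.transpose {X Y : Matrix (Fin 3) (Fin 3) F} (h : IsAxial X Y) :
    IsCentered Xᵀ Yᵀ := by
  obtain ⟨f, g, h, rfl, rfl⟩ := h
  exact ⟨f, g, h, transpose_vecMulVec _ _, transpose_vecMulVec _ _⟩

theorem Adj.transpose {X Y : Matrix (Fin 3) (Fin 3) F} (h : Adj X Y) : Adj Xᵀ Yᵀ := by
  rcases h with h | h | h
  · exact Or.inl h.transpose
  · exact Or.inr (Or.inr h.transpose)
  · exact Or.inr (Or.inl h.transpose)

theorem adj_transpose_iff {X Y : Matrix (Fin 3) (Fin 3) F} : Adj Xᵀ Yᵀ ↔ Adj X Y :=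
  ⟨fun h => by simpa using h.transpose, fun h => h.transpose⟩

theorem Adj.isElation_left {X Y : Matrix (Fin 3) (Fin 3) F} (h : Adj X Y) : IsElation X := by
  rcases h with h | ⟨f, g, h, rfl, rfl⟩ | ⟨v, w, h, rfl, rfl⟩
  · exact h.1
  · exact isElation_vecMulVec h (left_ne_zero_of_cross h) (left_dot_cross _ _)
  · exact isElation_vecMulVec (left_ne_zero_of_cross h) h
      (by rw [dotProduct_comm, left_dot_cross])

theorem Adj.isElation_right {X Y : Matrix (Fin 3) (Fin 3) F} (h : Adj X Y) : IsElation Y := by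
  rcases h with ⟨h, c, h0, -, rfl⟩ | ⟨f, g, h, rfl, rfl⟩ | ⟨v, w, h, rfl, rfl⟩
  · exact h.smul h0
  · exact isElation_vecMulVec h (right_ne_zero_of_cross h) (right_dot_cross _ _)
  · exact isElation_vecMulVec (right_ne_zero_of_cross h) h
      (by rw [dotProduct_comm, right_dot_cross])

variable [FieldFour F]

omit [FieldFour F] in
theorem IsScaled.symm {X Y : Matrix (Fin 3) (Fin 3) F} (h : IsScaled X Y) : IsScaled Y X := by
  obtain ⟨hX, c, h0, h1, rfl⟩ := h
  exact ⟨hX.smul h0, c⁻¹, inv_ne_zero h0, fun h => h1 (inv_eq_one.mp h),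
    by rw [smul_smul, inv_mul_cancel₀ h0, one_smul]⟩

theorem IsCentered.symm {X Y : Matrix (Fin 3) (Fin 3) F} (h : IsCentered X Y) :
    IsCentered Y X := by
  obtain ⟨f, g, h, rfl, rfl⟩ := h
  rw [cross_comm] at h ⊢
  exact ⟨g, f, h, rfl, rfl⟩

theorem IsAxial.symm {X Y : Matrix (Fin 3) (Fin 3) F} (h : IsAxial X Y) :
    IsAxial Y X := by
  obtain ⟨f, g, h, rfl, rfl⟩ := h
  rw [cross_comm] at h ⊢
  exact ⟨g, f, h, rfl, rfl⟩

theorem Adj.symm {X Y : Matrix (Fin 3) (Fin 3) F} (h : Adj X Y) : Adj Y X := by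
  rcases h with h | h | h
  · exact Or.inl h.symm
  · exact Or.inr (Or.inl h.symm)
  · exact Or.inr (Or.inr h.symm)

omit [FieldFour F] in
theorem IsScaled.exists_eq {v f : Fin 3 → F} {Y : Matrix (Fin 3) (Fin 3) F}
    (h : IsScaled (v ⊠ f) Y) : ∃ c : F, c ≠ 0 ∧ c ≠ 1 ∧ Y = v ⊠ (c • f) := by
  obtain ⟨-, c, h0, h1, rfl⟩ := h
  exact ⟨c, h0, h1, (vecMulVec_smul _ _ _).symm⟩

/-- Another representation of the same elation replaces `(v, f)` by `(c • v, c⁻¹ • f)`. The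
normalization of the cross product survives such a change because `c ^ 3 = 1`. -/
theorem IsCentered.exists_eq {v f : Fin 3 → F} (hv : v ≠ 0) (hf : f ≠ 0)
    {Y : Matrix (Fin 3) (Fin 3) F}
    (h : IsCentered (v ⊠ f) Y) : ∃ g, f ⨯₃ g = v ∧ Y = v ⊠ g := by
  obtain ⟨f', g', h, h1, rfl⟩ := h
  obtain ⟨c, hc, h2, rfl⟩ := vecMulVec_eq_iff hv hf h1
  refine ⟨c • g', ?_, by rw [h2, smul_vecMulVec, vecMulVec_smul]⟩
  rw [cross_smul_smul, h2, smul_smul, mul_comm c c, mul_assoc, ← pow_two, ← pow_succ',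
    pow_three hc, one_smul]

theorem IsAxial.exists_eq {v f : Fin 3 → F} (hv : v ≠ 0) (hf : f ≠ 0)
    {Y : Matrix (Fin 3) (Fin 3) F}
    (h : IsAxial (v ⊠ f) Y) : ∃ w, v ⨯₃ w = f ∧ Y = w ⊠ f := by
  have h1 := h.transpose
  rw [transpose_vecMulVec] at h1
  obtain ⟨w, h2, h3⟩ := h1.exists_eq hf hv
  exact ⟨w, h2, by rw [← transpose_transpose Y, h3, transpose_vecMulVec]⟩

theorem Adj.cases_left {v f : Fin 3 → F} (hv : v ≠ 0) (hf : f ≠ 0)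
    {Y : Matrix (Fin 3) (Fin 3) F} (h : Adj (v ⊠ f) Y) :
    (∃ c : F, c ≠ 0 ∧ c ≠ 1 ∧ Y = v ⊠ (c • f)) ∨ (∃ g, f ⨯₃ g = v ∧ Y = v ⊠ g) ∨
      (∃ w, v ⨯₃ w = f ∧ Y = w ⊠ f) := by
  rcases h with h | h | h
  · exact Or.inl h.exists_eq
  · exact Or.inr (Or.inl (h.exists_eq hv hf))
  · exact Or.inr (Or.inr (h.exists_eq hv hf))

omit [FieldFour F] in
theorem adj_smul {v f : Fin 3 → F} (hv : v ≠ 0) (hf : f ≠ 0) (h : f ⬝ᵥ v = 0) {c : F}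
    (h0 : c ≠ 0) (h1 : c ≠ 1) : Adj (v ⊠ f) (v ⊠ (c • f)) :=
  Or.inl ⟨isElation_vecMulVec hv hf h, c, h0, h1, vecMulVec_smul _ _ _⟩

omit [FieldFour F] in
theorem vecMulVec_right_injective {v f g : Fin 3 → F} (hv : v ≠ 0) (h : v ⊠ f = v ⊠ g) :
    f = g := by
  obtain ⟨i, hi⟩ := Function.ne_iff.mp hv
  ext j
  have := congrFun (congrFun h i) j
  simp only [vecMulVec_apply] at this
  exact mul_left_cancel₀ hi this

/-- Collinearity of elations with the same center. -/
theorem adj_center_iff {v f g : Fin 3 → F} (hv : v ≠ 0) (hf : f ≠ 0) (hfg : f ⨯₃ g ≠ 0) :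
    Adj (v ⊠ f) (v ⊠ g) ↔ f ⨯₃ g = v := by
  refine ⟨fun h => ?_, adj_of_cross_center hv⟩
  rcases h.cases_left hv hf with ⟨c, -, -, h⟩ | ⟨g', h1, h2⟩ | ⟨w, h1, h2⟩
  · rw [vecMulVec_right_injective hv h] at hfg
    simp at hfg
  · rwa [vecMulVec_right_injective hv h2]
  · obtain ⟨c, -, -, rfl⟩ := vecMulVec_eq_iff hv (right_ne_zero_of_cross hfg) h2
    simp at hfg

/-! ### Geodesics of length two with a unique midpoint -/

/-- `Y` is collinear with `X` and `Z` and is the unique such point. -/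
def IsMid (X Y Z : Matrix (Fin 3) (Fin 3) F) : Prop :=
  Adj X Y ∧ Adj Y Z ∧ X ≠ Z ∧ ¬ Adj X Z ∧ ∀ U, Adj X U → Adj U Z → U = Y

omit [FieldFour F] in
theorem IsMid.transpose {X Y Z : Matrix (Fin 3) (Fin 3) F} (h : IsMid X Y Z) :
    IsMid Xᵀ Yᵀ Zᵀ := by
  obtain ⟨h1, h2, h3, h4, h5⟩ := h
  refine ⟨h1.transpose, h2.transpose, fun h => h3 (transpose_injective h),
    fun h => h4 (adj_transpose_iff.mp h), fun U h6 h7 => ?_⟩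
  rw [← h5 Uᵀ (by simpa using h6.transpose) (by simpa using h7.transpose), transpose_transpose]

/-- The outer elations share neither center nor axis, so a common neighbor takes its center from one
of them and its axis from the other. Center `w` with axis `f` would need `v ⨯₃ w` parallel to `f`,
but it equals `g`. With center `v` and axis `g`, the normalization of the cross product fixes the
scalar. -/
theorem isMid_of_cross {v f g w : Fin 3 → F} (hv : v ≠ 0) (hg : g ≠ 0) (h1 : f ⨯₃ g = v)
    (h2 : v ⨯₃ w = g) : IsMid (v ⊠ f) (v ⊠ g) (w ⊠ g) := by
  have hf : f ≠ 0 := by rintro rfl; simp at h1; exact hv h1.symm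
  have hw : w ≠ 0 := by rintro rfl; simp at h2; exact hg h2.symm
  have center : ∀ k, w ⊠ g ≠ v ⊠ k := by
    intro k h
    obtain ⟨d, -, rfl, -⟩ := vecMulVec_eq_iff hw hg h
    simp at h2
    exact hg h2.symm
  have axis : ∀ x (c : F), w ⊠ g ≠ x ⊠ (c • f) := by
    intro x c h
    obtain ⟨d, -, -, rfl⟩ := vecMulVec_eq_iff hw hg h
    simp at h1
    exact hv h1.symm
  have axis' : ∀ x, w ⊠ g ≠ x ⊠ f := fun x h => axis x 1 (by rwa [one_smul])
  refine ⟨adj_of_cross_center hv h1, adj_of_cross_axis hg h2, fun h => center _ h.symm,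
    fun h => ?_, fun U h3 h4 => ?_⟩
  · rcases h.cases_left hv hf with ⟨c, -, -, h⟩ | ⟨g', -, h⟩ | ⟨w', -, h⟩
    · exact center _ h
    · exact center _ h
    · exact axis' _ h
  · rcases h3.cases_left hv hf with ⟨c, hc, -, rfl⟩ | ⟨g', h5, rfl⟩ | ⟨x, h5, rfl⟩
    · rcases h4.cases_left hv (smul_ne_zero hc hf) with ⟨d, -, -, h⟩ | ⟨k, -, h⟩ | ⟨w', -, h⟩
      · exact absurd h (center _)
      · exact absurd h (center _)
      · exact absurd h (axis _ _)
    · have hg' : g' ≠ 0 := by rintro rfl; simp at h5; exact hv h5.symm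
      rcases h4.cases_left hv hg' with ⟨d, -, -, h⟩ | ⟨k, -, h⟩ | ⟨w', h6, h⟩
      · exact absurd h (center _)
      · exact absurd h (center _)
      · obtain ⟨d, hd, h7, h8⟩ := vecMulVec_eq_iff hw hg h
        rw [h8, map_smul, h5] at h1
        have : d = 1 := smul_left_injective F hv (by simpa using h1)
        rw [h8, this, one_smul]
    · have hx : x ≠ 0 := by rintro rfl; simp at h5; exact hf h5.symm
      rcases h4.cases_left hx hf with ⟨d, -, -, h⟩ | ⟨k, h6, h⟩ | ⟨w', -, h⟩
      · exact absurd h (axis _ _)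
      · obtain ⟨d, hd, h7, h8⟩ := vecMulVec_eq_iff hw hg h
        rw [h7, map_smul, h2] at h5
        rw [← h5] at h1
        simp at h1
        exact absurd h1.symm hv
      · exact absurd h (axis' _)

/-- Let `X = c • Y`. A neighbor `Z` of `Y` with the same center and axis equals `X` or is collinear
with it. For any other neighbor `Z` of `Y`, the multiple `c⁻¹ • Z` is a second common neighbor of
`X` and `Z`. -/
theorem not_isMid_of_isScaled {X Y Z : Matrix (Fin 3) (Fin 3) F} (hYX : IsScaled Y X) :
    ¬ IsMid X Y Z := by
  rintro ⟨h1, h2, h3, h4, h5⟩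
  obtain ⟨v, f, hv, hf, hvf, rfl⟩ := hYX.1
  obtain ⟨c, hc0, hc1, rfl⟩ := hYX.exists_eq
  have hcf : c • f ≠ 0 := smul_ne_zero hc0 hf
  have hci : c⁻¹ ≠ 1 := fun h => hc1 (inv_eq_one.mp h)
  rcases h2.cases_left hv hf with ⟨d, hd0, -, rfl⟩ | ⟨g, h6, rfl⟩ | ⟨w, h6, rfl⟩
  · apply h4
    have h : d • f = (d * c⁻¹) • (c • f) := by
      rw [smul_smul, mul_assoc, inv_mul_cancel₀ hc0, mul_one]
    rw [h]
    refine adj_smul hv hcf (by rw [smul_dotProduct, hvf, smul_zero])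
      (mul_ne_zero hd0 (inv_ne_zero hc0)) (fun h' => h3 ?_)
    rw [h, h', one_smul]
  · have hg : g ≠ 0 := by rintro rfl; simp at h6; exact hv h6.symm
    have hgv : g ⬝ᵥ v = 0 := by rw [← h6, right_dot_cross]
    have h := h5 (v ⊠ (c⁻¹ • g)) (adj_of_cross_center hv (by
      rw [cross_smul_smul, mul_inv_cancel₀ hc0, one_smul, h6]))
      (adj_smul hv hg hgv (inv_ne_zero hc0) hci).symm
    rw [← vecMulVec_right_injective hv h] at h6
    simp at h6
    exact hv h6.symm
  · have hw : w ≠ 0 := by rintro rfl; simp at h6; exact hf h6.symm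
    have hwf : f ⬝ᵥ w = 0 := by rw [← h6, dotProduct_comm, right_dot_cross]
    have e1 : v ⊠ (c • f) = (c • v) ⊠ f := by rw [vecMulVec_smul, smul_vecMulVec]
    have e2 : (c⁻¹ • w) ⊠ f = w ⊠ (c⁻¹ • f) := by rw [vecMulVec_smul, smul_vecMulVec]
    have h := h5 ((c⁻¹ • w) ⊠ f) (e1 ▸ adj_of_cross_axis hf (by
      rw [cross_smul_smul, mul_inv_cancel₀ hc0, one_smul, h6]))
      (e2 ▸ (adj_smul hw hf hwf (inv_ne_zero hc0) hci).symm)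
    obtain ⟨d, -, h7, -⟩ := vecMulVec_eq_iff hv hf h.symm
    have h8 : w = (c * d) • v := by
      rw [mul_smul, ← h7, smul_smul, mul_inv_cancel₀ hc0, one_smul]
    rw [h8] at h6
    simp at h6
    exact hf h6.symm

/-- A unique midpoint forces alternation: after a step with common center comes a step with common
axis. Otherwise `Z` has center `v` too, and then `X = Z`, or `X` and `Z` are collinear, or a
nontrivial multiple of `X` is another common neighbor. -/
theorem IsMid.exists_eq {v f g : Fin 3 → F} (hv : v ≠ 0) (h1 : f ⨯₃ g = v)
    {Z : Matrix (Fin 3) (Fin 3) F} (h : IsMid (v ⊠ f) (v ⊠ g) Z) :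
    ∃ w, v ⨯₃ w = g ∧ Z = w ⊠ g := by
  have hg : g ≠ 0 := by rintro rfl; simp at h1; exact hv h1.symm
  have hf : f ≠ 0 := by rintro rfl; simp at h1; exact hv h1.symm
  have hfv : f ⬝ᵥ v = 0 := by rw [← h1, left_dot_cross]
  have hgv : g ⬝ᵥ v = 0 := by rw [← h1, right_dot_cross]
  obtain ⟨-, h2, h3, h4, h5⟩ := h
  rcases h2.cases_left hv hg with ⟨c, hc0, hc1, rfl⟩ | ⟨k, h6, rfl⟩ | h6
  · have h := h5 (v ⊠ (c⁻¹ • f)) (adj_smul hv hf hfv (inv_ne_zero hc0)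
      (fun h => hc1 (inv_eq_one.mp h))) (adj_of_cross_center hv (by
      rw [cross_smul_smul, inv_mul_cancel₀ hc0, one_smul, h1]))
    rw [← vecMulVec_right_injective hv h] at h1
    simp at h1
    exact absurd h1.symm hv
  · have h7 : g ⨯₃ (f + k) = 0 := by
      rw [map_add, h6, cross_comm, h1, ← two_smul F, two_eq_zero, zero_smul]
    obtain ⟨a, ha⟩ := exists_smul_of_cross_eq_zero hg h7
    have hk : k = f + a • g := by
      rw [← ha, ← add_assoc, ← two_smul F, two_eq_zero, zero_smul, zero_add]
    subst hk
    have ha0 : a ≠ 0 := by rintro rfl; simp at h3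
    by_cases ha1 : a = 1
    · exact absurd (adj_of_cross_center hv (by simp [ha1, h1])) h4
    -- With `k = f + a • g`, the factor `a⁻¹` makes `(a⁻¹ • f) ⨯₃ k = v`.
    · have h := h5 (v ⊠ (a⁻¹ • f)) (adj_smul hv hf hfv (inv_ne_zero ha0)
        (fun h => ha1 (inv_eq_one.mp h))) (adj_of_cross_center hv (by
        simp [h1, smul_smul, ha0]))
      rw [← vecMulVec_right_injective hv h] at h1
      simp at h1
      exact absurd h1.symm hv
  · exact h6

theorem IsMid.exists_eq' {v w f : Fin 3 → F} (hf : f ≠ 0) (h1 : v ⨯₃ w = f)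
    {Z : Matrix (Fin 3) (Fin 3) F} (h : IsMid (v ⊠ f) (w ⊠ f) Z) :
    ∃ g, f ⨯₃ g = w ∧ Z = w ⊠ g := by
  have h2 := h.transpose
  simp only [transpose_vecMulVec] at h2
  obtain ⟨g, h3, h4⟩ := h2.exists_eq hf h1
  exact ⟨g, h3, by rw [← transpose_transpose Z, h4, transpose_vecMulVec]⟩

theorem isMid_of_cross' {v w f g : Fin 3 → F} (hw : w ≠ 0) (hf : f ≠ 0) (h1 : v ⨯₃ w = f)
    (h2 : f ⨯₃ g = w) : IsMid (v ⊠ f) (w ⊠ f) (w ⊠ g) := by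
  have h := (isMid_of_cross hf hw h1 h2).transpose
  simpa only [transpose_vecMulVec] using h

/-- Among collinear pairs, the scaled ones are those which do not extend to a geodesic with a
unique midpoint. -/
theorem isScaled_iff {X Y : Matrix (Fin 3) (Fin 3) F} :
    IsScaled X Y ↔ Adj X Y ∧ ∀ Z, ¬ IsMid X Y Z := by
  refine ⟨fun h => ⟨Or.inl h, fun Z => not_isMid_of_isScaled h.symm⟩, fun ⟨h1, h2⟩ => ?_⟩
  rcases h1 with h | ⟨f, g, h, rfl, rfl⟩ | ⟨v, w, h, rfl, rfl⟩
  · exact h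
  · obtain ⟨w, hw⟩ := exists_cross_eq h (right_dot_cross f g)
    exact absurd (isMid_of_cross h (right_ne_zero_of_cross h) rfl hw) (h2 _)
  · obtain ⟨g, hg⟩ := exists_cross_eq h (right_dot_cross v w)
    exact absurd (isMid_of_cross' (right_ne_zero_of_cross h) h rfl hg) (h2 _)

end Elations

/-! ### Automorphisms of the collinearity structure -/

section Automorphisms

variable {F : Type*} [Field F]

/-- `θ` maps elations to elations, and lines `{X, Y, X + Y}` to lines. -/
structure LinePreserving (θ : Matrix (Fin 3) (Fin 3) F → Matrix (Fin 3) (Fin 3) F) : Prop where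
  isElation : ∀ X, IsElation X → IsElation (θ X)
  adj : ∀ X Y, Adj X Y → Adj (θ X) (θ Y)
  add : ∀ X Y, Adj X Y → θ (X + Y) = θ X + θ Y

/-- `θ` and `η` preserve lines and are inverse to each other on elations. -/
structure LineAut (θ η : Matrix (Fin 3) (Fin 3) F → Matrix (Fin 3) (Fin 3) F) : Prop where
  left : LinePreserving θ
  right : LinePreserving η
  left_inv : ∀ X, IsElation X → η (θ X) = X
  right_inv : ∀ X, IsElation X → θ (η X) = X

variable {θ η : Matrix (Fin 3) (Fin 3) F → Matrix (Fin 3) (Fin 3) F}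

theorem LineAut.symm (h : LineAut θ η) : LineAut η θ := ⟨h.right, h.left, h.right_inv, h.left_inv⟩

theorem LinePreserving.comp {ψ : Matrix (Fin 3) (Fin 3) F → Matrix (Fin 3) (Fin 3) F}
    (hθ : LinePreserving θ) (hψ : LinePreserving ψ) : LinePreserving (fun X => θ (ψ X)) where
  isElation X h := hθ.isElation _ (hψ.isElation X h)
  adj X Y h := hθ.adj _ _ (hψ.adj X Y h)
  add X Y h := by rw [hψ.add X Y h, hθ.add _ _ (hψ.adj X Y h)]

theorem linePreserving_transpose :
    LinePreserving (fun X : Matrix (Fin 3) (Fin 3) F => Xᵀ) where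
  isElation _ h := h.transpose
  adj _ _ h := h.transpose
  add _ _ _ := transpose_add _ _

theorem LineAut.comp {θ' η' : Matrix (Fin 3) (Fin 3) F → Matrix (Fin 3) (Fin 3) F}
    (h : LineAut θ η) (h' : LineAut θ' η') :
    LineAut (fun X => θ (θ' X)) (fun X => η' (η X)) where
  left := h.left.comp h'.left
  right := h'.right.comp h.right
  left_inv X hX := by rw [h.left_inv _ (h'.left.isElation X hX), h'.left_inv X hX]
  right_inv X hX := by rw [h'.right_inv _ (h.right.isElation X hX), h.right_inv X hX]

theorem lineAut_transpose :
    LineAut (fun X : Matrix (Fin 3) (Fin 3) F => Xᵀ) (fun X => Xᵀ) :=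
  ⟨linePreserving_transpose, linePreserving_transpose, fun X _ => transpose_transpose X,
    fun X _ => transpose_transpose X⟩

theorem LineAut.isMid (h : LineAut θ η) {X Y Z : Matrix (Fin 3) (Fin 3) F} (hm : IsMid X Y Z) :
    IsMid (θ X) (θ Y) (θ Z) := by
  obtain ⟨h1, h2, h3, h4, h5⟩ := hm
  have hX := h1.isElation_left
  have hZ := h2.isElation_right
  refine ⟨h.left.adj _ _ h1, h.left.adj _ _ h2, fun e => h3 ?_, fun e => h4 ?_, fun U h6 h7 => ?_⟩
  · rw [← h.left_inv X hX, e, h.left_inv Z hZ]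
  · have := h.right.adj _ _ e
    rwa [h.left_inv X hX, h.left_inv Z hZ] at this
  · have h8 := h.right.adj _ _ h6
    have h9 := h.right.adj _ _ h7
    rw [h.left_inv X hX] at h8
    rw [h.left_inv Z hZ] at h9
    rw [← h5 _ h8 h9, h.right_inv U h6.isElation_right]

variable [FieldFour F]

/-- By `isScaled_iff` this relation is expressed through collinearity alone. -/
theorem LineAut.isScaled (h : LineAut θ η) {X Y : Matrix (Fin 3) (Fin 3) F}
    (hs : IsScaled X Y) : IsScaled (θ X) (θ Y) := by
  rw [isScaled_iff] at hs ⊢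
  refine ⟨h.left.adj _ _ hs.1, fun Z hZ => hs.2 (η Z) ?_⟩
  have := h.symm.isMid hZ
  rwa [h.left_inv X hs.1.isElation_left, h.left_inv Y hs.1.isElation_right] at this

/-! ### Fixed flags -/

/-- `θ` fixes all elations with center `v` and axis `f`. -/
def FixFlag (θ : Matrix (Fin 3) (Fin 3) F → Matrix (Fin 3) (Fin 3) F) (v f : Fin 3 → F) : Prop :=
  ∀ c : F, c ≠ 0 → θ (v ⊠ (c • f)) = v ⊠ (c • f)

omit [FieldFour F] in
theorem FixFlag.smul {v f : Fin 3 → F} (h : FixFlag θ v f) {a : F} (ha : a ≠ 0) :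
    FixFlag θ v (a • f) := fun c hc => by
  rw [smul_smul]
  exact h _ (mul_ne_zero hc ha)

omit [FieldFour F] in
theorem FixFlag.eq {v f : Fin 3 → F} (h : FixFlag θ v f) : θ (v ⊠ f) = v ⊠ f := by
  simpa using h 1 one_ne_zero

omit [FieldFour F] in
theorem fixFlag_transpose {v f : Fin 3 → F} :
    FixFlag (fun X => (θ Xᵀ)ᵀ) f v ↔ FixFlag θ v f := by
  refine forall₂_congr fun c hc => ?_
  rw [← transpose_inj, transpose_transpose, transpose_vecMulVec, smul_vecMulVec,
    ← vecMulVec_smul]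

theorem LineAut.exists_smul (h : LineAut θ η) {v f k : Fin 3 → F} (hv : v ≠ 0) (hf : f ≠ 0)
    (hvf : f ⬝ᵥ v = 0) (hk : θ (v ⊠ f) = v ⊠ k) {c : F} (h0 : c ≠ 0) (h1 : c ≠ 1) :
    ∃ d : F, d ≠ 0 ∧ d ≠ 1 ∧ θ (v ⊠ (c • f)) = v ⊠ (d • k) := by
  have hs : IsScaled (v ⊠ f) (v ⊠ (c • f)) :=
    ⟨isElation_vecMulVec hv hf hvf, c, h0, h1, vecMulVec_smul _ _ _⟩
  have := h.isScaled hs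
  rw [hk] at this
  exact this.exists_eq

/-- One fixed elation is enough on the second flag: `θ` moves `v ⊠ (c • g)` to some `v ⊠ (d • g)`,
and collinearity with the fixed elation `v ⊠ (c⁻¹ • f)` forces `d = c`. -/
theorem LineAut.fixFlag_of_cross (h : LineAut θ η) {v f g : Fin 3 → F} (hv : v ≠ 0)
    (hfg : f ⨯₃ g = v) (hf : FixFlag θ v f) (hg : θ (v ⊠ g) = v ⊠ g) : FixFlag θ v g := by
  intro c hc
  by_cases hc1 : c = 1
  · rw [hc1, one_smul, hg]
  have hg0 : g ≠ 0 := by rintro rfl; simp at hfg; exact hv hfg.symm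
  have hf0 : f ≠ 0 := by rintro rfl; simp at hfg; exact hv hfg.symm
  obtain ⟨d, hd0, hd1, hd⟩ := h.exists_smul hv hg0 (by rw [← hfg, right_dot_cross]) hg hc hc1
  have h1 : Adj (v ⊠ (c⁻¹ • f)) (v ⊠ (c • g)) := adj_of_cross_center hv (by
    rw [cross_smul_smul, inv_mul_cancel₀ hc, one_smul, hfg])
  have h2 := h.left.adj _ _ h1
  rw [hf _ (inv_ne_zero hc), hd, adj_center_iff hv (smul_ne_zero (inv_ne_zero hc) hf0)
    (by rw [cross_smul_smul, hfg]; exact smul_ne_zero (mul_ne_zero (inv_ne_zero hc) hd0) hv),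
    cross_smul_smul, hfg] at h2
  have h3 : c⁻¹ * d = 1 := smul_left_injective F hv (by simpa using h2)
  have h4 : d = c := by field_simp at h3; exact h3
  rw [hd, h4]

/-- Scale so that `f ⨯₃ g = v`, and write an axis as `k = a • f + b • g`. If `a` and `b` are
nonzero, some multiple of `v ⊠ k` is the third point on a line through two fixed elations. This
leaves a scalar for `v ⊠ k` itself, which collinearity with the fixed elation `v ⊠ (b⁻¹ • f)`
determines. -/
theorem LineAut.fixFlag_center (h : LineAut θ η) {v f g : Fin 3 → F} (hv : v ≠ 0)
    (hfv : f ⬝ᵥ v = 0) (hgv : g ⬝ᵥ v = 0) (hfg : f ⨯₃ g ≠ 0) (hf : FixFlag θ v f)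
    (hg : FixFlag θ v g) {k : Fin 3 → F} (hk0 : k ≠ 0) (hk : k ⬝ᵥ v = 0) : FixFlag θ v k := by
  obtain ⟨δ, hδ⟩ := exists_cross_eq_smul hv hfv hgv
  have hδ0 : δ ≠ 0 := by rintro rfl; rw [zero_smul] at hδ; exact hfg hδ
  wlog hδ1 : δ = 1 generalizing f δ
  · refine this (f := δ⁻¹ • f) (by rw [smul_dotProduct, hfv, smul_zero]) ?_
      (hf.smul (inv_ne_zero hδ0)) 1 ?_ one_ne_zero rfl
    · rw [map_smul, LinearMap.smul_apply]
      exact smul_ne_zero (inv_ne_zero hδ0) hfg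
    · rw [map_smul, LinearMap.smul_apply, hδ, smul_smul, inv_mul_cancel₀ hδ0]
  rw [hδ1, one_smul] at hδ
  suffices H : ∀ k : Fin 3 → F, k ≠ 0 → k ⬝ᵥ v = 0 → θ (v ⊠ k) = v ⊠ k by
    intro c hc
    exact H _ (smul_ne_zero hc hk0) (by rw [smul_dotProduct, hk, smul_zero])
  clear hk hk0 k
  intro k hk0 hk
  rw [← hδ] at hk
  obtain ⟨a, b, rfl⟩ := exists_eq_smul_add_smul hfg hk
  rw [hδ] at hk
  by_cases ha : a = 0
  · have hb : b ≠ 0 := by rintro rfl; simp [ha] at hk0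
    rw [ha, zero_smul, zero_add]
    exact hg b hb
  by_cases hb : b = 0
  · rw [hb, zero_smul, add_zero]
    exact hf a ha
  -- With this `c` the vectors `(c * a) • f` and `(c * b) • g` have cross product exactly `v`.
  obtain ⟨c, hc⟩ := exists_sq_eq (a * b)⁻¹
  have hab : a * b ≠ 0 := mul_ne_zero ha hb
  have hc0 : c ≠ 0 := by rintro rfl; simp [eq_comm, ha, hb] at hc
  have hcab : (c * a) * (c * b) = 1 := by
    calc (c * a) * (c * b) = c ^ 2 * (a * b) := by ring
      _ = 1 := by rw [hc, inv_mul_cancel₀ hab]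
  have fixed : θ (v ⊠ (c • (a • f + b • g))) = v ⊠ (c • (a • f + b • g)) := by
    have e : v ⊠ (c • (a • f + b • g)) = v ⊠ ((c * a) • f) + v ⊠ ((c * b) • g) := by
      rw [← vecMulVec_add, smul_add, smul_smul, smul_smul]
    rw [e, h.left.add _ _ (adj_of_cross_center hv (by
      rw [cross_smul_smul, hcab, one_smul, hδ])), hf _ (mul_ne_zero hc0 ha),
      hg _ (mul_ne_zero hc0 hb)]
  by_cases hc1 : c = 1
  · simpa [hc1] using fixed
  obtain ⟨d, hd0, -, hd⟩ := h.exists_smul hv (smul_ne_zero hc0 hk0)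
    (by rw [smul_dotProduct, hk, smul_zero]) fixed (inv_ne_zero hc0)
    (fun h => hc1 (inv_eq_one.mp h))
  rw [smul_smul, inv_mul_cancel₀ hc0, one_smul, smul_smul] at hd
  have h1 : (b⁻¹ • f) ⨯₃ (a • f + b • g) = v := by
    simp [smul_smul, hb, hδ]
  have h2 := h.left.adj _ _ (adj_of_cross_center hv h1)
  have hf0 : f ≠ 0 := left_ne_zero_of_cross hfg
  have h3 : (b⁻¹ • f) ⨯₃ ((d * c) • (a • f + b • g)) = (d * c) • v := by
    rw [map_smul, h1]
  rw [hf _ (inv_ne_zero hb), hd, adj_center_iff hv (smul_ne_zero (inv_ne_zero hb) hf0)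
    (by rw [h3]; exact smul_ne_zero (mul_ne_zero hd0 hc0) hv), h3] at h2
  have h4 : d * c = 1 := smul_left_injective F hv (by simpa using h2)
  rw [hd, h4, one_smul]

/-- Each elation of the middle flag is the unique midpoint of suitable elations of the two fixed
flags. -/
theorem LineAut.fixFlag_mid (h : LineAut θ η) {v w f g : Fin 3 → F} (hfv : f ⬝ᵥ v = 0)
    (hgv : g ⬝ᵥ v = 0) (hgw : g ⬝ᵥ w = 0) (hfg : f ⨯₃ g ≠ 0) (hvw : v ⨯₃ w ≠ 0)
    (hf : FixFlag θ v f) (hg : FixFlag θ w g) : FixFlag θ v g := by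
  intro c hc
  have hv := left_ne_zero_of_cross hvw
  have hg0 := right_ne_zero_of_cross hfg
  obtain ⟨a, ha⟩ := exists_cross_eq_smul hv hfv hgv
  obtain ⟨b, hb⟩ := exists_cross_eq_smul hg0 (by rw [dotProduct_comm, hgv] : v ⬝ᵥ g = 0)
    (by rw [dotProduct_comm, hgw] : w ⬝ᵥ g = 0)
  have ha0 : a ≠ 0 := by rintro rfl; rw [zero_smul] at ha; exact hfg ha
  have hb0 : b ≠ 0 := by rintro rfl; rw [zero_smul] at hb; exact hvw hb
  -- The coefficients give the cross products `v` and `c • g` required of a midpoint `v ⊠ (c • g)`.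
  have hm := isMid_of_cross (f := (a⁻¹ * c⁻¹) • f) (g := c • g) (w := (c * b⁻¹) • w) hv
    (smul_ne_zero hc hg0) (by rw [cross_smul_smul, ha, smul_smul]; field_simp; simp)
    (by rw [map_smul, hb, smul_smul]; field_simp)
  obtain ⟨h1, h2, -, -, h5⟩ := hm
  apply h5
  · have := h.left.adj _ _ h1
    rwa [hf _ (mul_ne_zero (inv_ne_zero ha0) (inv_ne_zero hc))] at this
  · have e : ((c * b⁻¹) • w) ⊠ (c • g) = w ⊠ ((c * b⁻¹ * c) • g) := by
      rw [smul_vecMulVec, ← vecMulVec_smul, smul_smul]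
    have := h.left.adj _ _ h2
    rwa [e, hg _ (by simp [hc, hb0]), ← e] at this

omit [FieldFour F] in
-- Duality: conjugating with transposition turns statements on a common center into statements on a
-- common axis.
theorem LineAut.transpose (h : LineAut θ η) :
    LineAut (fun X => (θ Xᵀ)ᵀ) (fun X => (η Xᵀ)ᵀ) :=
  lineAut_transpose.comp (h.comp lineAut_transpose)

theorem LineAut.fixFlag_of_cross' (h : LineAut θ η) {v w f : Fin 3 → F} (hf : f ≠ 0)
    (hvw : v ⨯₃ w = f) (hv : FixFlag θ v f) (hw : θ (w ⊠ f) = w ⊠ f) : FixFlag θ w f := by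
  rw [← fixFlag_transpose] at hv ⊢
  exact h.transpose.fixFlag_of_cross hf hvw hv (by
    rw [transpose_vecMulVec, hw, transpose_vecMulVec])

theorem LineAut.fixFlag_axis (h : LineAut θ η) {v w f : Fin 3 → F} (hf : f ≠ 0)
    (hfv : f ⬝ᵥ v = 0) (hfw : f ⬝ᵥ w = 0) (hvw : v ⨯₃ w ≠ 0) (hv : FixFlag θ v f)
    (hw : FixFlag θ w f) {k : Fin 3 → F} (hk0 : k ≠ 0) (hk : f ⬝ᵥ k = 0) : FixFlag θ k f := by
  rw [← fixFlag_transpose] at hv hw ⊢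
  rw [dotProduct_comm] at hfv hfw hk
  exact h.transpose.fixFlag_center hf hfv hfw hvw hv hw hk0 hk

/-- The standard basis. -/
def stdVec (F : Type*) [Field F] (i : Fin 3) : Fin 3 → F := Pi.single i 1

omit [FieldFour F] in
theorem stdVec_cross (i : Fin 3) : stdVec F i ⨯₃ stdVec F (i + 1) = stdVec F (i + 2) := by
  ext j
  fin_cases i <;> fin_cases j <;> simp [stdVec, cross_apply]

omit [FieldFour F] in
theorem stdVec_dot_self (i : Fin 3) : stdVec F i ⬝ᵥ stdVec F i = 1 := by
  simp [stdVec]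

omit [FieldFour F] in
theorem stdVec_dot {i j : Fin 3} (h : i ≠ j) : stdVec F i ⬝ᵥ stdVec F j = 0 := by
  simp [stdVec, h.symm]

omit [FieldFour F] in
theorem stdVec_ne_zero (i : Fin 3) : stdVec F i ≠ 0 := by simp [stdVec]

/-- The fixed flags of the coordinate triangle spread to all flags at a vertex and all flags on a
side, then to all flags whose center lies on a side. A general axis meets two sides in distinct
points, so its flags are fixed as well. -/
theorem LineAut.eq_self_of_fixFlag (h : LineAut θ η)
    (hfix : ∀ i j, i ≠ j → FixFlag θ (stdVec F i) (stdVec F j))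
    {X : Matrix (Fin 3) (Fin 3) F} (hX : IsElation X) : θ X = X := by
  have ne1 : ∀ i : Fin 3, i ≠ i + 1 := by decide
  have ne2 : ∀ i : Fin 3, i ≠ i + 2 := by decide
  have cross12 : ∀ i, stdVec F (i + 1) ⨯₃ stdVec F (i + 2) = stdVec F i := by
    intro i
    have := stdVec_cross (F := F) (i + 1)
    rwa [add_assoc, add_assoc, show (1 : Fin 3) + 1 = 2 from rfl, show (1 : Fin 3) + 2 = 0 from rfl,
      add_zero] at this
  have centers : ∀ i k, k ≠ 0 → k ⬝ᵥ stdVec F i = 0 → FixFlag θ (stdVec F i) k :=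
    fun i k h0 hk => h.fixFlag_center (stdVec_ne_zero i) (stdVec_dot (ne1 i).symm)
      (stdVec_dot (ne2 i).symm) (by rw [cross12]; exact stdVec_ne_zero i)
      (hfix _ _ (ne1 i)) (hfix _ _ (ne2 i)) h0 hk
  have axes : ∀ j v, v ≠ 0 → stdVec F j ⬝ᵥ v = 0 → FixFlag θ v (stdVec F j) :=
    fun i k h0 hk => h.fixFlag_axis (stdVec_ne_zero i) (stdVec_dot (ne1 i))
      (stdVec_dot (ne2 i)) (by rw [cross12]; exact stdVec_ne_zero i)
      (hfix _ _ (ne1 i).symm) (hfix _ _ (ne2 i).symm) h0 hk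
  have sides : ∀ j v k, v ≠ 0 → stdVec F j ⬝ᵥ v = 0 → k ≠ 0 → k ⬝ᵥ v = 0 → FixFlag θ v k := by
    intro j v k hv hvj hk hkv
    -- The line `v ⨯₃ stdVec F j` joins `v` to the vertex opposite side `j`. Its flag at `v` lies
    -- between a fixed flag on the side and a fixed flag at the vertex.
    have e : stdVec F j ⨯₃ (v ⨯₃ stdVec F j) = v := by
      rw [cross_cross_eq_smul_sub_smul', stdVec_dot_self, dotProduct_comm v, hvj, one_smul,
        zero_smul, sub_zero]
    have hg : v ⨯₃ stdVec F j ≠ 0 := by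
      intro h0; rw [h0] at e; simp at e; exact hv e.symm
    have hgv : v ⨯₃ stdVec F j ⬝ᵥ v = 0 := by rw [dotProduct_comm, left_dot_cross]
    have hgj : v ⨯₃ stdVec F j ⬝ᵥ stdVec F j = 0 := by rw [dotProduct_comm, right_dot_cross]
    have h1 : FixFlag θ v (v ⨯₃ stdVec F j) :=
      h.fixFlag_mid hvj hgv hgj (by rwa [e]) hg (axes j v hv hvj) (centers j _ hg hgj)
    exact h.fixFlag_center hv hvj hgv (by rwa [e]) (axes j v hv hvj) h1 hk hkv
  obtain ⟨v, f, hv, hf, hfv, rfl⟩ := hX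
  -- When `f i ≠ 0`, the intersections of `f` with the sides `i + 1` and `i + 2` are distinct, since
  -- their cross product is `f i • f`.
  obtain ⟨i, hi⟩ := Function.ne_iff.mp hf
  have e : (f ⨯₃ stdVec F (i + 1)) ⨯₃ (f ⨯₃ stdVec F (i + 2)) = f i • f := by
    have : stdVec F i ⬝ᵥ f = f i := by simp [stdVec]
    rw [cross_cross_eq_smul_sub_smul', left_dot_cross, zero_smul, sub_zero, dotProduct_comm,
      triple_product_permutation, cross12, dotProduct_comm, this]
  have hne : (f ⨯₃ stdVec F (i + 1)) ⨯₃ (f ⨯₃ stdVec F (i + 2)) ≠ 0 := by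
    rw [e]; exact smul_ne_zero hi hf
  refine (h.fixFlag_axis hf (left_dot_cross _ _) (left_dot_cross _ _) hne ?_ ?_ hv hfv).eq
  · exact sides (i + 1) _ _ (left_ne_zero_of_cross hne) (right_dot_cross _ _) hf
      (left_dot_cross _ _)
  · exact sides (i + 2) _ _ (right_ne_zero_of_cross hne) (right_dot_cross _ _) hf
      (left_dot_cross _ _)

/-- An automorphism fixing an elation hexagon and one further elation is trivial. -/
theorem LineAut.eq_self_of_hexagon (h : LineAut θ η)
    (hfix : ∀ i j, i ≠ j → θ (stdVec F i ⊠ stdVec F j) = stdVec F i ⊠ stdVec F j)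
    {a : F} (ha0 : a ≠ 0) (ha1 : a ≠ 1)
    (ha : θ (stdVec F 0 ⊠ (a • stdVec F 1)) = stdVec F 0 ⊠ (a • stdVec F 1))
    {X : Matrix (Fin 3) (Fin 3) F} (hX : IsElation X) : θ X = X := by
  have c01 : stdVec F 0 ⨯₃ stdVec F 1 = stdVec F 2 := stdVec_cross 0
  have c12 : stdVec F 1 ⨯₃ stdVec F 2 = stdVec F 0 := stdVec_cross 1
  have c20 : stdVec F 2 ⨯₃ stdVec F 0 = stdVec F 1 := stdVec_cross 2
  have h01 : FixFlag θ (stdVec F 0) (stdVec F 1) := by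
    intro c hc
    by_cases hc1 : c = 1
    · simpa [hc1] using hfix 0 1 (by decide)
    by_cases hca : c = a
    · rw [hca, ha]
    have d01 := stdVec_dot (F := F) (i := 1) (j := 0) (by decide)
    obtain ⟨d, hd0, hd1, hd⟩ := h.exists_smul (stdVec_ne_zero 0) (stdVec_ne_zero 1)
      d01 (hfix 0 1 (by decide)) hc hc1
    rcases eq_one_or_eq_or_eq_sq ha0 ha1 hd0 with e | e | e
    · exact absurd e hd1
    · exfalso
      -- If `d = a`, then `v ⊠ (c • f)` and the fixed `v ⊠ (a • f)`, with `v = stdVec F 0` and `f =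
      -- stdVec F 1`, have the same image, against injectivity on elations.
      have el : ∀ c : F, c ≠ 0 → IsElation (stdVec F 0 ⊠ (c • stdVec F 1)) := fun c hc =>
        isElation_vecMulVec (stdVec_ne_zero 0) (smul_ne_zero hc (stdVec_ne_zero 1))
          (by rw [smul_dotProduct, d01, smul_zero])
      have h1 := h.left_inv _ (el c hc)
      rw [hd, e, ← ha, h.left_inv _ (el a ha0)] at h1
      exact hca (smul_left_injective F (stdVec_ne_zero 1)
        (vecMulVec_right_injective (stdVec_ne_zero 0) h1)).symm
    · rcases eq_one_or_eq_or_eq_sq ha0 ha1 hc with e' | e' | e'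
      · exact absurd e' hc1
      · exact absurd e' hca
      · rw [hd, e, e']
  -- Walk around the hexagon, alternating between a common center and a common axis.
  have h02 := h.fixFlag_of_cross (stdVec_ne_zero 0) c12 h01 (hfix 0 2 (by decide))
  have h12 := h.fixFlag_of_cross' (stdVec_ne_zero 2) c01 h02 (hfix 1 2 (by decide))
  have h10 := h.fixFlag_of_cross (stdVec_ne_zero 1) c20 h12 (hfix 1 0 (by decide))
  have h20 := h.fixFlag_of_cross' (stdVec_ne_zero 0) c12 h10 (hfix 2 0 (by decide))
  have h21 := h.fixFlag_of_cross (stdVec_ne_zero 2) c01 h20 (hfix 2 1 (by decide))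
  refine h.eq_self_of_fixFlag (fun i j hij => ?_) hX
  fin_cases i <;> fin_cases j <;> first | exact absurd rfl hij | assumption

end Automorphisms

/-! ### The action of collineations and correlations on elations -/

section Action

variable {F : Type*} [Field F]

/-- The action of a collineation on elations. -/
def symMap (A : GL (Fin 3) F) (τ : F ≃+* F) (X : Matrix (Fin 3) (Fin 3) F) :
    Matrix (Fin 3) (Fin 3) F :=
  (A : Matrix (Fin 3) (Fin 3) F) * X.map τ * ((A⁻¹ : GL (Fin 3) F) : Matrix (Fin 3) (Fin 3) F)

theorem symMap_add (A : GL (Fin 3) F) (τ : F ≃+* F) (X Y : Matrix (Fin 3) (Fin 3) F) :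
    symMap A τ (X + Y) = symMap A τ X + symMap A τ Y := by
  have : (X + Y).map τ = X.map τ + Y.map τ := by ext; simp
  rw [symMap, this, mul_add, add_mul]; rfl

theorem symMap_smul (A : GL (Fin 3) F) (τ : F ≃+* F) (c : F) (X : Matrix (Fin 3) (Fin 3) F) :
    symMap A τ (c • X) = τ c • symMap A τ X := by
  have : (c • X).map τ = τ c • X.map τ := by ext; simp
  rw [symMap, this, Matrix.mul_smul, Matrix.smul_mul]; rfl

theorem symMap_vecMulVec (A : GL (Fin 3) F) (τ : F ≃+* F) (v f : Fin 3 → F) :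
    symMap A τ (v ⊠ f) = semilinMap A τ v ⊠ semilinMap (invTranspose A) τ f := by
  have : (v ⊠ f).map τ = (fun i => τ (v i)) ⊠ (fun i => τ (f i)) := by
    ext; simp [vecMulVec_apply]
  rw [symMap, this, mul_vecMulVec, vecMulVec_mul]
  congr 1
  exact (mulVec_transpose _ _).symm

theorem symMap_symMap (A B : GL (Fin 3) F) (τ σ : F ≃+* F) (X : Matrix (Fin 3) (Fin 3) F) :
    symMap A τ (symMap B σ X) = symMap (A * conjMat τ B) (τ * σ) X := by
  have h1 : ∀ Y Z : Matrix (Fin 3) (Fin 3) F, (Y * Z).map τ = Y.map τ * Z.map τ := fun Y Z =>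
    Matrix.map_mul (f := (τ : F →+* F))
  have h2 : ∀ C : GL (Fin 3) F, (C : Matrix (Fin 3) (Fin 3) F).map τ = (conjMat τ C :) :=
    fun C => rfl
  have h3 : conjMat τ B⁻¹ = (conjMat τ B)⁻¹ := map_inv _ _
  rw [symMap, symMap, symMap, h1, h1, h2, h2, _root_.mul_inv_rev, Units.val_mul, Units.val_mul,
    h3]
  simp only [mul_assoc]
  rfl

theorem symMap_one (X : Matrix (Fin 3) (Fin 3) F) : symMap 1 1 X = X := by
  simp only [symMap, inv_one, Units.val_one, one_mul, mul_one]
  ext; simp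

theorem mul_conjMat_inv (A : GL (Fin 3) F) (τ : F ≃+* F) :
    A * conjMat τ (conjMat τ⁻¹ A⁻¹) = 1 := by
  have h1 : conjMat τ (conjMat τ⁻¹ A⁻¹) = A⁻¹ := by
    apply Units.ext
    ext i j
    exact τ.apply_symm_apply _
  rw [h1, mul_inv_cancel]

theorem conjMat_inv_mul (A : GL (Fin 3) F) (τ : F ≃+* F) :
    conjMat τ⁻¹ A⁻¹ * conjMat τ⁻¹ A = 1 := by
  rw [← map_mul, inv_mul_cancel, map_one]

theorem semilinMap_ne_zero (A : GL (Fin 3) F) (τ : F ≃+* F) {v : Fin 3 → F} (hv : v ≠ 0) :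
    semilinMap A τ v ≠ 0 := fun h => hv (semilinMap_injective A τ (by rw [h, map_zero]))

theorem semilinMap_dot (A : GL (Fin 3) F) (τ : F ≃+* F) (f v : Fin 3 → F) :
    semilinMap (invTranspose A) τ f ⬝ᵥ semilinMap A τ v = τ (f ⬝ᵥ v) := by
  change (((A⁻¹ : GL (Fin 3) F) : Matrix (Fin 3) (Fin 3) F)ᵀ *ᵥ (fun i => τ (f i))) ⬝ᵥ
    ((A : Matrix (Fin 3) (Fin 3) F) *ᵥ (fun i => τ (v i))) = _
  rw [mulVec_transpose, ← dotProduct_mulVec, mulVec_mulVec, Units.inv_mul, one_mulVec]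
  simp [dotProduct]

/-- The cross product transforms by the cofactor matrix. -/
theorem cross_mulVec (M : Matrix (Fin 3) (Fin 3) F) (v w : Fin 3 → F) :
    Mᵀ *ᵥ ((M *ᵥ v) ⨯₃ (M *ᵥ w)) = M.det • v ⨯₃ w := by
  ext i
  fin_cases i <;> simp [mulVec, dotProduct, Fin.sum_univ_three, cross_apply, det_fin_three] <;> ring

/-- For determinant one the cofactor matrix is the inverse transpose. This is the reason why the
group preserves the normalization in `IsCentered` and `IsAxial`. -/
theorem semilinMap_cross {A : GL (Fin 3) F} (hA : (A : Matrix (Fin 3) (Fin 3) F).det = 1)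
    (τ : F ≃+* F) (v w : Fin 3 → F) :
    semilinMap A τ v ⨯₃ semilinMap A τ w = semilinMap (invTranspose A) τ (v ⨯₃ w) := by
  have h := cross_mulVec (A : Matrix (Fin 3) (Fin 3) F) (fun i => τ (v i)) (fun i => τ (w i))
  have h2 : (fun i => τ ((v ⨯₃ w) i)) = (fun i => τ (v i)) ⨯₃ (fun i => τ (w i)) := by
    ext i
    fin_cases i <;> simp [cross_apply]
  rw [hA, one_smul, ← h2] at h
  change _ = ((A⁻¹ : GL (Fin 3) F) : Matrix (Fin 3) (Fin 3) F)ᵀ *ᵥ (fun i => τ ((v ⨯₃ w) i))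
  rw [← h, mulVec_mulVec, ← transpose_mul, Units.mul_inv, transpose_one, one_mulVec]
  rfl

theorem semilinMap_cross' {A : GL (Fin 3) F} (hA : (A : Matrix (Fin 3) (Fin 3) F).det = 1)
    (τ : F ≃+* F) (v w : Fin 3 → F) :
    semilinMap (invTranspose A) τ v ⨯₃ semilinMap (invTranspose A) τ w =
      semilinMap A τ (v ⨯₃ w) := by
  rw [semilinMap_cross (det_invTranspose A hA), invTranspose_invTranspose]

theorem linePreserving_symMap {A : GL (Fin 3) F}
    (hA : (A : Matrix (Fin 3) (Fin 3) F).det = 1) (τ : F ≃+* F) :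
    LinePreserving (symMap A τ) := by
  have el : ∀ X, IsElation X → IsElation (symMap A τ X) := by
    rintro _ ⟨v, f, hv, hf, h, rfl⟩
    rw [symMap_vecMulVec]
    exact isElation_vecMulVec (semilinMap_ne_zero A τ hv) (semilinMap_ne_zero _ τ hf)
      (by rw [semilinMap_dot, h, map_zero])
  refine ⟨el, ?_, fun X Y _ => symMap_add A τ X Y⟩
  rintro X Y (⟨h, c, h0, h1, rfl⟩ | ⟨f, g, h, rfl, rfl⟩ | ⟨v, w, h, rfl, rfl⟩)
  · refine Or.inl ⟨el X h, τ c, by simpa using h0, by simpa using h1, symMap_smul A τ c X⟩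
  · rw [symMap_vecMulVec, symMap_vecMulVec]
    exact adj_of_cross_center (semilinMap_ne_zero A τ h) (semilinMap_cross' hA τ f g)
  · rw [symMap_vecMulVec, symMap_vecMulVec]
    exact adj_of_cross_axis (semilinMap_ne_zero _ τ h) (semilinMap_cross hA τ v w)

theorem det_conjMat_inv {A : GL (Fin 3) F} (hA : (A : Matrix (Fin 3) (Fin 3) F).det = 1)
    (τ : F ≃+* F) : ((conjMat τ⁻¹ A⁻¹ : GL (Fin 3) F) : Matrix (Fin 3) (Fin 3) F).det = 1 := by
  have h2 : ((A⁻¹ : GL (Fin 3) F) : Matrix (Fin 3) (Fin 3) F).det = 1 := by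
    rw [← det_transpose]
    exact det_invTranspose A hA
  have h3 := det_mul_conjMat 1 A⁻¹ τ⁻¹ (by simp) h2
  rwa [one_mul] at h3

theorem lineAut_symMap {A : GL (Fin 3) F}
    (hA : (A : Matrix (Fin 3) (Fin 3) F).det = 1) (τ : F ≃+* F) :
    LineAut (symMap A τ) (symMap (conjMat τ⁻¹ A⁻¹) τ⁻¹) where
  left := linePreserving_symMap hA τ
  right := linePreserving_symMap (det_conjMat_inv hA τ) τ⁻¹
  left_inv X _ := by rw [symMap_symMap, conjMat_inv_mul, inv_mul_cancel, symMap_one]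
  right_inv X _ := by rw [symMap_symMap, mul_conjMat_inv, mul_inv_cancel, symMap_one]

/-- The matrix with columns `v`, `w`, `u`. -/
def frame (v w u : Fin 3 → F) (h : u ⬝ᵥ v ⨯₃ w = 1) : GL (Fin 3) F where
  val := (Matrix.of ![v, w, u])ᵀ
  -- The rows form the dual basis, because the triple product is one.
  inv := Matrix.of ![w ⨯₃ u, u ⨯₃ v, v ⨯₃ w]
  val_inv := by
    rw [mul_eq_one_comm]
    have h1 : w ⨯₃ u ⬝ᵥ v = 1 := by
      rw [dotProduct_comm, triple_product_permutation, triple_product_permutation, h]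
    have h2 : u ⨯₃ v ⬝ᵥ w = 1 := by
      rw [dotProduct_comm, triple_product_permutation, h]
    have h3 : v ⨯₃ w ⬝ᵥ u = 1 := by rw [dotProduct_comm, h]
    have hl : ∀ a b : Fin 3 → F, a ⨯₃ b ⬝ᵥ a = 0 := fun a b => by
      rw [dotProduct_comm, left_dot_cross]
    have hr : ∀ a b : Fin 3 → F, a ⨯₃ b ⬝ᵥ b = 0 := fun a b => by
      rw [dotProduct_comm, right_dot_cross]
    ext i j
    change (![w ⨯₃ u, u ⨯₃ v, v ⨯₃ w] i) ⬝ᵥ (![v, w, u] j) = _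
    fin_cases i <;> fin_cases j <;> simp [h1, h2, h3, hl, hr]
  inv_val := by
    have h1 : w ⨯₃ u ⬝ᵥ v = 1 := by
      rw [dotProduct_comm, triple_product_permutation, triple_product_permutation, h]
    have h2 : u ⨯₃ v ⬝ᵥ w = 1 := by
      rw [dotProduct_comm, triple_product_permutation, h]
    have h3 : v ⨯₃ w ⬝ᵥ u = 1 := by rw [dotProduct_comm, h]
    have hl : ∀ a b : Fin 3 → F, a ⨯₃ b ⬝ᵥ a = 0 := fun a b => by
      rw [dotProduct_comm, left_dot_cross]
    have hr : ∀ a b : Fin 3 → F, a ⨯₃ b ⬝ᵥ b = 0 := fun a b => by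
      rw [dotProduct_comm, right_dot_cross]
    ext i j
    change (![w ⨯₃ u, u ⨯₃ v, v ⨯₃ w] i) ⬝ᵥ (![v, w, u] j) = _
    fin_cases i <;> fin_cases j <;> simp [h1, h2, h3, hl, hr]

variable {v w u : Fin 3 → F} (h : u ⬝ᵥ v ⨯₃ w = 1)

theorem det_frame : (frame v w u h : Matrix (Fin 3) (Fin 3) F).det = 1 := by
  change ((Matrix.of ![v, w, u])ᵀ).det = 1
  rw [det_transpose, ← h, triple_product_permutation, triple_product_eq_det]
  rfl

theorem semilinMap_frame (τ : F ≃+* F) (i : Fin 3) :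
    semilinMap (frame v w u h) τ (stdVec F i) = ![v, w, u] i := by
  ext j
  change ((Matrix.of ![v, w, u])ᵀ *ᵥ (fun k => τ (stdVec F i k))) j = _
  fin_cases i <;>
    simp [stdVec, mulVec, dotProduct, Pi.single_apply]

theorem semilinMap_invTranspose_frame (τ : F ≃+* F) (i : Fin 3) :
    semilinMap (invTranspose (frame v w u h)) τ (stdVec F i) =
      ![w ⨯₃ u, u ⨯₃ v, v ⨯₃ w] i := by
  ext j
  change ((Matrix.of ![w ⨯₃ u, u ⨯₃ v, v ⨯₃ w])ᵀ *ᵥ (fun k => τ (stdVec F i k))) j = _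
  fin_cases i <;>
    simp [stdVec, mulVec, dotProduct, Pi.single_apply]

theorem symMap_frame (τ : F ≃+* F) (i j : Fin 3) :
    symMap (frame v w u h) τ (stdVec F i ⊠ stdVec F j) =
      ![v, w, u] i ⊠ ![w ⨯₃ u, u ⨯₃ v, v ⨯₃ w] j := by
  rw [symMap_vecMulVec, semilinMap_frame, semilinMap_invTranspose_frame]

/-! ### Hexagons -/

/-- A closed hexagon all of whose vertices are unique midpoints. -/
structure IsHexagon (X : Fin 6 → Matrix (Fin 3) (Fin 3) F) : Prop where
  isMid : ∀ i, IsMid (X i) (X (i + 1)) (X (i + 2))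

variable [FieldFour F]

/-- Common center and common axis alternate around the hexagon, which gives three centers and three
axes. Each new vector is tied to the previous two by a cross product, and closing up removes the
remaining scalar freedom. -/
theorem IsHexagon.exists_frame_of_isCentered {X : Fin 6 → Matrix (Fin 3) (Fin 3) F}
    (hX : IsHexagon X) (h01 : IsCentered (X 0) (X 1)) :
    ∃ v w u : Fin 3 → F, u ⬝ᵥ v ⨯₃ w = 1 ∧ X 0 = v ⊠ (u ⨯₃ v) ∧ X 1 = v ⊠ (v ⨯₃ w) ∧
      X 2 = w ⊠ (v ⨯₃ w) ∧ X 3 = w ⊠ (w ⨯₃ u) ∧ X 4 = u ⊠ (w ⨯₃ u) ∧ X 5 = u ⊠ (u ⨯₃ v) := by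
  obtain ⟨f, g, hfg, e0, e1⟩ := h01
  have m0 := hX.isMid 0
  have m1 := hX.isMid 1
  have m2 := hX.isMid 2
  have m3 := hX.isMid 3
  have m4 := hX.isMid 4
  simp only [show (0 : Fin 6) + 1 = 1 from rfl, show (0 : Fin 6) + 2 = 2 from rfl,
    show (1 : Fin 6) + 1 = 2 from rfl, show (1 : Fin 6) + 2 = 3 from rfl,
    show (2 : Fin 6) + 1 = 3 from rfl, show (2 : Fin 6) + 2 = 4 from rfl,
    show (3 : Fin 6) + 1 = 4 from rfl, show (3 : Fin 6) + 2 = 5 from rfl,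
    show (4 : Fin 6) + 1 = 5 from rfl, show (4 : Fin 6) + 2 = 0 from rfl] at m0 m1 m2 m3 m4
  obtain ⟨v, hv⟩ : ∃ v, v = f ⨯₃ g := ⟨_, rfl⟩
  rw [← hv] at hfg e0 e1
  have hg := right_ne_zero_of_cross (hv ▸ hfg)
  have hf := left_ne_zero_of_cross (hv ▸ hfg)
  rw [e0, e1] at m0
  obtain ⟨w, hw, e2⟩ := m0.exists_eq hfg hv.symm
  rw [e1, e2] at m1
  have hw0 := right_ne_zero_of_cross (hw ▸ hg)
  obtain ⟨k, hk, e3⟩ := m1.exists_eq' hg hw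
  rw [e2, e3] at m2
  have hk0 := right_ne_zero_of_cross (hk ▸ hw0)
  obtain ⟨u, hu, e4⟩ := m2.exists_eq hw0 hk
  rw [e3, e4] at m3
  have hu0 := right_ne_zero_of_cross (hu ▸ hk0)
  obtain ⟨l, hl, e5⟩ := m3.exists_eq' hk0 hu
  rw [e4, e5] at m4
  have hl0 := right_ne_zero_of_cross (hl ▸ hu0)
  obtain ⟨z, hz, e6⟩ := m4.exists_eq hu0 hl
  rw [e0] at e6
  obtain ⟨c, hc, rfl, rfl⟩ := vecMulVec_eq_iff hfg hf e6
  rw [map_smul] at hz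
  -- Here `g ⨯₃ k = (v ⨯₃ w) ⨯₃ (w ⨯₃ u)` is the triple product times `w`, and it must equal `w`.
  have hD : u ⬝ᵥ v ⨯₃ w = 1 := by
    have h1 : g ⨯₃ k = (u ⬝ᵥ v ⨯₃ w) • w := by
      rw [← hw, ← hu, cross_cross_eq_smul_sub_smul, left_dot_cross, zero_smul, sub_zero,
        triple_product_permutation u v w]
    rw [h1] at hk
    exact smul_left_injective F hw0 (by simpa using hk)
  -- Closing the hexagon yields `c ^ 2 = 1`, and squaring is injective in characteristic two.
  have hc1 : c = 1 := by
    have h1 : (c • l) ⨯₃ g = (c ^ 2) • v := by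
      rw [← hz, ← hw, smul_smul, map_smul, LinearMap.smul_apply, cross_cross_eq_smul_sub_smul,
        left_dot_cross, zero_smul, sub_zero, hD, one_smul, pow_two]
    rw [h1] at hv
    exact eq_one_of_sq_eq_one (smul_left_injective F hfg (by simpa using hv.symm))
  subst hc1
  rw [one_smul] at hz
  refine ⟨v, w, u, hD, ?_, ?_, ?_, ?_, ?_, ?_⟩
  · rw [e0, one_smul, hz]
  · rw [e1, hw]
  · rw [e2, hw]
  · rw [e3, hu]
  · rw [e4, hu]
  · rw [e5, hz]

/-- The standard hexagon. -/
def stdHexagon (F : Type*) [Field F] (i : Fin 6) : Matrix (Fin 3) (Fin 3) F :=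
  stdVec F (![0, 0, 1, 1, 2, 2] i) ⊠ stdVec F (![1, 2, 2, 0, 0, 1] i)

theorem isHexagon_stdHexagon : IsHexagon (stdHexagon F) := by
  have c01 : stdVec F 0 ⨯₃ stdVec F 1 = stdVec F 2 := stdVec_cross 0
  have c12 : stdVec F 1 ⨯₃ stdVec F 2 = stdVec F 0 := stdVec_cross 1
  have c20 : stdVec F 2 ⨯₃ stdVec F 0 = stdVec F 1 := stdVec_cross 2
  have n := stdVec_ne_zero (F := F)
  refine ⟨fun i => ?_⟩
  fin_cases i
  · exact isMid_of_cross (n 0) (n 2) c12 c01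
  · exact isMid_of_cross' (n 1) (n 2) c01 c20
  · exact isMid_of_cross (n 1) (n 0) c20 c12
  · exact isMid_of_cross' (n 2) (n 0) c12 c01
  · exact isMid_of_cross (n 2) (n 1) c01 c20
  · exact isMid_of_cross' (n 0) (n 1) c20 c12

variable {θ η : Matrix (Fin 3) (Fin 3) F → Matrix (Fin 3) (Fin 3) F}

omit [FieldFour F] in
theorem LineAut.isHexagon (h : LineAut θ η) {X : Fin 6 → Matrix (Fin 3) (Fin 3) F}
    (hX : IsHexagon X) : IsHexagon (fun i => θ (X i)) := ⟨fun i => h.isMid (hX.isMid i)⟩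

/-- The image of the standard hexagon supplies the matrix, and the image of one further multiple of
its first vertex supplies the field automorphism. Undoing this collineation leaves an automorphism
to which `LineAut.eq_self_of_hexagon` applies. -/
theorem LineAut.exists_symMap_of_isCentered (h : LineAut θ η)
    (h01 : IsCentered (θ (stdHexagon F 0)) (θ (stdHexagon F 1))) :
    ∃ (A : GL (Fin 3) F) (τ : F ≃+* F), (A : Matrix (Fin 3) (Fin 3) F).det = 1 ∧
      ∀ X, IsElation X → θ X = symMap A τ X := by
  obtain ⟨v, w, u, hD, e0, e1, e2, e3, e4, e5⟩ :=
    (h.isHexagon isHexagon_stdHexagon).exists_frame_of_isCentered h01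
  obtain ⟨a, ha0, ha1⟩ := exists_ne_zero_ne_one (F := F)
  have hv : v ≠ 0 := by rintro rfl; simp at hD
  have hvu : u ⨯₃ v ≠ 0 := by
    intro h0; rw [triple_product_permutation, triple_product_permutation, h0] at hD; simp at hD
  obtain ⟨d, hd0, hd1, hd⟩ : ∃ d : F, d ≠ 0 ∧ d ≠ 1 ∧
      θ (stdVec F 0 ⊠ (a • stdVec F 1)) = v ⊠ (d • u ⨯₃ v) := by
    have hs : IsScaled (stdHexagon F 0) (stdVec F 0 ⊠ (a • stdVec F 1)) :=
      ⟨isElation_vecMulVec (stdVec_ne_zero 0) (stdVec_ne_zero 1) (stdVec_dot (by decide)),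
        a, ha0, ha1, vecMulVec_smul _ _ _⟩
    have := h.isScaled hs
    rw [e0] at this
    exact this.exists_eq
  -- The two scalars outside `{0, 1}` are exchanged by Frobenius.
  obtain ⟨τ, hτ⟩ : ∃ τ : F ≃+* F, τ a = d := by
    rcases eq_one_or_eq_or_eq_sq ha0 ha1 hd0 with e | e | e
    · exact absurd e hd1
    · exact ⟨1, e.symm⟩
    · obtain ⟨τ, hτ⟩ := exists_frobenius (F := F)
      exact ⟨τ, by rw [hτ, e]⟩
  have hψ := lineAut_symMap (det_frame hD) τ
  have hf := symMap_frame hD τ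
  have hcomp := hψ.symm.comp h
  have hfix : ∀ X, IsElation X → symMap (conjMat τ⁻¹ (frame v w u hD)⁻¹) τ⁻¹ (θ X) = X := by
    intro X hX
    refine hcomp.eq_self_of_hexagon (fun i j hij => ?_) ha0 ha1 ?_ hX
    · have key : θ (stdVec F i ⊠ stdVec F j) =
          symMap (frame v w u hD) τ (stdVec F i ⊠ stdVec F j) := by
        rw [hf]
        fin_cases i <;> fin_cases j <;>
          first | exact absurd rfl hij | assumption
      change symMap (conjMat τ⁻¹ (frame v w u hD)⁻¹) τ⁻¹ (θ (stdVec F i ⊠ stdVec F j)) = _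
      rw [key, hψ.left_inv _
        (isElation_vecMulVec (stdVec_ne_zero i) (stdVec_ne_zero j) (stdVec_dot hij.symm))]
    · have key : θ (stdVec F 0 ⊠ (a • stdVec F 1)) =
          symMap (frame v w u hD) τ (stdVec F 0 ⊠ (a • stdVec F 1)) := by
        rw [hd, vecMulVec_smul, vecMulVec_smul, symMap_smul, hf, hτ]
        rfl
      rw [key, hψ.left_inv _ (isElation_vecMulVec (stdVec_ne_zero 0)
        (smul_ne_zero ha0 (stdVec_ne_zero 1))
        (by rw [smul_dotProduct, stdVec_dot (by decide), smul_zero]))]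
  refine ⟨frame v w u hD, τ, det_frame hD, fun X hX => ?_⟩
  rw [← hψ.right_inv _ (h.left.isElation X hX), hfix X hX]

/-- Every automorphism of the collinearity structure on elations is induced by a collineation or
a correlation with a matrix of determinant one. -/
theorem LineAut.exists_symMap (h : LineAut θ η) :
    ∃ (A : GL (Fin 3) F) (τ : F ≃+* F), (A : Matrix (Fin 3) (Fin 3) F).det = 1 ∧
      ((∀ X, IsElation X → θ X = symMap A τ X) ∨ ∀ X, IsElation X → θ X = (symMap A τ X)ᵀ) := by
  have h01 : Adj (θ (stdHexagon F 0)) (θ (stdHexagon F 1)) :=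
    (h.isMid (isHexagon_stdHexagon.isMid 0)).1
  rcases h01 with h01 | h01 | h01
  -- Edges of the hexagon extend to geodesics with a unique midpoint, so their images are not scaled
  -- pairs.
  · exact absurd (h.isMid (isHexagon_stdHexagon.isMid 0)) (not_isMid_of_isScaled h01.symm)
  · obtain ⟨A, τ, hA, h1⟩ := h.exists_symMap_of_isCentered h01
    exact ⟨A, τ, hA, Or.inl h1⟩
  -- Transposition exchanges the axial and the centered case, so a correlation appears.
  · obtain ⟨A, τ, hA, h1⟩ := (lineAut_transpose.comp h).exists_symMap_of_isCentered h01.transpose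
    refine ⟨A, τ, hA, Or.inr fun X hX => ?_⟩
    rw [← h1 X hX, transpose_transpose]

end Action

/-! ### The group of collineations and correlations -/

section Group

variable {F : Type*} [Field F]

theorem projMap_inv_left (A : GL (Fin 3) F) (τ : F ≃+* F) (p : ℙ F (Fin 3 → F)) :
    projMap (conjMat τ⁻¹ A⁻¹) τ⁻¹ (projMap A τ p) = p := by
  rw [projMap_comp, conjMat_inv_mul, inv_mul_cancel, projMap_one]

/-- The collineation given by `A` and `τ`. -/
def collineation (A : GL (Fin 3) F) (τ : F ≃+* F) : Equiv.Perm (PlaneElement F) where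
  toFun := Sum.elim (fun p => Sum.inl (projMap A τ p))
    (fun l => Sum.inr (projMap (invTranspose A) τ l))
  invFun := Sum.elim (fun p => Sum.inl (projMap (conjMat τ⁻¹ A⁻¹) τ⁻¹ p))
    (fun l => Sum.inr (projMap (conjMat τ⁻¹ (invTranspose A)⁻¹) τ⁻¹ l))
  left_inv := by rintro (p | l) <;> simp [projMap_inv_left, -map_inv]
  right_inv := by rintro (p | l) <;> simp [projMap_inv_right, -map_inv]

/-- The correlation given by `A` and `τ`. -/
def correlation (A : GL (Fin 3) F) (τ : F ≃+* F) : Equiv.Perm (PlaneElement F) where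
  toFun := Sum.elim (fun p => Sum.inr (projMap A τ p))
    (fun l => Sum.inl (projMap (invTranspose A) τ l))
  invFun := Sum.elim (fun p => Sum.inr (projMap (conjMat τ⁻¹ (invTranspose A)⁻¹) τ⁻¹ p))
    (fun l => Sum.inl (projMap (conjMat τ⁻¹ A⁻¹) τ⁻¹ l))
  left_inv := by rintro (p | l) <;> simp [projMap_inv_left, -map_inv]
  right_inv := by rintro (p | l) <;> simp [projMap_inv_right, -map_inv]

theorem collineation_mul (A B : GL (Fin 3) F) (τ σ : F ≃+* F) :
    collineation A τ * collineation B σ = collineation (A * conjMat τ B) (τ * σ) := by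
  ext (p | l) : 1
  · exact congrArg Sum.inl (projMap_comp A B τ σ p)
  · refine congrArg Sum.inr ((projMap_comp _ _ τ σ l).trans ?_)
    rw [invTranspose_mul, invTranspose_conjMat]

theorem correlation_mul_collineation (A B : GL (Fin 3) F) (τ σ : F ≃+* F) :
    correlation A τ * collineation B σ = correlation (A * conjMat τ B) (τ * σ) := by
  ext (p | l) : 1
  · exact congrArg Sum.inr (projMap_comp A B τ σ p)
  · refine congrArg Sum.inl ((projMap_comp _ _ τ σ l).trans ?_)
    rw [invTranspose_mul, invTranspose_conjMat]

theorem collineation_mul_correlation (A B : GL (Fin 3) F) (τ σ : F ≃+* F) :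
    collineation A τ * correlation B σ =
      correlation (invTranspose A * conjMat τ B) (τ * σ) := by
  ext (p | l) : 1
  · exact congrArg Sum.inr (projMap_comp _ B τ σ p)
  · refine congrArg Sum.inl ((projMap_comp _ _ τ σ l).trans ?_)
    rw [invTranspose_mul, invTranspose_conjMat, invTranspose_invTranspose]

theorem invTranspose_one : invTranspose (1 : GL (Fin 3) F) = 1 := by
  apply Units.ext
  change Matrix.transpose _ = _
  simp

theorem collineation_one : collineation (1 : GL (Fin 3) F) 1 = 1 := by
  ext (p | l) : 1
  · exact congrArg Sum.inl (projMap_one p)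
  · refine congrArg Sum.inr ?_
    rw [invTranspose_one, projMap_one]

theorem projMap_eq_of_smul {A B : GL (Fin 3) F} (τ : F ≃+* F) {c : F}
    (h : (A : Matrix (Fin 3) (Fin 3) F) = c • (B : Matrix (Fin 3) (Fin 3) F)) :
    projMap A τ = projMap B τ := by
  ext p
  induction p using Projectivization.ind with
  | h v hv =>
    simp only [projMap, Projectivization.map_mk]
    rw [Projectivization.mk_eq_mk_iff']
    refine ⟨c, ?_⟩
    change c • ((B : Matrix (Fin 3) (Fin 3) F) *ᵥ fun i => τ (v i)) =
      (A : Matrix (Fin 3) (Fin 3) F) *ᵥ fun i => τ (v i)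
    rw [h, smul_mulVec]

theorem collineation_eq_of_smul {A B : GL (Fin 3) F} (τ : F ≃+* F) {c : F} (hc : c ≠ 0)
    (h : (A : Matrix (Fin 3) (Fin 3) F) = c • (B : Matrix (Fin 3) (Fin 3) F)) :
    collineation A τ = collineation B τ := by
  have h2 : (invTranspose A : Matrix (Fin 3) (Fin 3) F) =
      c⁻¹ • (invTranspose B : Matrix (Fin 3) (Fin 3) F) := by
    have e : (A : Matrix (Fin 3) (Fin 3) F) *
        (c⁻¹ • ((B⁻¹ : GL (Fin 3) F) : Matrix (Fin 3) (Fin 3) F)) = 1 := by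
      rw [h, Matrix.smul_mul, Matrix.mul_smul, smul_smul, mul_inv_cancel₀ hc, one_smul,
        Units.mul_inv]
    have e2 : ((A⁻¹ : GL (Fin 3) F) : Matrix (Fin 3) (Fin 3) F) =
        c⁻¹ • ((B⁻¹ : GL (Fin 3) F) : Matrix (Fin 3) (Fin 3) F) := by
      rw [← one_mul (c⁻¹ • _), ← Units.inv_mul A, mul_assoc, e, mul_one]
    change (((A⁻¹ : GL (Fin 3) F) : Matrix (Fin 3) (Fin 3) F))ᵀ = _
    rw [e2, transpose_smul]
    rfl
  ext (p | l) : 1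
  · exact congrArg Sum.inl (congrFun (projMap_eq_of_smul τ h) p)
  · exact congrArg Sum.inr (congrFun (projMap_eq_of_smul τ h2) l)

/-- Every vector is an eigenvector of `B⁻¹ A`, so this matrix is scalar. -/
theorem exists_smul_of_collineation_eq {A B : GL (Fin 3) F}
    (h : collineation A 1 = collineation B 1) :
    ∃ c : F, (A : Matrix (Fin 3) (Fin 3) F) = c • (B : Matrix (Fin 3) (Fin 3) F) := by
  have h1 : ∀ v : Fin 3 → F, v ≠ 0 → ∃ a : F, a • ((B : Matrix (Fin 3) (Fin 3) F) *ᵥ v) =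
      (A : Matrix (Fin 3) (Fin 3) F) *ᵥ v := by
    intro v hv
    have h2 := Sum.inl.inj (congrFun (congrArg DFunLike.coe h) (Sum.inl (.mk F v hv)))
    simp only [projMap, Projectivization.map_mk] at h2
    rw [Projectivization.mk_eq_mk_iff'] at h2
    exact h2
  obtain ⟨a, ha⟩ := LinearMap.exists_eq_smul_id_of_forall_notLinearIndependent
    (f := Matrix.toLin' (((B⁻¹ : GL (Fin 3) F) : Matrix (Fin 3) (Fin 3) F) *
      (A : Matrix (Fin 3) (Fin 3) F))) (fun v => by
    by_cases hv : v = 0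
    · simp [hv, linearIndependent_fin2]
    · rw [LinearIndependent.pair_iff' hv]
      push Not
      obtain ⟨a, ha⟩ := h1 v hv
      refine ⟨a, ?_⟩
      rw [toLin'_apply, ← mulVec_mulVec, ← ha, mulVec_smul, mulVec_mulVec, Units.inv_mul,
        one_mulVec])
  refine ⟨a, ?_⟩
  have h3 : ((B⁻¹ : GL (Fin 3) F) : Matrix (Fin 3) (Fin 3) F) *
      (A : Matrix (Fin 3) (Fin 3) F) = a • 1 := by
    apply Matrix.toLin'.injective
    rw [ha, map_smul, toLin'_one]
    rfl
  calc (A : Matrix (Fin 3) (Fin 3) F) = B * (((B⁻¹ : GL (Fin 3) F) : Matrix (Fin 3) (Fin 3) F) *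
      (A : Matrix (Fin 3) (Fin 3) F)) := by rw [← mul_assoc, Units.mul_inv, one_mul]
    _ = _ := by rw [h3, Matrix.mul_smul, mul_one]

theorem collineation_mem {A : GL (Fin 3) F} (hA : (A : Matrix (Fin 3) (Fin 3) F).det = 1)
    (τ : F ≃+* F) : collineation A τ ∈ unimodularCorrelationGroup F :=
  ⟨A, τ, hA, Or.inl ⟨fun _ => rfl, fun _ => rfl⟩⟩

theorem correlation_mem {A : GL (Fin 3) F} (hA : (A : Matrix (Fin 3) (Fin 3) F).det = 1)
    (τ : F ≃+* F) : correlation A τ ∈ unimodularCorrelationGroup F :=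
  ⟨A, τ, hA, Or.inr ⟨fun _ => rfl, fun _ => rfl⟩⟩

theorem exists_eq_collineation_or_correlation (h : unimodularCorrelationGroup F) :
    ∃ (A : GL (Fin 3) F) (τ : F ≃+* F), (A : Matrix (Fin 3) (Fin 3) F).det = 1 ∧
      ((h : Equiv.Perm (PlaneElement F)) = collineation A τ ∨
        (h : Equiv.Perm (PlaneElement F)) = correlation A τ) := by
  obtain ⟨θ, A, τ, hA, h⟩ := h
  refine ⟨A, τ, hA, ?_⟩
  rcases h with h | h
  · left
    ext (p | l) : 1
    · exact h.1 p
    · exact h.2 l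
  · right
    ext (p | l) : 1
    · exact h.1 p
    · exact h.2 l

variable [FieldFour F]

theorem add_self_matrix (X : Matrix (Fin 3) (Fin 3) F) : X + X = 0 := by
  rw [← two_smul F, two_eq_zero, zero_smul]

/-- The matrix `1 + X` for a matrix `X` with square zero. -/
def oneAdd (X : Matrix (Fin 3) (Fin 3) F) (h : X * X = 0) : GL (Fin 3) F where
  val := 1 + X
  inv := 1 + X
  val_inv := by
    rw [add_mul, one_mul, mul_add, h, mul_one, add_zero, add_assoc, add_self_matrix, add_zero]
  inv_val := by
    rw [add_mul, one_mul, mul_add, h, mul_one, add_zero, add_assoc, add_self_matrix, add_zero]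

/-- The matrix is an involution, so its determinant squares to one, and one has no other square
root. -/
theorem det_oneAdd (X : Matrix (Fin 3) (Fin 3) F) (h : X * X = 0) :
    (oneAdd X h : Matrix (Fin 3) (Fin 3) F).det = 1 := by
  apply eq_one_of_sq_eq_one
  rw [pow_two, ← det_mul]
  have : (oneAdd X h : Matrix (Fin 3) (Fin 3) F) * (oneAdd X h : Matrix (Fin 3) (Fin 3) F) = 1 :=
    (oneAdd X h).val_inv
  rw [this, det_one]

open Classical in
/-- The collineation with matrix `1 + X`, for a matrix `X` with square zero. -/
noncomputable def elation (X : Matrix (Fin 3) (Fin 3) F) : unimodularCorrelationGroup F :=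
  if h : X * X = 0 then ⟨collineation (oneAdd X h) 1, collineation_mem (det_oneAdd X h) 1⟩ else 1

theorem coe_elation {X : Matrix (Fin 3) (Fin 3) F} (h : X * X = 0) :
    (elation X : Equiv.Perm (PlaneElement F)) = collineation (oneAdd X h) 1 := by
  rw [elation, dif_pos h]

omit [FieldFour F] in
theorem IsElation.mul_self {X : Matrix (Fin 3) (Fin 3) F} (h : IsElation X) : X * X = 0 := by
  obtain ⟨v, f, -, -, h, rfl⟩ := h
  rw [vecMulVec_mul_vecMulVec, h]
  simp

/-- Equality of collineations gives `1 + X = c • (1 + Y)`. Squaring `X = (c - 1) • 1 + c • Y` leaves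
`(c - 1) ^ 2 = 0`, since the mixed terms cancel in characteristic two. -/
theorem elation_injOn {X Y : Matrix (Fin 3) (Fin 3) F} (hX : X * X = 0) (hY : Y * Y = 0)
    (h : elation X = elation Y) : X = Y := by
  have h1 := congrArg (Subtype.val) h
  rw [coe_elation hX, coe_elation hY] at h1
  obtain ⟨c, hc⟩ := exists_smul_of_collineation_eq h1
  change 1 + X = c • (1 + Y) at hc
  have h2 : X = (c - 1) • 1 + c • Y := by
    have : X = c • (1 + Y) - 1 := by rw [← hc, add_sub_cancel_left]
    rw [this, sub_smul, smul_add, one_smul]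
    abel
  have h3 : ((c - 1) ^ 2) • (1 : Matrix (Fin 3) (Fin 3) F) = 0 := by
    have e : X * X = ((c - 1) • 1 + c • Y) * ((c - 1) • 1 + c • Y) := by rw [← h2]
    simp only [add_mul, mul_add, Matrix.smul_mul, Matrix.mul_smul, one_mul, mul_one, hX, hY,
      smul_zero, add_zero, smul_smul] at e
    rw [mul_comm c, add_assoc, add_self_matrix, add_zero, ← pow_two] at e
    exact e.symm
  have h4 : c = 1 := by
    have := congrFun (congrFun h3 0) 0
    simp only [Matrix.smul_apply, one_apply_eq, smul_eq_mul, mul_one, Matrix.zero_apply] at this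
    exact sub_eq_zero.mp (pow_eq_zero_iff two_ne_zero |>.mp this)
  simpa [h4] using h2

theorem elation_zero : elation (0 : Matrix (Fin 3) (Fin 3) F) = 1 := by
  apply Subtype.ext
  rw [coe_elation (mul_zero 0)]
  have : oneAdd (0 : Matrix (Fin 3) (Fin 3) F) (mul_zero 0) = 1 := Units.ext (add_zero 1)
  rw [this, collineation_one]; rfl

omit [FieldFour F] in
theorem conjMat_one (A : GL (Fin 3) F) : conjMat 1 A = A := by
  apply Units.ext
  rfl

theorem elation_mul {X Y : Matrix (Fin 3) (Fin 3) F} (hX : X * X = 0) (hY : Y * Y = 0)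
    (hXY : X * Y = 0) (hYX : Y * X = 0) : elation X * elation Y = elation (X + Y) := by
  have h : (X + Y) * (X + Y) = 0 := by simp [add_mul, mul_add, hX, hY, hXY, hYX]
  apply Subtype.ext
  rw [Subgroup.coe_mul, coe_elation hX, coe_elation hY, coe_elation h, collineation_mul,
    conjMat_one, mul_one]
  congr 1
  apply Units.ext
  change (1 + X) * (1 + Y) = 1 + (X + Y)
  rw [add_mul, one_mul, mul_add, hXY, mul_one, add_zero]
  abel

omit [FieldFour F] in
theorem symMap_mul_self (A : GL (Fin 3) F) (τ : F ≃+* F) {X : Matrix (Fin 3) (Fin 3) F}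
    (h : X * X = 0) : symMap A τ X * symMap A τ X = 0 := by
  have h1 : X.map τ * X.map τ = 0 := by
    have : (X * X).map τ = X.map τ * X.map τ := Matrix.map_mul (f := (τ : F →+* F))
    rw [← this, h]
    ext; simp
  have h2 : ((A⁻¹ : GL (Fin 3) F) : Matrix (Fin 3) (Fin 3) F) *
    (A : Matrix (Fin 3) (Fin 3) F) = 1 := Units.inv_mul A
  calc symMap A τ X * symMap A τ X = (A : Matrix (Fin 3) (Fin 3) F) * X.map τ *
      (((A⁻¹ : GL (Fin 3) F) : Matrix (Fin 3) (Fin 3) F) * (A : Matrix (Fin 3) (Fin 3) F)) *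
        X.map τ * ((A⁻¹ : GL (Fin 3) F) : Matrix (Fin 3) (Fin 3) F) := by
        simp only [symMap, mul_assoc]
    _ = 0 := by rw [h2, mul_one, mul_assoc (A : Matrix (Fin 3) (Fin 3) F), h1, mul_zero, zero_mul]

theorem mul_conjMat_oneAdd (A : GL (Fin 3) F) (τ : F ≃+* F) {X : Matrix (Fin 3) (Fin 3) F}
    (h : X * X = 0) : A * conjMat τ (oneAdd X h) = oneAdd _ (symMap_mul_self A τ h) * A := by
  apply Units.ext
  have e : ((conjMat τ (oneAdd X h) : GL (Fin 3) F) : Matrix (Fin 3) (Fin 3) F) =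
      1 + X.map τ := by
    change (1 + X).map τ = _
    rw [Matrix.map_add _ (map_add τ), Matrix.map_one _ (map_zero τ) (map_one τ)]
  rw [Units.val_mul, Units.val_mul, e]
  change _ = (1 + symMap A τ X) * _
  rw [mul_add, add_mul, mul_one, one_mul, symMap, mul_assoc _ _ (A : Matrix (Fin 3) (Fin 3) F),
    Units.inv_mul, mul_one]

theorem conj_elation_of_collineation {h : unimodularCorrelationGroup F} {A : GL (Fin 3) F}
    {τ : F ≃+* F} (hA : (h : Equiv.Perm (PlaneElement F)) = collineation A τ)
    {X : Matrix (Fin 3) (Fin 3) F} (hX : X * X = 0) :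
    h * elation X * h⁻¹ = elation (symMap A τ X) := by
  rw [mul_inv_eq_iff_eq_mul]
  apply Subtype.ext
  rw [Subgroup.coe_mul, Subgroup.coe_mul, hA, coe_elation hX,
    coe_elation (symMap_mul_self A τ hX), collineation_mul, collineation_mul, conjMat_one,
    mul_one, one_mul, mul_conjMat_oneAdd]

omit [FieldFour F] in
theorem transpose_mul_self {X : Matrix (Fin 3) (Fin 3) F} (h : X * X = 0) : Xᵀ * Xᵀ = 0 := by
  rw [← transpose_mul, h, transpose_zero]

theorem conj_elation_of_correlation {h : unimodularCorrelationGroup F} {A : GL (Fin 3) F}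
    {τ : F ≃+* F} (hA : (h : Equiv.Perm (PlaneElement F)) = correlation A τ)
    {X : Matrix (Fin 3) (Fin 3) F} (hX : X * X = 0) :
    h * elation X * h⁻¹ = elation (symMap A τ X)ᵀ := by
  have hs := symMap_mul_self A τ hX
  rw [mul_inv_eq_iff_eq_mul]
  apply Subtype.ext
  rw [Subgroup.coe_mul, Subgroup.coe_mul, hA, coe_elation hX,
    coe_elation (transpose_mul_self hs), collineation_mul_correlation,
    correlation_mul_collineation, conjMat_one, mul_one, one_mul, mul_conjMat_oneAdd]
  congr 2
  apply Units.ext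
  change 1 + symMap A τ X = (1 + (symMap A τ X)ᵀ)ᵀ
  rw [transpose_add, transpose_one, transpose_transpose]

/-- Conjugation acts on elations by an automorphism of the collinearity structure. -/
theorem exists_lineAut_conj (h : unimodularCorrelationGroup F) :
    ∃ θ η : Matrix (Fin 3) (Fin 3) F → Matrix (Fin 3) (Fin 3) F, LineAut θ η ∧
      ∀ X, X * X = 0 → h * elation X * h⁻¹ = elation (θ X) := by
  obtain ⟨A, τ, hA, h1 | h1⟩ := exists_eq_collineation_or_correlation h
  · exact ⟨_, _, lineAut_symMap hA τ, fun X hX => conj_elation_of_collineation h1 hX⟩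
  · exact ⟨_, _, lineAut_transpose.comp (lineAut_symMap hA τ),
      fun X hX => conj_elation_of_correlation h1 hX⟩

/-- Every automorphism of the collinearity structure is induced by conjugation. -/
theorem LineAut.exists_conj {θ η : Matrix (Fin 3) (Fin 3) F → Matrix (Fin 3) (Fin 3) F}
    (h : LineAut θ η) : ∃ g : unimodularCorrelationGroup F,
      ∀ X, IsElation X → g * elation X * g⁻¹ = elation (θ X) := by
  obtain ⟨A, τ, hA, h1 | h1⟩ := h.exists_symMap
  · refine ⟨⟨_, collineation_mem hA τ⟩, fun X hX => ?_⟩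
    rw [conj_elation_of_collineation rfl hX.mul_self, h1 X hX]
  · refine ⟨⟨_, correlation_mem hA τ⟩, fun X hX => ?_⟩
    rw [conj_elation_of_correlation rfl hX.mul_self, h1 X hX]

/-- Commuting means `(v ⊠ f) * (w ⊠ g) = (w ⊠ g) * (v ⊠ f)`. If `f ⬝ᵥ w` were nonzero, comparing the
rank one matrices would make `w` a multiple of `v`, which is orthogonal to `f`. -/
theorem orthogonal_of_commute {v f w g : Fin 3 → F} (hv : v ≠ 0) (hf : f ≠ 0)
    (hvf : f ⬝ᵥ v = 0) (hw : w ≠ 0) (hg : g ≠ 0) (hwg : g ⬝ᵥ w = 0)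
    (h : Commute (elation (v ⊠ f)) (elation (w ⊠ g))) : f ⬝ᵥ w = 0 ∧ g ⬝ᵥ v = 0 := by
  have hX := (isElation_vecMulVec hv hf hvf).mul_self
  have hY := (isElation_vecMulVec hw hg hwg).mul_self
  have h1 : elation (v ⊠ f) * elation (w ⊠ g) * (elation (v ⊠ f))⁻¹ = elation (w ⊠ g) := by
    rw [h.eq, mul_inv_cancel_right]
  rw [conj_elation_of_collineation (coe_elation hX) hY] at h1
  have h2 := elation_injOn (symMap_mul_self _ 1 hY) hY h1
  have h3 : (1 + v ⊠ f) * (w ⊠ g) = (w ⊠ g) * (1 + v ⊠ f) := by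
    nth_rewrite 2 [← h2]
    have e : (w ⊠ g).map (1 : F ≃+* F) = w ⊠ g := rfl
    rw [symMap, e, mul_assoc]
    change _ = _ * (_ * (1 + v ⊠ f))
    have e2 : ((oneAdd _ hX)⁻¹ : GL (Fin 3) F).val * (1 + v ⊠ f) = 1 := Units.inv_mul (oneAdd _ hX)
    rw [e2, mul_one]
    rfl
  rw [add_mul, mul_add, one_mul, mul_one, add_right_inj, vecMulVec_mul_vecMulVec,
    vecMulVec_mul_vecMulVec, ] at h3
  have h4 : f ⬝ᵥ w = 0 := by
    by_contra hne
    obtain ⟨c, -, rfl, -⟩ := vecMulVec_eq_iff hv (smul_ne_zero hne hg) h3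
    rw [dotProduct_smul, hvf, smul_zero] at hne
    exact hne rfl
  refine ⟨h4, ?_⟩
  rw [h4, zero_smul, vecMulVec_zero, eq_comm, vecMulVec_eq_zero] at h3
  rcases h3 with h3 | h3
  · exact absurd h3 hw
  · exact (smul_eq_zero.mp h3).resolve_right hf

end Group

/-! ### Transport along isomorphisms -/

section Transport

variable {G H : Type*} [Group G] [Group H]

theorem isCentralInvolution_map [Finite G] (e : G ≃* H) {x : G} (h : IsCentralInvolution G x) :
    IsCentralInvolution H (e x) := by
  obtain ⟨h1, P, hP⟩ := h
  refine ⟨by rw [MulEquiv.orderOf_eq, h1],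
    P.mapSurjective (f := e.toMonoidHom) e.surjective, ?_⟩
  rw [Subgroup.mem_centralizer_iff] at hP ⊢
  rintro _ ⟨y, hy, rfl⟩
  change e y * e x = e x * e y
  rw [← map_mul, hP y hy, map_mul]

theorem isCentralInvolution_conj [Finite G] (g : G) {x : G} (h : IsCentralInvolution G x) :
    IsCentralInvolution G (g * x * g⁻¹) := isCentralInvolution_map (MulAut.conj g) h

theorem index_normalizer_map (e : G ≃* H) (K : Subgroup G) :
    (Subgroup.normalizer (K.map e.toMonoidHom : Set H)).index =
      (Subgroup.normalizer (K : Set G)).index := by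
  have : Subgroup.normalizer (K.map e.toMonoidHom : Set H) =
      (Subgroup.normalizer (K : Set G)).map e.toMonoidHom := by
    ext h
    obtain ⟨g, rfl⟩ := e.surjective h
    have h1 : ∀ x, e x ∈ (K.map e.toMonoidHom : Set H) ↔ x ∈ (K : Set G) := fun x =>
      ⟨fun ⟨y, hy, hxy⟩ => e.injective hxy ▸ hy, fun hx => ⟨x, hx, rfl⟩⟩
    have h2 : ∀ x, e x ∈ (Subgroup.normalizer (K : Set G)).map e.toMonoidHom ↔
        x ∈ Subgroup.normalizer (K : Set G) := fun x =>
      ⟨fun ⟨y, hy, hxy⟩ => e.injective hxy ▸ hy, fun hx => ⟨x, hx, rfl⟩⟩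
    rw [h2, Subgroup.mem_set_normalizer_iff, Subgroup.mem_set_normalizer_iff,
      e.surjective.forall]
    refine forall_congr' fun x => ?_
    rw [h1, ← map_mul, ← map_inv, ← map_mul, h1]
  rw [this]
  exact Subgroup.index_map_equiv _ e

theorem isOctagonLine_map [Finite G] (e : G ≃* H) {L : Set G} (h : IsOctagonLine G L) :
    IsOctagonLine H (e '' L) := by
  obtain ⟨x, y, hx, hy, hne, hc, hi, rfl⟩ := h
  refine ⟨e x, e y, isCentralInvolution_map e hx, isCentralInvolution_map e hy,
    e.injective.ne hne, hc.map e, ?_, ?_⟩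
  · have : Subgroup.closure {e x, e y} = (Subgroup.closure {x, y}).map e.toMonoidHom := by
      rw [MonoidHom.map_closure, Set.image_pair]; rfl
    rwa [this, index_normalizer_map]
  · rw [Set.image_insert_eq, Set.image_pair, map_mul]

end Transport

/-! ### Central involutions are elations -/

section CentralInvolutions

variable {F : Type*} [Field F]

/-- An upper unitriangular matrix. -/
def unitriangular (a b c : F) : GL (Fin 3) F where
  val := !![1, a, b; 0, 1, c; 0, 0, 1]
  inv := !![1, -a, a * c - b; 0, 1, -c; 0, 0, 1]
  val_inv := by
    ext i j
    fin_cases i <;> fin_cases j <;> simp [Matrix.mul_apply, Fin.sum_univ_three]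
    ring
  inv_val := by
    ext i j
    fin_cases i <;> fin_cases j <;> simp [Matrix.mul_apply, Fin.sum_univ_three]
    ring

theorem unitriangular_mul (a b c a' b' c' : F) :
    unitriangular a b c * unitriangular a' b' c' =
      unitriangular (a + a') (b + b' + a * c') (c + c') := by
  apply Units.ext
  change !![1, a, b; 0, 1, c; 0, 0, 1] * !![1, a', b'; 0, 1, c'; 0, 0, 1] =
    !![1, a + a', b + b' + a * c'; 0, 1, c + c'; 0, 0, 1]
  ext i j
  fin_cases i <;> fin_cases j <;> simp [Matrix.mul_apply, Fin.sum_univ_three] <;> ring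

theorem unitriangular_zero : unitriangular (0 : F) 0 0 = 1 := by
  apply Units.ext
  change !![1, 0, 0; 0, 1, 0; 0, 0, 1] = (1 : Matrix (Fin 3) (Fin 3) F)
  ext i j
  fin_cases i <;> fin_cases j <;> simp

variable [FieldFour F]

omit [FieldFour F] in
theorem collineation_unitriangular_mul (a b c a' b' c' : F) :
    collineation (unitriangular a b c) 1 * collineation (unitriangular a' b' c') 1 =
      collineation (unitriangular (a + a') (b + b' + a * c') (c + c')) 1 := by
  rw [collineation_mul, conjMat_one, mul_one, unitriangular_mul]

/-- The group of collineations given by upper unitriangular matrices. -/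
def unitriangularGroup (F : Type*) [Field F] :
    Subgroup (unimodularCorrelationGroup F) where
  carrier := {h | ∃ a b c : F, (h : Equiv.Perm (PlaneElement F)) =
    collineation (unitriangular a b c) 1}
  one_mem' := ⟨0, 0, 0, by rw [unitriangular_zero, collineation_one]; rfl⟩
  mul_mem' := by
    rintro x y ⟨a, b, c, h⟩ ⟨a', b', c', h'⟩
    exact ⟨_, _, _, by rw [Subgroup.coe_mul, h, h', collineation_unitriangular_mul]⟩
  inv_mem' := by
    rintro x ⟨a, b, c, h⟩
    refine ⟨-a, a * c - b, -c, ?_⟩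
    rw [Subgroup.coe_inv, inv_eq_iff_mul_eq_one, h, collineation_unitriangular_mul,
      ← collineation_one, ← unitriangular_zero]
    congr 2 <;> ring

theorem isPGroup_unitriangularGroup : IsPGroup 2 (unitriangularGroup F) := by
  rintro ⟨x, a, b, c, h⟩
  refine ⟨2, ?_⟩
  apply Subtype.ext
  apply Subtype.ext
  change (x : Equiv.Perm (PlaneElement F)) ^ (2 ^ 2) = 1
  have h2 : (2 : F) = 0 := two_eq_zero
  rw [show (2 ^ 2 : ℕ) = 2 + 2 from rfl, pow_add, pow_two, h, collineation_unitriangular_mul,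
    collineation_unitriangular_mul, ← collineation_one, ← unitriangular_zero]
  congr 2
  · linear_combination 2 * a * h2
  · linear_combination (2 * b + 3 * a * c) * h2
  · linear_combination 2 * c * h2

theorem elation_mem_of_axis {v : Fin 3 → F} (hv : v 2 = 0) :
    elation (v ⊠ stdVec F 2) ∈ unitriangularGroup F := by
  have h : (v ⊠ stdVec F 2) * (v ⊠ stdVec F 2) = 0 := by
    rw [vecMulVec_mul_vecMulVec, stdVec, single_dotProduct, hv]; simp
  refine ⟨0, v 0, v 1, ?_⟩
  rw [coe_elation h]
  congr 1
  apply Units.ext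
  change 1 + v ⊠ stdVec F 2 = !![1, 0, v 0; 0, 1, v 1; 0, 0, 1]
  ext i j
  fin_cases i <;> fin_cases j <;> simp [vecMulVec_apply, stdVec, hv]

theorem elation_mem_of_center {f : Fin 3 → F} (hf : f 0 = 0) :
    elation (stdVec F 0 ⊠ f) ∈ unitriangularGroup F := by
  have h : (stdVec F 0 ⊠ f) * (stdVec F 0 ⊠ f) = 0 := by
    rw [vecMulVec_mul_vecMulVec, stdVec, dotProduct_single, hf]; simp
  refine ⟨f 1, f 2, 0, ?_⟩
  rw [coe_elation h]
  congr 1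
  apply Units.ext
  change 1 + stdVec F 0 ⊠ f = !![1, f 1, f 2; 0, 1, 0; 0, 0, 1]
  ext i j
  fin_cases i <;> fin_cases j <;> simp [vecMulVec_apply, stdVec, hf]

omit [FieldFour F] in
theorem vecMulVec_left_injective {v w f : Fin 3 → F} (hf : f ≠ 0) (h : v ⊠ f = w ⊠ f) :
    v = w := by
  apply vecMulVec_right_injective hf
  rw [← transpose_vecMulVec v f, h, transpose_vecMulVec]

omit [FieldFour F] in
theorem isElation_axis {v : Fin 3 → F} (hv0 : v ≠ 0) (hv : v 2 = 0) :
    IsElation (v ⊠ stdVec F 2) :=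
  isElation_vecMulVec hv0 (stdVec_ne_zero 2) (by simp [stdVec, hv])

omit [FieldFour F] in
theorem isElation_center {f : Fin 3 → F} (hf0 : f ≠ 0) (hf : f 0 = 0) :
    IsElation (stdVec F 0 ⊠ f) :=
  isElation_vecMulVec (stdVec_ne_zero 0) hf0 (by simp [stdVec, hf])

omit [FieldFour F] in
theorem smul_vecMulVec_stdVec_mul_self (s : F) :
    (s • stdVec F 0 ⊠ stdVec F 2) * (s • stdVec F 0 ⊠ stdVec F 2) = 0 := by
  rw [Matrix.smul_mul, Matrix.mul_smul, vecMulVec_mul_vecMulVec, stdVec_dot (by decide)]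
  simp

/-- A correlation sends the elations with center `stdVec F 0` to elations with one common axis. If
it fixed them all, their axes would be proportional, but both `stdVec F 1` and `stdVec F 2` occur.
-/
theorem not_correlation_of_commute {h : unimodularCorrelationGroup F}
    (hc : ∀ X, IsElation X → elation X ∈ unitriangularGroup F → Commute h (elation X))
    (A : GL (Fin 3) F) (τ : F ≃+* F) :
    (h : Equiv.Perm (PlaneElement F)) ≠ correlation A τ := by
  intro hA
  have key : ∀ f : Fin 3 → F, f ≠ 0 → f 0 = 0 →
      ∃ c : F, c ≠ 0 ∧ f = c • semilinMap A τ (stdVec F 0) := by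
    intro f hf0 hf
    have hX := isElation_center hf0 hf
    have h1 : h * elation (stdVec F 0 ⊠ f) * h⁻¹ = elation (stdVec F 0 ⊠ f) := by
      rw [(hc _ hX (elation_mem_of_center hf)).eq, mul_inv_cancel_right]
    rw [conj_elation_of_correlation hA hX.mul_self] at h1
    have h2 := elation_injOn (transpose_mul_self (symMap_mul_self A τ hX.mul_self)) hX.mul_self h1
    rw [symMap_vecMulVec, transpose_vecMulVec] at h2
    obtain ⟨c, hc, -, h3⟩ := vecMulVec_eq_iff (stdVec_ne_zero 0) hf0 h2.symm
    exact ⟨c, hc, h3⟩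
  obtain ⟨c, hc, h1⟩ := key (stdVec F 1) (stdVec_ne_zero 1) (by simp [stdVec])
  obtain ⟨d, hd, h2⟩ := key (stdVec F 2) (stdVec_ne_zero 2) (by simp [stdVec])
  have h3 := congrFun h1 2
  have h4 := congrFun h2 2
  simp only [stdVec, Pi.single_apply, Pi.smul_apply, smul_eq_mul] at h3 h4
  simp [hc] at h3
  simp [h3] at h4

/-- The elements commuting with the unitriangular elations are elations. -/
theorem exists_eq_elation_of_commute {h : unimodularCorrelationGroup F}
    (hc : ∀ X, IsElation X → elation X ∈ unitriangularGroup F → Commute h (elation X)) :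
    ∃ s : F, h = elation (s • stdVec F 0 ⊠ stdVec F 2) := by
  obtain ⟨A, τ, -, hA | hA⟩ := exists_eq_collineation_or_correlation h
  swap
  · exact absurd hA (not_correlation_of_commute hc A τ)
  have fix : ∀ X, IsElation X → elation X ∈ unitriangularGroup F → symMap A τ X = X := by
    intro X hX hU
    have h1 : h * elation X * h⁻¹ = elation X := by
      rw [(hc _ hX hU).eq, mul_inv_cancel_right]
    rw [conj_elation_of_collineation hA hX.mul_self] at h1
    exact elation_injOn (symMap_mul_self A τ hX.mul_self) hX.mul_self h1
  have fixAxis : ∀ v : Fin 3 → F, v ≠ 0 → v 2 = 0 → semilinMap A τ v ⊠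
      semilinMap (invTranspose A) τ (stdVec F 2) = v ⊠ stdVec F 2 := fun v h0 hv => by
    rw [← symMap_vecMulVec]
    exact fix _ (isElation_axis h0 hv) (elation_mem_of_axis hv)
  have fixCenter : ∀ f : Fin 3 → F, f ≠ 0 → f 0 = 0 → semilinMap A τ (stdVec F 0) ⊠
      semilinMap (invTranspose A) τ f = stdVec F 0 ⊠ f := fun v h0 hv => by
    rw [← symMap_vecMulVec]
    exact fix _ (isElation_center h0 hv) (elation_mem_of_center hv)
  have h00 : (stdVec F 0) 2 = 0 := by simp [stdVec]
  have h20 : (stdVec F 2) 0 = 0 := by simp [stdVec]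
  obtain ⟨c, hc0, hc1, hc2⟩ := vecMulVec_eq_iff (stdVec_ne_zero 0) (stdVec_ne_zero 2)
    (fixAxis _ (stdVec_ne_zero 0) h00).symm
  have hA1 : ∀ v : Fin 3 → F, v ≠ 0 → v 2 = 0 → semilinMap A τ v = c • v := by
    intro v h0 hv
    have h1 := fixAxis v h0 hv
    have h2 : semilinMap (invTranspose A) τ (stdVec F 2) ≠ 0 :=
      semilinMap_ne_zero _ τ (stdVec_ne_zero 2)
    nth_rewrite 2 [hc2] at h1
    rw [vecMulVec_smul, ← smul_vecMulVec] at h1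
    exact vecMulVec_left_injective h2 h1
  have hA2 : ∀ f : Fin 3 → F, f ≠ 0 → f 0 = 0 → f = c • semilinMap (invTranspose A) τ f := by
    intro v h0 hv
    have h1 := fixCenter v h0 hv
    rw [hc1, smul_vecMulVec, ← vecMulVec_smul] at h1
    exact (vecMulVec_right_injective (stdVec_ne_zero 0) h1).symm
  -- On multiples of `stdVec F 0` the semilinear map is multiplication by the fixed scalar `c`,
  -- which leaves no room for `τ`.
  have hτ : τ = 1 := by
    ext a
    by_cases ha : a = 0
    · simp [ha]
    have h1 := hA1 (a • stdVec F 0) (smul_ne_zero ha (stdVec_ne_zero 0)) (by simp [stdVec])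
    rw [LinearMap.map_smulₛₗ, hc1, smul_smul, smul_smul, mul_comm c] at h1
    have h2 := smul_left_injective F (stdVec_ne_zero 0) h1
    exact mul_right_cancel₀ hc0 h2
  subst hτ
  have col : ∀ j : Fin 3, j ≠ 2 → ∀ i, A i j = c * stdVec F j i := by
    intro j hj i
    have h1 := congrFun (hA1 (stdVec F j) (stdVec_ne_zero j) (by simp [stdVec, hj.symm])) i
    rw [Pi.smul_apply, smul_eq_mul] at h1
    rw [← h1]
    change _ = ((A : Matrix (Fin 3) (Fin 3) F) *ᵥ stdVec F j) i
    simp [stdVec]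
  have row : ∀ i : Fin 3, i ≠ 0 → ∀ j, A i j = c * stdVec F i j := by
    intro i hi j
    have h1 := hA2 (stdVec F i) (stdVec_ne_zero i) (by simp [stdVec, hi.symm])
    have h2 : (A : Matrix (Fin 3) (Fin 3) F)ᵀ *ᵥ stdVec F i = c • stdVec F i := by
      have h3 : semilinMap (invTranspose A) 1 (stdVec F i) =
        ((A⁻¹ : GL (Fin 3) F) : Matrix (Fin 3) (Fin 3) F)ᵀ *ᵥ stdVec F i := rfl
      rw [h3] at h1
      nth_rewrite 1 [h1]
      rw [mulVec_smul, mulVec_mulVec, ← transpose_mul, Units.inv_mul, transpose_one, one_mulVec]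
    have h3 := congrFun h2 j
    simpa [stdVec] using h3
  -- Columns 0, 1 and rows 1, 2 of `A` agree with those of `c • 1`, so only the entry `(0, 2)` is
  -- free.
  refine ⟨c⁻¹ * A 0 2, Subtype.ext ?_⟩
  rw [hA, coe_elation (smul_vecMulVec_stdVec_mul_self _)]
  refine collineation_eq_of_smul 1 hc0 ?_
  change _ = c • (1 + (c⁻¹ * A 0 2) • stdVec F 0 ⊠ stdVec F 2)
  ext i j
  by_cases hi : i = 0
  · by_cases hj : j = 2
    · subst hi hj
      simp [vecMulVec_apply, stdVec, hc0]
    · rw [col j hj]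
      simp [vecMulVec_apply, stdVec, hj, Matrix.one_apply, Pi.single_apply]
  · rw [row i hi]
    simp [vecMulVec_apply, stdVec, hi, Matrix.one_apply, Pi.single_apply, eq_comm]

omit [FieldFour F] in
/-- The action on nontrivial elations is transitive. -/
theorem exists_symMap_eq {s : F} (hs : s ≠ 0) {X : Matrix (Fin 3) (Fin 3) F}
    (hX : IsElation X) : ∃ A : GL (Fin 3) F, (A : Matrix (Fin 3) (Fin 3) F).det = 1 ∧
      symMap A 1 (s • stdVec F 0 ⊠ stdVec F 2) = X := by
  obtain ⟨v, f, hv, hf, hvf, rfl⟩ := hX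
  -- The factor `s⁻¹` cancels the scalar `s` of the given elation.
  obtain ⟨w, hw⟩ := exists_cross_eq (f := s⁻¹ • f) hv (by rw [smul_dotProduct, hvf, smul_zero])
  obtain ⟨u, hu⟩ := exists_dot_eq_one (v := v ⨯₃ w)
    (by rw [hw]; exact smul_ne_zero (inv_ne_zero hs) hf)
  refine ⟨_, det_frame hu, ?_⟩
  rw [symMap_smul, symMap_frame]
  change s • v ⊠ (v ⨯₃ w) = _
  rw [← vecMulVec_smul, hw, smul_smul, mul_inv_cancel₀ hs, one_smul]

theorem exists_conj_eq_elation {s : F} (hs : s ≠ 0) {X : Matrix (Fin 3) (Fin 3) F}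
    (hX : IsElation X) : ∃ g : unimodularCorrelationGroup F,
      g * elation (s • stdVec F 0 ⊠ stdVec F 2) * g⁻¹ = elation X := by
  obtain ⟨A, hA, h⟩ := exists_symMap_eq hs hX
  refine ⟨⟨_, collineation_mem hA 1⟩, ?_⟩
  rw [conj_elation_of_collineation rfl (smul_vecMulVec_stdVec_mul_self s), h]

theorem finite_unimodularCorrelationGroup : Finite (unimodularCorrelationGroup F) := by
  have : Finite (ℙ F (Fin 3 → F)) := Quotient.finite _
  infer_instance

instance : Finite (unimodularCorrelationGroup F) := finite_unimodularCorrelationGroup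

theorem elation_ne_one {X : Matrix (Fin 3) (Fin 3) F} (hX : IsElation X) : elation X ≠ 1 := by
  rw [← elation_zero]
  exact fun h => hX.ne_zero (elation_injOn hX.mul_self (mul_zero 0) h)

theorem orderOf_elation {X : Matrix (Fin 3) (Fin 3) F} (hX : IsElation X) :
    orderOf (elation X) = 2 := by
  apply orderOf_eq_prime _ (elation_ne_one hX)
  rw [pow_two, elation_mul hX.mul_self hX.mul_self hX.mul_self hX.mul_self, add_self_matrix,
    elation_zero]

omit [FieldFour F] in
theorem isElation_smul_stdVec {s : F} (hs : s ≠ 0) :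
    IsElation (s • stdVec F 0 ⊠ stdVec F 2) :=
  (isElation_vecMulVec (stdVec_ne_zero 0) (stdVec_ne_zero 2) (stdVec_dot (by decide))).smul hs

/-- The central involutions are the nontrivial elations. -/
theorem isCentralInvolution_iff {x : unimodularCorrelationGroup F} :
    IsCentralInvolution _ x ↔ ∃ X, IsElation X ∧ x = elation X := by
  -- It suffices that `Q` contains the unitriangular group; equality plays no role.
  obtain ⟨Q, hQ⟩ := (isPGroup_unitriangularGroup (F := F)).exists_le_sylow
  have hcent : ∀ y : unimodularCorrelationGroup F, y ≠ 1 →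
      y ∈ Subgroup.centralizer (Q : Set (unimodularCorrelationGroup F)) →
      ∃ s : F, s ≠ 0 ∧ y = elation (s • stdVec F 0 ⊠ stdVec F 2) := by
    intro y hy1 hy
    rw [Subgroup.mem_centralizer_iff] at hy
    obtain ⟨s, hs⟩ := exists_eq_elation_of_commute (fun X _ hX => (hy _ (hQ hX)).symm)
    refine ⟨s, ?_, hs⟩
    rintro rfl
    rw [zero_smul, elation_zero] at hs
    exact hy1 hs
  constructor
  · rintro ⟨h2, P, hP⟩
    obtain ⟨g, hg⟩ := MulAction.exists_smul_eq (unimodularCorrelationGroup F) P Q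
    have hx1 : g * x * g⁻¹ ≠ 1 := by
      intro h
      rw [mul_inv_eq_one, mul_eq_left] at h
      rw [h, orderOf_one] at h2
      omega
    obtain ⟨s, hs, hy⟩ := hcent (g * x * g⁻¹) hx1 (by
      rw [Subgroup.mem_centralizer_iff] at hP ⊢
      intro y hy
      rw [← hg] at hy
      obtain ⟨z, hz, rfl⟩ := hy
      change g * z * g⁻¹ * (g * x * g⁻¹) = g * x * g⁻¹ * (g * z * g⁻¹)
      have := hP z hz
      simp only [mul_assoc, inv_mul_cancel_left]
      rw [← mul_assoc z, this, mul_assoc])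
    obtain ⟨θ, η, hθ, hconj⟩ := exists_lineAut_conj g⁻¹
    have hel := isElation_smul_stdVec hs
    refine ⟨θ _, hθ.left.isElation _ hel, ?_⟩
    rw [← hconj _ hel.mul_self, ← hy]
    group
  · rintro ⟨X, hX, rfl⟩
    refine ⟨orderOf_elation hX, ?_⟩
    have hU : elation (stdVec F 0 ⊠ stdVec F 2) ∈ Q := hQ (elation_mem_of_axis (by simp [stdVec]))
    have hnt : Nontrivial Q := by
      refine ⟨⟨⟨_, hU⟩, 1, fun h => ?_⟩⟩
      have := congrArg Subtype.val h
      exact elation_ne_one (isElation_axis (stdVec_ne_zero 0) (by simp [stdVec])) this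
    -- A nontrivial central element of `Q` is one of the elations in `hcent`; all other elations are
    -- conjugate to it.
    have := Q.isPGroup'.center_nontrivial
    obtain ⟨⟨⟨z, hzQ⟩, hz⟩, hz1⟩ := exists_ne (1 : Subgroup.center Q)
    have hzc : z ∈ Subgroup.centralizer (Q : Set (unimodularCorrelationGroup F)) := by
      rw [Subgroup.mem_centralizer_iff]
      intro y hy
      rw [Subgroup.mem_center_iff] at hz
      exact congrArg Subtype.val (hz ⟨y, hy⟩)
    obtain ⟨s, hs, hzs⟩ := hcent z (fun h => hz1 (Subtype.ext (Subtype.ext h))) hzc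
    obtain ⟨g, hg⟩ := exists_conj_eq_elation hs hX
    have : IsCentralInvolution _ z := ⟨by
      rw [hzs]; exact orderOf_elation (isElation_smul_stdVec hs), Q, hzc⟩
    rw [← hg, ← hzs]
    exact (isCentralInvolution_conj g this).2

/-- Only the identity commutes with all elations. -/
theorem eq_one_of_forall_commute {h : unimodularCorrelationGroup F}
    (hc : ∀ X, IsElation X → Commute h (elation X)) : h = 1 := by
  obtain ⟨s, rfl⟩ := exists_eq_elation_of_commute (fun X hX _ => hc X hX)
  by_cases hs : s = 0
  · rw [hs, zero_smul, elation_zero]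
  -- The opposite elation, with center and axis interchanged, does not commute with the given one.
  have h20 := isElation_vecMulVec (stdVec_ne_zero 2) (stdVec_ne_zero 0)
    (stdVec_dot (F := F) (i := 0) (j := 2) (by decide))
  have h1 := hc _ h20
  rw [← smul_vecMulVec] at h1
  have h2 := (orthogonal_of_commute (smul_ne_zero hs (stdVec_ne_zero 0)) (stdVec_ne_zero 2)
    (by rw [dotProduct_smul, stdVec_dot (by decide), smul_zero]) (stdVec_ne_zero 2)
    (stdVec_ne_zero 0) (stdVec_dot (by decide)) h1).1
  rw [stdVec_dot_self] at h2
  exact absurd h2 one_ne_zero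

end CentralInvolutions

/-! ### Counting -/

section Counting

/-- If all fibers of a map are parametrized by the same type, then the cardinality is the product
of the number of parameters and the size of the range. -/
theorem card_eq_mul_ncard_range {α β γ : Type*} [Finite α] (f : α → β)
    (p : α → γ → α) (hp : ∀ a, Function.Injective (p a))
    (hf : ∀ a b, f b = f a ↔ ∃ c, p a c = b) :
    Nat.card α = Nat.card γ * (Set.range f).ncard := by
  have h1 : ∀ y : Set.range f, Nat.card {a // Set.rangeFactorization f a = y} = Nat.card γ := by
    rintro ⟨_, a, rfl⟩
    symm
    refine Nat.card_eq_of_bijective (fun c => (⟨p a c, Subtype.ext ((hf a _).mpr ⟨c, rfl⟩)⟩ :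
      {b // Set.rangeFactorization f b = ⟨f a, a, rfl⟩})) ⟨fun c d h => ?_, ?_⟩
    · exact hp a (congrArg Subtype.val h)
    · rintro ⟨b, hb⟩
      obtain ⟨c, hc⟩ := (hf a b).mp (congrArg Subtype.val hb)
      exact ⟨c, Subtype.ext hc⟩
  have := Fintype.ofFinite (Set.range f)
  rw [Nat.card_congr (Equiv.sigmaFiberEquiv (Set.rangeFactorization f)).symm, Nat.card_sigma]
  simp only [h1]
  rw [Finset.sum_const, Finset.card_univ, smul_eq_mul, mul_comm, ← Nat.card_eq_fintype_card,
    Nat.card_coe_set_eq]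

/-- Orbit-stabilizer for conjugation on subsets of the group. -/
theorem index_normalizer_eq_ncard {G : Type*} [Group G] (S : Set G) :
    (Subgroup.normalizer S).index = (Set.range fun g : G => MulAut.conj g '' S).ncard := by
  rw [Subgroup.index, ← Nat.card_coe_set_eq]
  refine Nat.card_congr ((Quotient.congrRight fun g h => ?_).trans
    (Setoid.quotientKerEquivRange (fun g : G => MulAut.conj g '' S)))
  change (QuotientGroup.leftRel _) g h ↔ MulAut.conj g '' S = MulAut.conj h '' S
  rw [QuotientGroup.leftRel_apply, Subgroup.mem_normalizer_iff_conj_image_eq, map_mul,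
    map_inv]
  have e : ⇑(MulAut.conj g) '' (⇑((MulAut.conj g)⁻¹ * MulAut.conj h) '' S) =
      MulAut.conj h '' S := by
    rw [Set.image_image]
    exact Set.image_congr fun x _ => MulAut.apply_inv_self G (MulAut.conj g) _
  rw [← e]
  exact ⟨fun h1 => by rw [h1], fun h1 =>
    ((Set.image_injective.mpr (MulAut.conj g).injective) h1).symm⟩

theorem closure_pair_eq {G : Type*} [Group G] {x y : G} (hx : x * x = 1) (hy : y * y = 1)
    (hxy : Commute x y) : (Subgroup.closure {x, y} : Set G) = {1, x, y, x * y} := by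
  have h1 : ∀ z, x * (x * z) = z := fun z => by rw [← mul_assoc, hx, one_mul]
  have h3 : y * x = x * y := hxy.eq.symm
  have h4 : ∀ z, y * (x * z) = x * (y * z) := fun z => by rw [← mul_assoc, h3, mul_assoc]
  let K : Subgroup G :=
    { carrier := {1, x, y, x * y}
      one_mem' := by simp
      mul_mem' := by
        rintro a b (rfl | rfl | rfl | rfl) (rfl | rfl | rfl | rfl) <;>
          simp [mul_assoc, h1, h3, h4, hx, hy]
      inv_mem' := by
        have hxi : x⁻¹ = x := inv_eq_of_mul_eq_one_left hx
        have hyi : y⁻¹ = y := inv_eq_of_mul_eq_one_left hy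
        rintro a (rfl | rfl | rfl | rfl) <;> simp [hxi, hyi, h3] }
  apply Set.Subset.antisymm
  · have : Subgroup.closure {x, y} ≤ K := by
      rw [Subgroup.closure_le]
      rintro z (rfl | rfl)
      · exact Or.inr (Or.inl rfl)
      · exact Or.inr (Or.inr (Or.inl rfl))
    exact this
  · have hxm : x ∈ Subgroup.closure {x, y} := Subgroup.subset_closure (by simp)
    have hym : y ∈ Subgroup.closure {x, y} := Subgroup.subset_closure (by simp)
    rintro z (rfl | rfl | rfl | rfl)
    · exact one_mem _
    · exact hxm
    · exact hym
    · exact mul_mem hxm hym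

end Counting

/-! ### Orbits of lines -/

section Orbits

variable {F : Type*} [Field F] [FieldFour F]

/-- The set of elations with matrices in `S`, and the identity. -/
def withOne (S : Set (Matrix (Fin 3) (Fin 3) F)) : Set (unimodularCorrelationGroup F) :=
  insert 1 (elation '' S)

theorem withOne_inj {S T : Set (Matrix (Fin 3) (Fin 3) F)} (hS : ∀ X ∈ S, IsElation X)
    (hT : ∀ X ∈ T, IsElation X) (h : withOne S = withOne T) : S = T := by
  have key : ∀ S T : Set (Matrix (Fin 3) (Fin 3) F), (∀ X ∈ S, IsElation X) →
      (∀ X ∈ T, IsElation X) → withOne S = withOne T → S ⊆ T := by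
    intro S T hS hT h X hX
    have h1 : elation X ∈ withOne T := h ▸ Or.inr ⟨X, hX, rfl⟩
    rcases h1 with h1 | ⟨Y, hY, h1⟩
    · exact absurd h1 (elation_ne_one (hS X hX))
    · rwa [← elation_injOn (hT Y hY).mul_self (hS X hX).mul_self h1]
  exact Set.Subset.antisymm (key S T hS hT h) (key T S hT hS h.symm)

theorem conj_image_withOne {g : unimodularCorrelationGroup F}
    {θ : Matrix (Fin 3) (Fin 3) F → Matrix (Fin 3) (Fin 3) F}
    (hθ : ∀ X, X * X = 0 → g * elation X * g⁻¹ = elation (θ X))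
    {S : Set (Matrix (Fin 3) (Fin 3) F)} (hS : ∀ X ∈ S, IsElation X) :
    MulAut.conj g '' withOne S = withOne (θ '' S) := by
  rw [withOne, Set.image_insert_eq, map_one, withOne, Set.image_image, Set.image_image]
  congr 1
  exact Set.image_congr fun X hX => hθ X (hS X hX).mul_self

/-- A family of sets of elations which is invariant under collineations and correlations, and
transitively permuted. -/
structure IsOrbit (C : Set (Set (Matrix (Fin 3) (Fin 3) F)))
    (S₀ : Set (Matrix (Fin 3) (Fin 3) F)) : Prop where
  isElation : ∀ S ∈ C, ∀ X ∈ S, IsElation X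
  symMap : ∀ (A : GL (Fin 3) F) (τ : F ≃+* F), (A : Matrix (Fin 3) (Fin 3) F).det = 1 →
    ∀ S ∈ C, symMap A τ '' S ∈ C
  transpose : ∀ S ∈ C, (fun X => Xᵀ) '' S ∈ C
  trans : ∀ S ∈ C, ∃ g : unimodularCorrelationGroup F,
    MulAut.conj g '' withOne S₀ = withOne S

/-- Invariance and transitivity make the family exactly the conjugation orbit, and `withOne` is
injective on it. -/
theorem IsOrbit.index_normalizer {C : Set (Set (Matrix (Fin 3) (Fin 3) F))}
    {S₀ S : Set (Matrix (Fin 3) (Fin 3) F)} (h : IsOrbit C S₀) (hS : S ∈ C) :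
    (Subgroup.normalizer (withOne S)).index = C.ncard := by
  rw [index_normalizer_eq_ncard, ← Set.InjOn.ncard_image (f := withOne) (s := C)
    (fun S hS T hT => withOne_inj (h.isElation S hS) (h.isElation T hT))]
  congr 1
  apply Set.Subset.antisymm
  · rintro _ ⟨g, rfl⟩
    obtain ⟨A, τ, hA, h1 | h1⟩ := exists_eq_collineation_or_correlation g
    · exact ⟨_, h.symMap A τ hA S hS, (conj_image_withOne
        (fun X hX => conj_elation_of_collineation h1 hX) (h.isElation S hS)).symm⟩
    · refine ⟨_, h.transpose _ (h.symMap A τ hA S hS), ?_⟩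
      rw [Set.image_image]
      exact (conj_image_withOne
        (fun X hX => conj_elation_of_correlation h1 hX) (h.isElation S hS)).symm
  · rintro _ ⟨T, hT, rfl⟩
    obtain ⟨g, hg⟩ := h.trans S hS
    obtain ⟨k, hk⟩ := h.trans T hT
    refine ⟨k * g⁻¹, ?_⟩
    simp only
    rw [← hg, ← hk, Set.image_image]
    refine Set.image_congr fun x _ => ?_
    simp [mul_assoc]

end Orbits

/-! ### The two families of lines -/

section Families

variable {F : Type*} [Field F] [FieldFour F]

/-- Ordered pairs of linearly independent vectors. -/
def IndepPair (F : Type*) [Field F] : Type _ :=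
  {p : (Fin 3 → F) × (Fin 3 → F) // p.1 ⨯₃ p.2 ≠ 0}

instance : Finite (IndepPair F) := Subtype.finite

/-- There are `(4³ - 1)(4³ - 4) = 63 · 60` ordered pairs. -/
theorem card_indepPair : Nat.card (IndepPair F) = 3780 := by
  have := Fintype.ofFinite F
  have hF : Fintype.card F = 4 := by rw [Fintype.card_eq_nat_card, FieldFour.card_eq]
  have h := card_linearIndependent (K := F) (V := Fin 3 → F) (k := 2)
    (by rw [Module.finrank_fin_fun]; norm_num)
  rw [Module.finrank_fin_fun, hF] at h
  have e : IndepPair F ≃ {s : Fin 2 → Fin 3 → F // LinearIndependent F s} :=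
    { toFun := fun p => ⟨![p.1.1, p.1.2], crossProduct_ne_zero_iff_linearIndependent.mp p.2⟩
      invFun := fun s => ⟨(s.1 0, s.1 1), by
        rw [crossProduct_ne_zero_iff_linearIndependent]
        convert s.2
        ext i : 1
        fin_cases i <;> rfl⟩
      left_inv := fun p => rfl
      right_inv := fun s => by
        apply Subtype.ext
        ext i : 1
        fin_cases i <;> rfl }
  rw [Nat.card_congr e, h]
  rfl

theorem card_units_eq : Nat.card Fˣ = 3 := by
  rw [Nat.card_units, FieldFour.card_eq]

/-- The elations with a given center and axis. -/
def rootSet (X : Matrix (Fin 3) (Fin 3) F) : Set (Matrix (Fin 3) (Fin 3) F) :=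
  Set.range fun c : Fˣ => (c : F) • X

/-- The family of all root sets. -/
def rootFamily (F : Type*) [Field F] : Set (Set (Matrix (Fin 3) (Fin 3) F)) :=
  {S | ∃ X, IsElation X ∧ S = rootSet X}

omit [FieldFour F] in
theorem rootFamily_eq_range : rootFamily F =
    Set.range fun p : IndepPair F => rootSet (p.1.1 ⊠ (p.1.1 ⨯₃ p.1.2)) := by
  ext S
  constructor
  · rintro ⟨_, ⟨v, f, hv, hf, h, rfl⟩, rfl⟩
    obtain ⟨w, rfl⟩ := exists_cross_eq hv h
    exact ⟨⟨(v, w), hf⟩, rfl⟩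
  · rintro ⟨p, rfl⟩
    exact ⟨_, isElation_vecMulVec (left_ne_zero_of_cross p.2) p.2
      (by rw [dotProduct_comm, left_dot_cross]), rfl⟩

/-- Two pairs give the same root set exactly when `v' = a v` and `w' = b w + c v` with `a`, `b`
nonzero. Each root set thus arises from `3 · 3 · 4 = 36` pairs, and `3780 / 36 = 105`. -/
theorem ncard_rootFamily : (rootFamily F).ncard = 105 := by
  rw [rootFamily_eq_range]
  have h := card_eq_mul_ncard_range (α := IndepPair F) (γ := Fˣ × Fˣ × F)
    (fun p : IndepPair F => rootSet (p.1.1 ⊠ (p.1.1 ⨯₃ p.1.2)))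
    (fun p c => ⟨((c.1 : F) • p.1.1, (c.2.1 : F) • p.1.2 + c.2.2 • p.1.1), by
      simp [p.2]⟩) ?_ ?_
  · rw [card_indepPair, Nat.card_prod, Nat.card_prod, card_units_eq, FieldFour.card_eq] at h
    omega
  · rintro ⟨⟨v, w⟩, hp⟩ ⟨a, b, c⟩ ⟨a', b', c'⟩ h
    have hp' : v ⨯₃ w ≠ 0 := hp
    have hv := left_ne_zero_of_cross hp'
    have h1 := congrArg Prod.fst (congrArg Subtype.val h)
    have h2 := congrArg Prod.snd (congrArg Subtype.val h)
    simp only at h1 h2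
    have ha : a = a' := Units.ext (smul_left_injective F hv h1)
    have h3 := congrArg (fun z => v ⨯₃ z) h2
    simp only [map_add, map_smul, cross_self, smul_zero, add_zero] at h3
    have hb : b = b' := Units.ext (smul_left_injective F hp' h3)
    subst ha hb
    have hc := smul_left_injective F hv (add_left_cancel h2)
    rw [hc]
  · rintro ⟨⟨v, w⟩, hp⟩ ⟨⟨v', w'⟩, hp'⟩
    change v ⨯₃ w ≠ 0 at hp
    change v' ⨯₃ w' ≠ 0 at hp'
    have hv := left_ne_zero_of_cross hp
    have hv' := left_ne_zero_of_cross hp'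
    constructor
    · intro h
      simp only at h
      have h1 : v' ⊠ (v' ⨯₃ w') ∈ rootSet (v ⊠ (v ⨯₃ w)) := by
        rw [← h]; exact ⟨1, by simp⟩
      obtain ⟨d, hd⟩ := h1
      simp only at hd
      rw [← vecMulVec_smul] at hd
      obtain ⟨a, ha, rfl, h2⟩ := vecMulVec_eq_iff hv (smul_ne_zero d.ne_zero hp) hd
      rw [map_smul, LinearMap.smul_apply, smul_smul] at h2
      have h3 : v ⨯₃ ((a * a * (d : F)⁻¹) • w' - w) = 0 := by
        rw [map_sub, map_smul, mul_comm, mul_smul, ← h2, smul_smul, inv_mul_cancel₀ d.ne_zero,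
          one_smul, sub_self]
      obtain ⟨c, hc⟩ := exists_smul_of_cross_eq_zero hv h3
      have hk : a * a * (d : F)⁻¹ ≠ 0 := mul_ne_zero (mul_ne_zero ha ha) (inv_ne_zero d.ne_zero)
      refine ⟨(Units.mk0 a ha, (Units.mk0 _ hk)⁻¹, (a * a * (d : F)⁻¹)⁻¹ * c), ?_⟩
      apply Subtype.ext
      refine Prod.ext rfl ?_
      change ((Units.mk0 _ hk)⁻¹ : Fˣ).val • w + ((a * a * (d : F)⁻¹)⁻¹ * c) • v = w'
      rw [mul_smul, ← hc, Units.val_inv_eq_inv_val, Units.val_mk0, ← smul_add, add_sub_cancel,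
        inv_smul_smul₀ hk]
    · rintro ⟨⟨a, b, c⟩, h⟩
      have h1 := congrArg Prod.fst (congrArg Subtype.val h)
      have h2 := congrArg Prod.snd (congrArg Subtype.val h)
      simp only at h1 h2
      subst h1 h2
      have e : ((a : F) • v) ⊠ (((a : F) • v) ⨯₃ ((b : F) • w + c • v)) =
          ((a * a * b : Fˣ) : F) • v ⊠ (v ⨯₃ w) := by
        simp [smul_vecMulVec, vecMulVec_smul, smul_smul, mul_comm, mul_left_comm]
      ext Z
      constructor
      · rintro ⟨d, rfl⟩
        refine ⟨d * (a * a * b), ?_⟩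
        simp only
        rw [e, smul_smul, Units.val_mul]
      · rintro ⟨d, rfl⟩
        refine ⟨d * (a * a * b)⁻¹, ?_⟩
        simp only
        rw [e, smul_smul, ← Units.val_mul, inv_mul_cancel_right]

omit [FieldFour F] in
theorem symMap_image_rootSet (A : GL (Fin 3) F) (τ : F ≃+* F) (X : Matrix (Fin 3) (Fin 3) F) :
    symMap A τ '' rootSet X = rootSet (symMap A τ X) := by
  rw [rootSet, rootSet, ← Set.range_comp]
  ext Z
  constructor
  · rintro ⟨c, rfl⟩
    exact ⟨Units.map (τ : F →* F) c, (symMap_smul A τ c X).symm⟩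
  · rintro ⟨c, rfl⟩
    refine ⟨Units.map (τ.symm : F →* F) c, (symMap_smul A τ _ X).trans ?_⟩
    simp

theorem isOrbit_rootFamily :
    IsOrbit (rootFamily F) (rootSet ((1 : F) • stdVec F 0 ⊠ stdVec F 2)) where
  isElation := by
    rintro _ ⟨X, hX, rfl⟩ _ ⟨c, rfl⟩
    exact hX.smul c.ne_zero
  symMap := by
    rintro A τ hA _ ⟨X, hX, rfl⟩
    exact ⟨_, (linePreserving_symMap hA τ).isElation X hX, symMap_image_rootSet A τ X⟩
  transpose := by
    rintro _ ⟨X, hX, rfl⟩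
    refine ⟨_, hX.transpose, ?_⟩
    rw [rootSet, rootSet, ← Set.range_comp]
    congr 1
  trans := by
    rintro _ ⟨X, hX, rfl⟩
    obtain ⟨A, hA, rfl⟩ := exists_symMap_eq one_ne_zero hX
    refine ⟨⟨_, collineation_mem hA 1⟩, ?_⟩
    rw [conj_image_withOne (fun X hX => conj_elation_of_collineation rfl hX),
      symMap_image_rootSet]
    rintro _ ⟨c, rfl⟩
    exact (isElation_smul_stdVec one_ne_zero).smul c.ne_zero

end Families

/-! ### Line sets with a common center or a common axis, and their number -/

section Families

variable {F : Type*} [Field F]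

/-- The nonzero vectors of the additive group generated by two vectors. -/
def trio (f g : Fin 3 → F) : Fin 3 → (Fin 3 → F) := ![f, g, f + g]

/-- The elation with center `v` and axis `k`, or with axis `v` and center `k`. -/
def tens (ε : Bool) (v k : Fin 3 → F) : Matrix (Fin 3) (Fin 3) F :=
  bif ε then v ⊠ k else k ⊠ v

/-- Three elations with the same center (or the same axis), closed under multiplication. -/
def lineSet (ε : Bool) (δ : F) (f g : Fin 3 → F) : Set (Matrix (Fin 3) (Fin 3) F) :=
  Set.range fun i => tens ε (δ • f ⨯₃ g) (trio f g i)

/-- The family of all line sets with parameters in `D`. -/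
def lineFamily (D : Set F) : Set (Set (Matrix (Fin 3) (Fin 3) F)) :=
  {S | ∃ ε : Bool, ∃ δ ∈ D, ∃ f g : Fin 3 → F, f ⨯₃ g ≠ 0 ∧ S = lineSet ε δ f g}

theorem lineFamily_eq_range (D : Set F) : lineFamily D =
    Set.range fun a : Bool × D × IndepPair F => lineSet a.1 (a.2.1 : F) a.2.2.1.1 a.2.2.1.2 := by
  ext S
  constructor
  · rintro ⟨ε, δ, hδ, f, g, h, rfl⟩
    exact ⟨(ε, ⟨δ, hδ⟩, ⟨(f, g), h⟩), rfl⟩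
  · rintro ⟨⟨ε, ⟨δ, hδ⟩, ⟨⟨f, g⟩, h⟩⟩, rfl⟩
    exact ⟨ε, δ, hδ, f, g, h, rfl⟩

theorem transpose_tens (ε : Bool) (v k : Fin 3 → F) : (tens ε v k)ᵀ = tens (!ε) v k := by
  cases ε <;> exact transpose_vecMulVec _ _

theorem transpose_image_lineSet (ε : Bool) (δ : F) (f g : Fin 3 → F) :
    (fun X => Xᵀ) '' lineSet ε δ f g = lineSet (!ε) δ f g := by
  rw [lineSet, lineSet, ← Set.range_comp]
  congr 1
  ext i : 1
  exact transpose_tens _ _ _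

theorem tens_eq_tens {ε : Bool} {v w k l : Fin 3 → F} (hv : v ≠ 0) (hk : k ≠ 0)
    (h : tens ε w l = tens ε v k) : ∃ c : F, c ≠ 0 ∧ w = c • v ∧ k = c • l := by
  cases ε
  · have h1 := congrArg Matrix.transpose h
    rw [transpose_tens, transpose_tens] at h1
    exact vecMulVec_eq_iff hv hk h1.symm
  · exact vecMulVec_eq_iff hv hk h.symm

/-- This separates the families with common center and common axis: two elements of one set lying in
a set of the other kind would have parallel varying vectors. -/
theorem tens_eq_tens_not {ε : Bool} {v w k l : Fin 3 → F} (hv : v ≠ 0) (hk : k ≠ 0)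
    (h : tens (!ε) w l = tens ε v k) : ∃ c : F, c ≠ 0 ∧ l = c • v := by
  cases ε
  · have h1 := congrArg Matrix.transpose h
    rw [transpose_tens, transpose_tens] at h1
    obtain ⟨c, hc, h2, -⟩ := vecMulVec_eq_iff hv hk h1.symm
    exact ⟨c, hc, h2⟩
  · obtain ⟨c, hc, h2, -⟩ := vecMulVec_eq_iff hv hk h.symm
    exact ⟨c, hc, h2⟩

variable [FieldFour F]

theorem add_self_vec (v : Fin 3 → F) : v + v = 0 := by
  rw [← two_smul F, two_eq_zero, zero_smul]

/-- In characteristic two the order of the factors and the addition of one to the other do not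
matter. Hence `δ` is independent of the generating pair. -/
theorem trio_cross {i j : Fin 3} (h : i ≠ j) (f g : Fin 3 → F) :
    trio f g i ⨯₃ trio f g j = f ⨯₃ g := by
  fin_cases i <;> fin_cases j <;> first | exact absurd rfl h | simp [trio, cross_comm g f]

theorem trio_ne_zero {f g : Fin 3 → F} (h : f ⨯₃ g ≠ 0) (i : Fin 3) : trio f g i ≠ 0 := by
  have hi : i ≠ i + 1 := by revert i; decide
  rw [← trio_cross hi] at h
  exact left_ne_zero_of_cross h

omit [FieldFour F] in
theorem trio_dot (f g : Fin 3 → F) (i : Fin 3) : trio f g i ⬝ᵥ f ⨯₃ g = 0 := by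
  fin_cases i
  · exact left_dot_cross _ _
  · exact right_dot_cross _ _
  · simp [trio, add_dotProduct]

theorem range_trio_trio {i j : Fin 3} (h : i ≠ j) (f g : Fin 3 → F) :
    Set.range (trio (trio f g i) (trio f g j)) = Set.range (trio f g) := by
  have h1 : ∀ v w : Fin 3 → F, v + (v + w) = w := fun v w => by
    rw [← add_assoc, add_self_vec, zero_add]
  have h2 : ∀ v w : Fin 3 → F, v + w + v = w := fun v w => by rw [add_comm, h1]
  have h3 : ∀ v w : Fin 3 → F, w + (v + w) = v := fun v w => by rw [add_comm v, h1]
  have h4 : ∀ v w : Fin 3 → F, v + w + w = v := fun v w => by rw [add_comm, h3]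
  have h5 : ∀ v w : Fin 3 → F, Set.range (trio v w) = {v, w, v + w} := fun v w => by
    ext x
    simp [trio, eq_comm]
    tauto
  rw [h5, h5]
  ext x
  fin_cases i <;> fin_cases j <;> first | exact absurd rfl h | skip
  all_goals simp only [trio, Fin.zero_eta, Fin.mk_one, Fin.reduceFinMk, cons_val_zero,
    cons_val_one, cons_val, h1, h2, h3, h4, Set.mem_insert_iff, Set.mem_singleton_iff,
    add_comm g f]
  all_goals tauto

omit [FieldFour F] in
theorem lineSet_eq_image (ε : Bool) (δ : F) (f g : Fin 3 → F) :
    lineSet ε δ f g = tens ε (δ • f ⨯₃ g) '' Set.range (trio f g) := by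
  rw [← Set.range_comp]; rfl

theorem tens_smul_smul {c : F} (hc : c ≠ 0) (ε : Bool) (v k : Fin 3 → F) :
    tens ε (c ^ 2 • v) (c • k) = tens ε v k := by
  have h := pow_three hc
  cases ε <;> simp [tens, smul_vecMulVec, vecMulVec_smul, smul_smul, ← pow_succ, ← pow_succ', h]

/-- The cross product gains `c ^ 2` and the other factor gains `c`, with product `c ^ 3 = 1`. -/
theorem lineSet_smul {c : F} (hc : c ≠ 0) (ε : Bool) (δ : F) (f g : Fin 3 → F) :
    lineSet ε δ (c • f) (c • g) = lineSet ε δ f g := by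
  rw [lineSet, lineSet]
  congr 1
  ext i : 1
  have h1 : trio (c • f) (c • g) i = c • trio f g i := by
    fin_cases i <;> simp [trio]
  rw [h1, cross_smul_smul, smul_smul, mul_comm, mul_smul, ← pow_two, tens_smul_smul hc]

/-- A line set determines `ε` and `δ`, and determines `(f, g)` up to the 3 scalars and the 6 ordered
pairs of distinct members of the trio. So each choice of `ε` and `δ` contributes `3780 / 18 = 210`
sets. -/
theorem ncard_lineFamily {D : Set F} (hD : 0 ∉ D) :
    (lineFamily D).ncard = 2 * D.ncard * 210 := by
  rw [lineFamily_eq_range]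
  have h := card_eq_mul_ncard_range (α := Bool × D × IndepPair F)
    (γ := Fˣ × {i : Fin 3 × Fin 3 // i.1 ≠ i.2})
    (fun a => lineSet a.1 (a.2.1 : F) a.2.2.1.1 a.2.2.1.2)
    (fun a c => (a.1, a.2.1, ⟨((c.1 : F) • trio a.2.2.1.1 a.2.2.1.2 c.2.1.1,
      (c.1 : F) • trio a.2.2.1.1 a.2.2.1.2 c.2.1.2), by
        rw [cross_smul_smul, trio_cross c.2.2]
        exact smul_ne_zero (mul_ne_zero c.1.ne_zero c.1.ne_zero) a.2.2.2⟩)) ?_ ?_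
  · have hc : Nat.card {i : Fin 3 × Fin 3 // i.1 ≠ i.2} = 6 := by
      rw [Nat.card_eq_fintype_card]; decide
    rw [Nat.card_prod, Nat.card_prod, card_indepPair, Nat.card_prod, card_units_eq, hc,
      Nat.card_eq_fintype_card, Fintype.card_bool, Nat.card_coe_set_eq] at h
    omega
  · rintro ⟨ε, δ, ⟨⟨f, g⟩, hp⟩⟩ ⟨c, ⟨⟨i, j⟩, hij⟩⟩ ⟨c', ⟨⟨i', j'⟩, hij'⟩⟩ h
    change f ⨯₃ g ≠ 0 at hp
    have h1 := congrArg (fun a => a.2.2.1.1) h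
    have h2 := congrArg (fun a => a.2.2.1.2) h
    simp only at h1 h2
    have key : ∀ k l : Fin 3, (c : F) • trio f g k = (c' : F) • trio f g l → k = l := by
      intro k l hkl
      by_contra hne
      have h3 : ((c : F) • trio f g k) ⨯₃ ((c' : F) • trio f g l) = 0 := by
        rw [hkl, cross_self]
      rw [cross_smul_smul, trio_cross hne] at h3
      exact smul_ne_zero (mul_ne_zero c.ne_zero c'.ne_zero) hp h3
    have hi := key _ _ h1
    have hj := key _ _ h2
    subst hi hj
    have hcc : c = c' := Units.ext (smul_left_injective F (trio_ne_zero hp i) h1)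
    rw [hcc]
  · rintro ⟨ε, ⟨δ, hδ⟩, ⟨⟨f, g⟩, hp⟩⟩ ⟨ε', ⟨δ', hδ'⟩, ⟨⟨f', g'⟩, hp'⟩⟩
    change f ⨯₃ g ≠ 0 at hp
    change f' ⨯₃ g' ≠ 0 at hp'
    have hδ0 : δ ≠ 0 := fun h => hD (h ▸ hδ)
    have hv : δ • f ⨯₃ g ≠ 0 := smul_ne_zero hδ0 hp
    constructor
    · intro h
      simp only at h
      have hf' : tens ε' (δ' • f' ⨯₃ g') f' ∈ lineSet ε δ f g := h ▸ ⟨0, rfl⟩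
      have hg' : tens ε' (δ' • f' ⨯₃ g') g' ∈ lineSet ε δ f g := h ▸ ⟨1, rfl⟩
      obtain ⟨i, hi⟩ := hf'
      obtain ⟨j, hj⟩ := hg'
      have hε : ε' = ε := by
        by_contra hne
        have hne' : ε' = !ε := by cases ε <;> cases ε' <;> simp_all
        rw [hne'] at hi hj
        obtain ⟨c, -, rfl⟩ := tens_eq_tens_not hv (trio_ne_zero hp i) hi.symm
        obtain ⟨d, -, rfl⟩ := tens_eq_tens_not hv (trio_ne_zero hp j) hj.symm
        simp at hp'
      subst hε
      obtain ⟨c, hc, h1, h2⟩ := tens_eq_tens hv (trio_ne_zero hp i) hi.symm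
      obtain ⟨d, -, h3, h4⟩ := tens_eq_tens hv (trio_ne_zero hp j) hj.symm
      have hdc : d = c := smul_left_injective F hv (h3.symm.trans h1)
      subst hdc
      have hij : i ≠ j := by
        rintro rfl
        have : f' = g' := smul_right_injective _ hc (h2.symm.trans h4)
        rw [this] at hp'
        simp at hp'
      have h5 : f ⨯₃ g = (d * d) • f' ⨯₃ g' := by
        rw [← trio_cross hij, h2, h4, cross_smul_smul]
      -- Comparing centers gives `δ' = d ^ 3 * δ`, and `d ^ 3 = 1`.
      have hδδ : δ' = δ := by
        rw [h5, smul_smul, smul_smul] at h1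
        have h6 := smul_left_injective F hp' h1
        linear_combination h6 + δ * pow_three hc
      subst hδδ
      refine ⟨(Units.mk0 d⁻¹ (inv_ne_zero hc), ⟨(i, j), hij⟩), ?_⟩
      simp only [Units.val_mk0, h2, h4, inv_smul_smul₀ hc]
    · rintro ⟨⟨c, ⟨⟨i, j⟩, hij⟩⟩, h⟩
      have h1 := congrArg (fun a => a.1) h
      have h2 := congrArg (fun a => (a.2.1 : F)) h
      have h3 := congrArg (fun a => a.2.2.1.1) h
      have h4 := congrArg (fun a => a.2.2.1.2) h
      simp only at h1 h2 h3 h4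
      subst h1 h2 h3 h4
      simp only
      rw [lineSet_smul c.ne_zero, lineSet_eq_image, range_trio_trio hij, trio_cross hij,
        ← lineSet_eq_image]

theorem isElation_of_mem_lineSet {ε : Bool} {δ : F} (hδ : δ ≠ 0) {f g : Fin 3 → F}
    (h : f ⨯₃ g ≠ 0) {X : Matrix (Fin 3) (Fin 3) F} (hX : X ∈ lineSet ε δ f g) :
    IsElation X := by
  obtain ⟨i, rfl⟩ := hX
  have h1 : IsElation (tens true (δ • f ⨯₃ g) (trio f g i)) :=
    isElation_vecMulVec (smul_ne_zero hδ h) (trio_ne_zero h i)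
      (by rw [dotProduct_smul, trio_dot, smul_zero])
  cases ε
  · have := h1.transpose
    rwa [transpose_tens] at this
  · exact h1

omit [FieldFour F] in
theorem symMap_image_lineSet_true {A : GL (Fin 3) F}
    (hA : (A : Matrix (Fin 3) (Fin 3) F).det = 1) (τ : F ≃+* F) (δ : F) (f g : Fin 3 → F) :
    symMap A τ '' lineSet true δ f g = lineSet true (τ δ)
      (semilinMap (invTranspose A) τ f) (semilinMap (invTranspose A) τ g) := by
  rw [lineSet, lineSet, ← Set.range_comp]
  congr 1
  ext i : 1
  have h : trio (semilinMap (invTranspose A) τ f) (semilinMap (invTranspose A) τ g) i =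
      semilinMap (invTranspose A) τ (trio f g i) := by
    fin_cases i <;> simp [trio]
  have h2 : semilinMap A τ (δ • f ⨯₃ g) = τ δ • semilinMap A τ (f ⨯₃ g) :=
    LinearMap.map_smulₛₗ _ _ _
  rw [h, semilinMap_cross' hA, ← h2]
  exact symMap_vecMulVec A τ _ _

omit [FieldFour F] in
theorem symMap_transpose (A : GL (Fin 3) F) (τ : F ≃+* F) (X : Matrix (Fin 3) (Fin 3) F) :
    symMap A τ Xᵀ = (symMap (invTranspose A) τ X)ᵀ := by
  have h : ((invTranspose A)⁻¹ : GL (Fin 3) F).val = (A : Matrix (Fin 3) (Fin 3) F)ᵀ := rfl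
  rw [symMap, symMap, h, transpose_mul, transpose_mul, transpose_transpose, mul_assoc]
  rfl

omit [FieldFour F] in
theorem symMap_mem_lineFamily {D : Set F} (hτ : ∀ (τ : F ≃+* F), ∀ δ ∈ D, τ δ ∈ D)
    {A : GL (Fin 3) F} (hA : (A : Matrix (Fin 3) (Fin 3) F).det = 1) (τ : F ≃+* F)
    {S : Set (Matrix (Fin 3) (Fin 3) F)} (hS : S ∈ lineFamily D) :
    symMap A τ '' S ∈ lineFamily D := by
  obtain ⟨ε, δ, hδ, f, g, h, rfl⟩ := hS
  have hne : ∀ B : GL (Fin 3) F, (B : Matrix (Fin 3) (Fin 3) F).det = 1 →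
      semilinMap B τ f ⨯₃ semilinMap B τ g ≠ 0 := fun B hB => by
    rw [semilinMap_cross hB]
    exact semilinMap_ne_zero _ τ h
  cases ε
  · rw [show false = !true from rfl, ← transpose_image_lineSet, Set.image_image]
    simp only [symMap_transpose]
    rw [← Set.image_image (fun X => Xᵀ), symMap_image_lineSet_true (det_invTranspose A hA),
      transpose_image_lineSet, invTranspose_invTranspose]
    exact ⟨_, _, hτ τ δ hδ, _, _, hne A hA, rfl⟩
  · rw [symMap_image_lineSet_true hA]
    exact ⟨_, _, hτ τ δ hδ, _, _, hne _ (det_invTranspose A hA), rfl⟩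

/-- A matrix with columns `f`, `g` and a third vector completing them to determinant one moves the
standard pair to `(f, g)`. The field automorphism adjusts `δ`, and a correlation switches between
common center and common axis. -/
theorem isOrbit_lineFamily {D : Set F} (hD : 0 ∉ D) (hτ : ∀ (τ : F ≃+* F), ∀ δ ∈ D, τ δ ∈ D)
    {δ₀ : F} (hδ₀ : δ₀ ≠ 0) (htrans : ∀ δ ∈ D, ∃ τ : F ≃+* F, τ δ₀ = δ) :
    IsOrbit (lineFamily D) (lineSet true δ₀ (stdVec F 0) (stdVec F 1)) where
  isElation := by
    rintro _ ⟨ε, δ, hδ, f, g, h, rfl⟩ X hX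
    exact isElation_of_mem_lineSet (fun h => hD (h ▸ hδ)) h hX
  symMap A τ hA S hS := symMap_mem_lineFamily hτ hA τ hS
  transpose := by
    rintro _ ⟨ε, δ, hδ, f, g, h, rfl⟩
    exact ⟨!ε, δ, hδ, f, g, h, transpose_image_lineSet ε δ f g⟩
  trans := by
    rintro _ ⟨ε, δ, hδ, f, g, h, rfl⟩
    obtain ⟨τ, rfl⟩ := htrans δ hδ
    obtain ⟨k, hk⟩ := exists_dot_eq_one h
    have e01 : stdVec F 0 ⨯₃ stdVec F 1 ≠ 0 := by
      rw [show stdVec F 0 ⨯₃ stdVec F 1 = stdVec F 2 from stdVec_cross 0]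
      exact stdVec_ne_zero 2
    have hA := det_invTranspose _ (det_frame hk)
    have himg : symMap (invTranspose (frame f g k hk)) τ ''
        lineSet true δ₀ (stdVec F 0) (stdVec F 1) = lineSet true (τ δ₀) f g := by
      rw [symMap_image_lineSet_true hA, invTranspose_invTranspose, semilinMap_frame,
        semilinMap_frame]
      rfl
    have hel := fun X => isElation_of_mem_lineSet (ε := true) hδ₀ e01 (X := X)
    cases ε
    · refine ⟨⟨_, correlation_mem hA τ⟩, ?_⟩
      rw [conj_image_withOne (fun X hX => conj_elation_of_correlation rfl hX) hel,
        ← Set.image_image (fun X => Xᵀ), himg, transpose_image_lineSet]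
      rfl
    · refine ⟨⟨_, collineation_mem hA τ⟩, ?_⟩
      rw [conj_image_withOne (fun X hX => conj_elation_of_collineation rfl hX) hel, himg]

theorem exists_ringEquiv {a b : F} (ha : a ≠ 0) (ha1 : a ≠ 1) (hb : b ≠ 0) (hb1 : b ≠ 1) :
    ∃ τ : F ≃+* F, τ a = b := by
  rcases eq_one_or_eq_or_eq_sq ha ha1 hb with h | h | h
  · exact absurd h hb1
  · exact ⟨1, h.symm⟩
  · obtain ⟨τ, hτ⟩ := exists_frobenius (F := F)
    exact ⟨τ, by rw [hτ, h]⟩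

theorem index_normalizer_lineSet_one (ε : Bool) {f g : Fin 3 → F} (h : f ⨯₃ g ≠ 0) :
    (Subgroup.normalizer (withOne (lineSet ε 1 f g))).index = 420 := by
  have horb : IsOrbit (lineFamily ({1} : Set F)) _ := isOrbit_lineFamily (by simp) (by simp)
    (one_ne_zero) (by simp)
  rw [horb.index_normalizer ⟨ε, 1, rfl, f, g, h, rfl⟩, ncard_lineFamily (by simp),
    Set.ncard_singleton]

/-- Frobenius fuses the two values of `δ` outside `{0, 1}` into one orbit of size `2 · 2 · 210`.
This is how the index distinguishes `δ = 1`. -/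
theorem index_normalizer_lineSet_of_ne (ε : Bool) {δ : F} (hδ : δ ≠ 0) (hδ1 : δ ≠ 1)
    {f g : Fin 3 → F} (h : f ⨯₃ g ≠ 0) :
    (Subgroup.normalizer (withOne (lineSet ε δ f g))).index = 840 := by
  have horb : IsOrbit (lineFamily ({0, 1}ᶜ : Set F)) _ := isOrbit_lineFamily (by simp) (by simp)
    hδ (fun δ' h' => by
      simp only [Set.mem_compl_iff, Set.mem_insert_iff, Set.mem_singleton_iff, not_or] at h'
      exact exists_ringEquiv hδ hδ1 h'.1 h'.2)
  rw [horb.index_normalizer ⟨ε, δ, by simp [hδ, hδ1], f, g, h, rfl⟩, ncard_lineFamily (by simp)]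
  have := Set.ncard_add_ncard_compl ({0, 1} : Set F)
  rw [Set.ncard_pair zero_ne_one, FieldFour.card_eq] at this
  omega

end Families

/-! ### The lines of the near octagon -/

section Lines

variable {F : Type*} [Field F]

theorem Adj.ne {X Y : Matrix (Fin 3) (Fin 3) F} (h : Adj X Y) : X ≠ Y := by
  rcases h with ⟨⟨v, f, hv, hf, -, rfl⟩, c, h0, h1, rfl⟩ | ⟨f, g, h, rfl, rfl⟩ | ⟨v, w, h, rfl, rfl⟩
  · intro h
    rw [← vecMulVec_smul] at h
    have h2 := vecMulVec_right_injective hv h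
    exact h1 (smul_left_injective F hf (by simpa using h2.symm))
  · intro h2
    rw [vecMulVec_right_injective h h2] at h
    simp at h
  · intro h2
    rw [vecMulVec_left_injective h h2] at h
    simp at h

theorem Adj.mul_eq_zero {X Y : Matrix (Fin 3) (Fin 3) F} (h : Adj X Y) : X * Y = 0 := by
  rcases h with ⟨hX, c, h0, h1, rfl⟩ | ⟨f, g, h, rfl, rfl⟩ | ⟨v, w, h, rfl, rfl⟩
  · rw [Matrix.mul_smul, hX.mul_self, smul_zero]
  · rw [vecMulVec_mul_vecMulVec, left_dot_cross, zero_smul, vecMulVec_zero]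
  · rw [vecMulVec_mul_vecMulVec, dotProduct_comm, right_dot_cross, zero_smul, vecMulVec_zero]

variable [FieldFour F]

theorem Adj.isElation_add {X Y : Matrix (Fin 3) (Fin 3) F} (h : Adj X Y) : IsElation (X + Y) := by
  rcases h with ⟨hX, c, h0, h1, rfl⟩ | ⟨f, g, h, rfl, rfl⟩ | ⟨v, w, h, rfl, rfl⟩
  · have : X + c • X = (1 + c) • X := by rw [add_smul, one_smul]
    rw [this]
    refine hX.smul fun h => h1 ?_
    linear_combination h - two_eq_zero (F := F)
  · rw [← vecMulVec_add]
    refine isElation_vecMulVec h ?_ (by rw [add_dotProduct, left_dot_cross, right_dot_cross,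
      add_zero])
    exact trio_ne_zero h 2
  · rw [← add_vecMulVec]
    refine isElation_vecMulVec ?_ h (by rw [dotProduct_add, dotProduct_comm, left_dot_cross,
      dotProduct_comm, right_dot_cross, add_zero])
    exact trio_ne_zero h 2

theorem withOne_triple {X Y : Matrix (Fin 3) (Fin 3) F} (hX : IsElation X) (hY : IsElation Y)
    (hXY : X * Y = 0) (hYX : Y * X = 0) :
    (Subgroup.closure {elation X, elation Y} : Set (unimodularCorrelationGroup F)) =
      withOne {X, Y, X + Y} := by
  have hm := elation_mul hX.mul_self hY.mul_self hXY hYX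
  have hm' := elation_mul hY.mul_self hX.mul_self hYX hXY
  have hsq : ∀ Z : Matrix (Fin 3) (Fin 3) F, Z * Z = 0 → elation Z * elation Z = 1 :=
    fun Z hZ => by rw [elation_mul hZ hZ hZ hZ, add_self_matrix, elation_zero]
  rw [closure_pair_eq (hsq X hX.mul_self) (hsq Y hY.mul_self)
    (by rw [Commute, SemiconjBy, hm, hm', add_comm]), hm, withOne, Set.image_insert_eq,
    Set.image_pair]

theorem triple_eq_rootSet {X : Matrix (Fin 3) (Fin 3) F} {c : F} (h0 : c ≠ 0) (h1 : c ≠ 1) :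
    ({X, c • X, X + c • X} : Set (Matrix (Fin 3) (Fin 3) F)) = rootSet X := by
  -- A scalar outside `{0, 1}` is a primitive cube root of unity.
  have h2 : (1 + c) = c ^ 2 := by
    have h := pow_three h0
    have : (c - 1) * (c ^ 2 + c + 1) = 0 := by linear_combination h
    have := (mul_eq_zero.mp this).resolve_left (sub_ne_zero.mpr h1)
    linear_combination this - c ^ 2 * two_eq_zero (F := F)
  have h3 : X + c • X = (c ^ 2) • X := by rw [← h2, add_smul, one_smul]
  rw [h3]
  ext Z
  constructor
  · rintro (rfl | rfl | rfl)
    · exact ⟨1, by simp⟩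
    · exact ⟨Units.mk0 c h0, rfl⟩
    · exact ⟨Units.mk0 (c ^ 2) (pow_ne_zero 2 h0), rfl⟩
  · rintro ⟨d, rfl⟩
    rcases eq_one_or_eq_or_eq_sq h0 h1 d.ne_zero with h | h | h
    · left; simp [h]
    · right; left; simp [h]
    · right; right; simp [h]

omit [FieldFour F] in
theorem lineSet_true (δ : F) (f g : Fin 3 → F) : lineSet true δ f g =
    {(δ • f ⨯₃ g) ⊠ f, (δ • f ⨯₃ g) ⊠ g, (δ • f ⨯₃ g) ⊠ f + (δ • f ⨯₃ g) ⊠ g} := by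
  rw [← vecMulVec_add]
  ext X
  simp [lineSet, Fin.exists_fin_succ, tens, trio, eq_comm]

omit [FieldFour F] in
theorem lineSet_false (δ : F) (f g : Fin 3 → F) : lineSet false δ f g =
    {f ⊠ (δ • f ⨯₃ g), g ⊠ (δ • f ⨯₃ g), f ⊠ (δ • f ⨯₃ g) + g ⊠ (δ • f ⨯₃ g)} := by
  rw [← add_vecMulVec]
  ext X
  simp [lineSet, Fin.exists_fin_succ, tens, trio, eq_comm]

theorem Adj.index_normalizer {X Y : Matrix (Fin 3) (Fin 3) F} (h : Adj X Y) :
    (Subgroup.normalizer (withOne {X, Y, X + Y})).index = 105 ∨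
      (Subgroup.normalizer (withOne {X, Y, X + Y})).index = 420 := by
  rcases h with ⟨hX, c, h0, h1, rfl⟩ | ⟨f, g, h, rfl, rfl⟩ | ⟨v, w, h, rfl, rfl⟩
  · left
    rw [triple_eq_rootSet h0 h1, isOrbit_rootFamily.index_normalizer ⟨X, hX, rfl⟩,
      ncard_rootFamily]
  · right
    have := lineSet_true 1 f g
    rw [one_smul] at this
    rw [← this, index_normalizer_lineSet_one true h]
  · right
    have := lineSet_false 1 v w
    rw [one_smul] at this
    rw [← this, index_normalizer_lineSet_one false h]

/-- Two distinct commuting elations whose product generates a subgroup with the right normalizer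
index are collinear. -/
theorem adj_of_index {X Y : Matrix (Fin 3) (Fin 3) F} (hX : IsElation X) (hY : IsElation Y)
    (hne : X ≠ Y) (hc : Commute (elation X) (elation Y))
    (hi : (Subgroup.normalizer (withOne {X, Y, X + Y})).index ≠ 840) : Adj X Y := by
  obtain ⟨v, f, hv, hf, hvf, rfl⟩ := hX
  obtain ⟨w, g, hw, hg, hwg, rfl⟩ := hY
  obtain ⟨hfw, hgv⟩ := orthogonal_of_commute hv hf hvf hw hg hwg hc
  by_cases hfg : f ⨯₃ g = 0
  · obtain ⟨c, rfl⟩ := exists_smul_of_cross_eq_zero hf hfg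
    have hc0 : c ≠ 0 := by rintro rfl; simp at hg
    rw [vecMulVec_smul, ← smul_vecMulVec] at hne hi ⊢
    -- The axes are parallel; moving the scalar to the center gives both elations the same axis `f`.
    obtain ⟨w', hw'⟩ : ∃ w', w' = c • w := ⟨_, rfl⟩
    rw [← hw'] at hne hi ⊢
    have hfw' : f ⬝ᵥ w' = 0 := by rw [hw', dotProduct_smul, hfw, smul_zero]
    have hw0 : w' ≠ 0 := by rw [hw']; exact smul_ne_zero hc0 hw
    by_cases hvw : v ⨯₃ w' = 0
    · obtain ⟨d, rfl⟩ := exists_smul_of_cross_eq_zero hv hvw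
      refine Or.inl ⟨isElation_vecMulVec hv hf hvf, d, ?_, ?_, smul_vecMulVec _ _ _⟩
      · rintro rfl; simp at hw0
      · rintro rfl; simp at hne
    · obtain ⟨δ, hδ⟩ := exists_cross_eq_smul hf (by rw [dotProduct_comm, hvf] : v ⬝ᵥ f = 0)
        (by rw [dotProduct_comm, hfw'] : w' ⬝ᵥ f = 0)
      have hδ0 : δ ≠ 0 := by rintro rfl; rw [zero_smul] at hδ; exact hvw hδ
      have hf' : f = δ⁻¹ • v ⨯₃ w' := by rw [hδ, inv_smul_smul₀ hδ0]
      by_cases hδ1 : δ⁻¹ = 1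
      · exact adj_of_cross_axis hf (by rw [hδ1, one_smul] at hf'; exact hf'.symm)
      · rw [hf', ← lineSet_false] at hi
        exact absurd (index_normalizer_lineSet_of_ne false (inv_ne_zero hδ0) hδ1 hvw) hi
  -- The axes are distinct, so both centers are their intersection `f ⨯₃ g` up to scalars.
  · obtain ⟨δ, hδ⟩ := exists_cross_eq_smul hv hvf hgv
    have hδ0 : δ ≠ 0 := by rintro rfl; rw [zero_smul] at hδ; exact hfg hδ
    obtain ⟨κ, hκ⟩ := exists_cross_eq_smul hw hfw hwg
    have hwv : w = (κ⁻¹ * δ) • v := by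
      have hκ0 : κ ≠ 0 := by rintro rfl; rw [zero_smul] at hκ; exact hfg hκ
      rw [mul_smul, ← hδ, hκ, inv_smul_smul₀ hκ0]
    obtain ⟨g', hg'⟩ : ∃ g', g' = (κ⁻¹ * δ) • g := ⟨_, rfl⟩
    have e : w ⊠ g = v ⊠ g' := by rw [hwv, hg', smul_vecMulVec, vecMulVec_smul]
    have hc0 : κ⁻¹ * δ ≠ 0 := by intro h; rw [hwv, h, zero_smul] at hw; exact hw rfl
    have hfg' : f ⨯₃ g' ≠ 0 := by
      rw [hg', map_smul]; exact smul_ne_zero hc0 hfg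
    rw [e] at hi ⊢
    have hv' : v = ((κ⁻¹ * δ) * δ)⁻¹ • f ⨯₃ g' := by
      rw [hg', map_smul, hδ, smul_smul _ δ, inv_smul_smul₀ (mul_ne_zero hc0 hδ0)]
    by_cases hδ1 : ((κ⁻¹ * δ) * δ)⁻¹ = 1
    · exact adj_of_cross_center hv (by rw [hδ1, one_smul] at hv'; exact hv'.symm)
    · have h840 := index_normalizer_lineSet_of_ne true (inv_ne_zero (mul_ne_zero hc0 hδ0)) hδ1 hfg'
      rw [lineSet_true, ← hv'] at h840
      exact absurd h840 hi

/-- The lines of the near octagon. -/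
theorem isOctagonLine_iff {L : Set (unimodularCorrelationGroup F)} :
    IsOctagonLine _ L ↔
      ∃ X Y, Adj X Y ∧ L = {elation X, elation Y, elation (X + Y)} := by
  constructor
  · rintro ⟨x, y, hx, hy, hne, hc, hi, rfl⟩
    obtain ⟨X, hX, rfl⟩ := isCentralInvolution_iff.mp hx
    obtain ⟨Y, hY, rfl⟩ := isCentralInvolution_iff.mp hy
    have hXY : X * Y = 0 ∧ Y * X = 0 := by
      obtain ⟨v, f, hv, hf, hvf, rfl⟩ := hX
      obtain ⟨w, g, hw, hg, hwg, rfl⟩ := hY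
      obtain ⟨h1, h2⟩ := orthogonal_of_commute hv hf hvf hw hg hwg hc
      rw [vecMulVec_mul_vecMulVec, vecMulVec_mul_vecMulVec, h1, h2]
      simp
    rw [withOne_triple hX hY hXY.1 hXY.2] at hi
    refine ⟨X, Y, adj_of_index hX hY (fun h => hne (by rw [h])) hc ?_, ?_⟩
    · rcases hi with h | h <;> rw [h] <;> norm_num
    · rw [elation_mul hX.mul_self hY.mul_self hXY.1 hXY.2]
  · rintro ⟨X, Y, h, rfl⟩
    have hX := h.isElation_left
    have hY := h.isElation_right
    have hm := elation_mul hX.mul_self hY.mul_self h.mul_eq_zero h.symm.mul_eq_zero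
    have hm' := elation_mul hY.mul_self hX.mul_self h.symm.mul_eq_zero h.mul_eq_zero
    refine ⟨elation X, elation Y, isCentralInvolution_iff.mpr ⟨X, hX, rfl⟩,
      isCentralInvolution_iff.mpr ⟨Y, hY, rfl⟩,
      fun e => h.ne (elation_injOn hX.mul_self hY.mul_self e), ?_, ?_, by rw [hm]⟩
    · rw [Commute, SemiconjBy, hm, hm', add_comm]
    · rw [withOne_triple hX hY h.mul_eq_zero h.symm.mul_eq_zero]
      exact h.index_normalizer

end Lines

/-! ### Automorphisms of the near octagon -/

section Automorphisms

variable {F : Type*} [Field F] [FieldFour F]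

theorem Adj.add_right {X Y : Matrix (Fin 3) (Fin 3) F} (h : Adj X Y) : Adj X (X + Y) := by
  have := FieldFour.charP (F := F)
  rcases h with ⟨hX, c, h0, h1, rfl⟩ | ⟨f, g, h, rfl, rfl⟩ | ⟨v, w, h, rfl, rfl⟩
  · refine Or.inl ⟨hX, 1 + c, fun h => h1 ?_, fun h => h0 ?_, by rw [add_smul, one_smul]⟩
    · rw [add_eq_zero_iff_eq_neg, CharTwo.neg_eq] at h
      exact h.symm
    · simpa using h
  · have h1 : f ⨯₃ (f + g) = f ⨯₃ g := by rw [map_add, cross_self, zero_add]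
    exact Or.inr (Or.inl ⟨f, f + g, by rwa [h1], by rw [h1], by rw [h1, vecMulVec_add]⟩)
  · have h1 : v ⨯₃ (v + w) = v ⨯₃ w := by rw [map_add, cross_self, zero_add]
    exact Or.inr (Or.inr ⟨v, v + w, by rwa [h1], by rw [h1], by rw [h1, add_vecMulVec]⟩)

theorem elation_mem_iff {X A B C : Matrix (Fin 3) (Fin 3) F} (hX : IsElation X) (hA : IsElation A)
    (hB : IsElation B) (hC : IsElation C) :
    elation X ∈ ({elation A, elation B, elation C} : Set (unimodularCorrelationGroup F)) ↔
      X = A ∨ X = B ∨ X = C := by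
  have h : ∀ {Y : Matrix (Fin 3) (Fin 3) F}, IsElation Y → (elation X = elation Y ↔ X = Y) :=
    fun hY => ⟨elation_injOn hX.mul_self hY.mul_self, fun h => h ▸ rfl⟩
  simp only [Set.mem_insert_iff, Set.mem_singleton_iff, h hA, h hB, h hC]

/-- In characteristic two a triple `{A, B, A + B}` is symmetric: any two members are collinear and
add up to the third. -/
theorem adj_of_isOctagonLine {X Y Z : Matrix (Fin 3) (Fin 3) F} (hX : IsElation X)
    (hY : IsElation Y) (hZ : IsElation Z) (hXY : X ≠ Y) (hXZ : X ≠ Z) (hYZ : Y ≠ Z)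
    (h : IsOctagonLine (unimodularCorrelationGroup F) {elation X, elation Y, elation Z}) :
    Adj X Y ∧ Z = X + Y := by
  have := FieldFour.charP (F := F)
  have hadd : ∀ S T : Matrix (Fin 3) (Fin 3) F, S + (S + T) = T := fun S T => by
    ext i j; simp only [Matrix.add_apply, CharTwo.add_cancel_left]
  obtain ⟨A, B, hAB, h⟩ := isOctagonLine_iff.mp h
  have hmem : ∀ {T}, IsElation T →
      elation T ∈ ({elation X, elation Y, elation Z} : Set (unimodularCorrelationGroup F)) →
      T = A ∨ T = B ∨ T = A + B := fun hT hmem => by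
    rwa [h, elation_mem_iff hT hAB.isElation_left hAB.isElation_right hAB.isElation_add] at hmem
  have h1 := hAB.add_right
  have h2 : Adj B (A + B) := add_comm B A ▸ hAB.symm.add_right
  have h3 : B + (A + B) = A := by rw [add_comm A B, hadd]
  rcases hmem hX (by simp) with rfl | rfl | rfl <;>
    rcases hmem hY (by simp) with rfl | rfl | rfl <;>
    rcases hmem hZ (by simp) with rfl | rfl | rfl <;>
    first
    | contradiction
    | exact ⟨hAB, rfl⟩
    | exact ⟨hAB.symm, add_comm _ _⟩
    | exact ⟨h1, (hadd _ _).symm⟩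
    | exact ⟨h1.symm, by rw [add_comm, hadd]⟩
    | exact ⟨h2, h3.symm⟩
    | exact ⟨h2.symm, by rw [add_comm, h3]⟩

theorem isCentralInvolution_of_mem {L : Set (unimodularCorrelationGroup F)}
    (hL : IsOctagonLine _ L) {x : unimodularCorrelationGroup F} (hx : x ∈ L) :
    IsCentralInvolution _ x := by
  obtain ⟨X, Y, h, rfl⟩ := isOctagonLine_iff.mp hL
  rcases hx with rfl | rfl | rfl
  · exact isCentralInvolution_iff.mpr ⟨_, h.isElation_left, rfl⟩
  · exact isCentralInvolution_iff.mpr ⟨_, h.isElation_right, rfl⟩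
  · exact isCentralInvolution_iff.mpr ⟨_, h.isElation_add, rfl⟩

/-- A map of central involutions, as a map of elation matrices. -/
noncomputable def onElations
    (t : unimodularCorrelationGroup F → unimodularCorrelationGroup F)
    (X : Matrix (Fin 3) (Fin 3) F) : Matrix (Fin 3) (Fin 3) F :=
  open Classical in
  if h : ∃ Y, IsElation Y ∧ t (elation X) = elation Y then h.choose else 0

section

variable {t : unimodularCorrelationGroup F → unimodularCorrelationGroup F}

theorem onElations_spec (ht : ∀ x, IsCentralInvolution _ x → IsCentralInvolution _ (t x))
    {X : Matrix (Fin 3) (Fin 3) F} (hX : IsElation X) :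
    IsElation (onElations t X) ∧ t (elation X) = elation (onElations t X) := by
  have h : ∃ Y, IsElation Y ∧ t (elation X) = elation Y :=
    isCentralInvolution_iff.mp (ht _ (isCentralInvolution_iff.mpr ⟨X, hX, rfl⟩))
  rw [onElations, dif_pos h]
  exact h.choose_spec

theorem linePreserving_onElations
    (ht : ∀ x, IsCentralInvolution _ x → IsCentralInvolution _ (t x))
    (hinj : ∀ x y, IsCentralInvolution _ x → IsCentralInvolution _ y → t x = t y → x = y)
    (hl : ∀ L, IsOctagonLine _ L → IsOctagonLine _ (t '' L)) :
    LinePreserving (onElations t) := by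
  have hne : ∀ {X Y : Matrix (Fin 3) (Fin 3) F}, IsElation X → IsElation Y → X ≠ Y →
      onElations t X ≠ onElations t Y := fun {X Y} hX hY hXY h => by
    refine hXY (elation_injOn hX.mul_self hY.mul_self (hinj _ _
      (isCentralInvolution_iff.mpr ⟨X, hX, rfl⟩) (isCentralInvolution_iff.mpr ⟨Y, hY, rfl⟩) ?_))
    rw [(onElations_spec ht hX).2, (onElations_spec ht hY).2, h]
  have key : ∀ X Y, Adj X Y → Adj (onElations t X) (onElations t Y) ∧
      onElations t (X + Y) = onElations t X + onElations t Y := fun X Y h => by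
    have hX := onElations_spec ht h.isElation_left
    have hY := onElations_spec ht h.isElation_right
    have hZ := onElations_spec ht h.isElation_add
    have h1 : Adj Y (X + Y) := add_comm Y X ▸ h.symm.add_right
    refine adj_of_isOctagonLine hX.1 hY.1 hZ.1 (hne h.isElation_left h.isElation_right h.ne)
      (hne h.isElation_left h.isElation_add h.add_right.ne)
      (hne h.isElation_right h.isElation_add h1.ne) ?_
    have h2 := hl _ (isOctagonLine_iff.mpr ⟨X, Y, h, rfl⟩)
    rwa [Set.image_insert_eq, Set.image_pair, hX.2, hY.2, hZ.2] at h2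
  exact ⟨fun X hX => (onElations_spec ht hX).1, fun X Y h => (key X Y h).1,
    fun X Y h => (key X Y h).2⟩

end

end Automorphisms

/-- The central involutions and octagon lines of `G` determine `G`: every permutation of the
central involutions that preserves the octagon lines is conjugation by an element. -/
structure IsOctagonal (G : Type*) [Group G] : Prop where
  finite : Finite G
  isCentralInvolution_of_mem : ∀ (L : Set G), IsOctagonLine G L → ∀ x ∈ L, IsCentralInvolution G x
  eq_one_of_forall_commute : ∀ g : G, (∀ x, IsCentralInvolution G x → Commute g x) → g = 1
  exists_conj : ∀ t s : G → G,
    (∀ x, IsCentralInvolution G x → IsCentralInvolution G (t x) ∧ s (t x) = x) →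
    (∀ x, IsCentralInvolution G x → IsCentralInvolution G (s x) ∧ t (s x) = x) →
    (∀ L, IsOctagonLine G L → IsOctagonLine G (t '' L)) →
    (∀ L, IsOctagonLine G L → IsOctagonLine G (s '' L)) →
    ∃ g, ∀ x, IsCentralInvolution G x → t x = g * x * g⁻¹

theorem isOctagonal_unimodularCorrelationGroup (F : Type*) [Field F] [FieldFour F] :
    IsOctagonal (unimodularCorrelationGroup F) where
  finite := inferInstance
  isCentralInvolution_of_mem _ hL _ hx := isCentralInvolution_of_mem hL hx
  eq_one_of_forall_commute g h := eq_one_of_forall_commute fun X hX =>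
    h _ (isCentralInvolution_iff.mpr ⟨X, hX, rfl⟩)
  exists_conj t s ht hs htl hsl := by
    have ht1 := fun x hx => (ht x hx).1
    have hs1 := fun x hx => (hs x hx).1
    have h : LineAut (onElations t) (onElations s) :=
      { left := linePreserving_onElations ht1
          (fun x y hx hy hxy => by rw [← (ht x hx).2, hxy, (ht y hy).2]) htl
        right := linePreserving_onElations hs1
          (fun x y hx hy hxy => by rw [← (hs x hx).2, hxy, (hs y hy).2]) hsl
        left_inv := fun X hX => by
          have h1 := onElations_spec ht1 hX
          have h2 := onElations_spec hs1 h1.1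
          refine elation_injOn h2.1.mul_self hX.mul_self ?_
          rw [← h2.2, ← h1.2, (ht _ (isCentralInvolution_iff.mpr ⟨X, hX, rfl⟩)).2]
        right_inv := fun X hX => by
          have h1 := onElations_spec hs1 hX
          have h2 := onElations_spec ht1 h1.1
          refine elation_injOn h2.1.mul_self hX.mul_self ?_
          rw [← h2.2, ← h1.2, (hs _ (isCentralInvolution_iff.mpr ⟨X, hX, rfl⟩)).2] }
    obtain ⟨g, hg⟩ := h.exists_conj
    refine ⟨g, fun x hx => ?_⟩
    obtain ⟨X, hX, rfl⟩ := isCentralInvolution_iff.mp hx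
    rw [hg X hX, (onElations_spec ht1 hX).2]

/-! ### Invariance under isomorphism, and the conjugation action on the geometry -/

namespace IsOctagonal

variable {G H : Type*} [Group G] [Group H]

/-- All notions involved are intrinsic to the group, so maps on `G` are carried to `H` by
conjugating with `e`. -/
theorem of_mulEquiv (hH : IsOctagonal H) (e : G ≃* H) : IsOctagonal G := by
  have := hH.finite
  have : Finite G := Finite.of_equiv H e.symm.toEquiv
  have hline : ∀ (t : G → G) (L : Set H), IsOctagonLine H L →
      (∀ L, IsOctagonLine G L → IsOctagonLine G (t '' L)) →
      IsOctagonLine H ((fun x => e (t (e.symm x))) '' L) := fun t L hL h => by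
    have h1 := isOctagonLine_map e (h _ (isOctagonLine_map e.symm hL))
    rwa [Set.image_image, Set.image_image] at h1
  have hmap : ∀ t s : G → G,
      (∀ x, IsCentralInvolution G x → IsCentralInvolution G (t x) ∧ s (t x) = x) →
      ∀ x, IsCentralInvolution H x → IsCentralInvolution H (e (t (e.symm x))) ∧
        e (s (e.symm (e (t (e.symm x))))) = x := fun t s h x hx => by
    have h1 := h _ (isCentralInvolution_map e.symm hx)
    exact ⟨isCentralInvolution_map e h1.1, by rw [e.symm_apply_apply, h1.2, e.apply_symm_apply]⟩
  refine ⟨this, fun L hL x hx => ?_, fun g hg => ?_, fun t s ht hs htl hsl => ?_⟩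
  · have h1 := hH.isCentralInvolution_of_mem _ (isOctagonLine_map e hL) _ ⟨x, hx, rfl⟩
    simpa using isCentralInvolution_map e.symm h1
  · refine e.map_eq_one_iff.mp (hH.eq_one_of_forall_commute _ fun x hx => ?_)
    simpa using (hg _ (isCentralInvolution_map e.symm hx)).map e
  · obtain ⟨g, hg⟩ := hH.exists_conj (fun x => e (t (e.symm x))) (fun x => e (s (e.symm x)))
      (hmap t s ht) (hmap s t hs) (fun L hL => hline t L hL htl) (fun L hL => hline s L hL hsl)
    refine ⟨e.symm g, fun x hx => e.injective ?_⟩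
    have h1 := hg _ (isCentralInvolution_map e hx)
    simpa using h1

theorem isOctagonLine_conj [Finite G] (g : G) {L : Set G} (hL : IsOctagonLine G L) :
    IsOctagonLine G ((fun x => g * x * g⁻¹) '' L) := isOctagonLine_map (MulAut.conj g) hL

/-- Conjugation by `g` on the points and lines of the octagon geometry. -/
def conj [Finite G] (g : G) :
    Equiv.Perm (octagonGeometry G).Point × Equiv.Perm (octagonGeometry G).Line where
  fst :=
    { toFun := fun p => ⟨g * p.1 * g⁻¹, isCentralInvolution_conj g p.2⟩
      invFun := fun p => ⟨g⁻¹ * p.1 * g⁻¹⁻¹, isCentralInvolution_conj g⁻¹ p.2⟩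
      left_inv := fun p => Subtype.ext (by group)
      right_inv := fun p => Subtype.ext (by group) }
  snd :=
    { toFun := fun L => ⟨(fun x => g * x * g⁻¹) '' L.1, isOctagonLine_conj g L.2⟩
      invFun := fun L => ⟨(fun x => g⁻¹ * x * g⁻¹⁻¹) '' L.1, isOctagonLine_conj g⁻¹ L.2⟩
      left_inv := fun L => Subtype.ext (by simp [Set.image_image, mul_assoc])
      right_inv := fun L => Subtype.ext (by simp [Set.image_image, mul_assoc]) }

theorem eq_conj [Finite G] {g : G}
    {θ : Equiv.Perm (octagonGeometry G).Point × Equiv.Perm (octagonGeometry G).Line}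
    (h : IsConjugationBy g θ) : θ = conj g :=
  Prod.ext (Equiv.ext fun p => Subtype.ext (h.1 p)) (Equiv.ext fun L => Subtype.ext (h.2 L))

theorem conj_mem [Finite G] (g : G) : conj g ∈ (octagonGeometry G).Aut := fun p L => by
  change g * p.1 * g⁻¹ ∈ (fun x => g * x * g⁻¹) '' L.1 ↔ p.1 ∈ L.1
  exact (MulAut.conj g).injective.mem_set_image

/-- The action of `G` by conjugation on its octagon geometry. -/
def conjHom [Finite G] : G →* (octagonGeometry G).Aut where
  toFun g := ⟨conj g, conj_mem g⟩
  map_one' := Subtype.ext (eq_conj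
    ⟨fun p => by
      change p.1 = _
      simp,
    fun L => by
      change L.1 = _
      simp⟩).symm
  map_mul' g h := Subtype.ext (eq_conj
    ⟨fun p => by
      change g * (h * p.1 * h⁻¹) * g⁻¹ = _
      group,
    fun L => by
      change (fun x => g * x * g⁻¹) '' ((fun x => h * x * h⁻¹) '' L.1) = _
      simp [Set.image_image, mul_assoc]⟩).symm

theorem conjHom_injective [Finite G] (hG : IsOctagonal G) :
    Function.Injective (conjHom (G := G)) := by
  refine (injective_iff_map_eq_one _).mpr fun g hg => hG.eq_one_of_forall_commute g fun x hx => ?_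
  have h1 : g * x * g⁻¹ = x := congrArg Subtype.val
    (DFunLike.congr_fun (congrArg (fun θ => θ.1.1) hg) (⟨x, hx⟩ : {σ // IsCentralInvolution G σ}))
  exact mul_inv_eq_iff_eq_mul.mp h1

/-- A permutation of the points as a map on `G`, the identity outside of the central
involutions. -/
noncomputable def extendPerm (θ : Equiv.Perm {σ : G // IsCentralInvolution G σ}) (x : G) : G :=
  open Classical in if h : IsCentralInvolution G x then (θ ⟨x, h⟩).1 else x

theorem extendPerm_apply (θ : Equiv.Perm {σ : G // IsCentralInvolution G σ})
    (p : {σ : G // IsCentralInvolution G σ}) : extendPerm θ p.1 = (θ p).1 := dif_pos p.2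

theorem extendPerm_spec (θ : Equiv.Perm {σ : G // IsCentralInvolution G σ}) (x : G)
    (hx : IsCentralInvolution G x) :
    IsCentralInvolution G (extendPerm θ x) ∧ extendPerm θ⁻¹ (extendPerm θ x) = x := by
  rw [extendPerm_apply θ ⟨x, hx⟩, extendPerm_apply]
  exact ⟨(θ _).2, congrArg Subtype.val (θ.symm_apply_apply ⟨x, hx⟩)⟩

/-- Lines consist of points, so preservation of incidence and non-incidence makes the action on
lines the one induced by the action on points. -/
theorem extendPerm_image (hG : IsOctagonal G)
    {θ : Equiv.Perm {σ : G // IsCentralInvolution G σ} × Equiv.Perm {L : Set G // IsOctagonLine G L}}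
    (hθ : θ ∈ (octagonGeometry G).Aut) (L : {L : Set G // IsOctagonLine G L}) :
    extendPerm θ.1 '' L.1 = (θ.2 L).1 := by
  have hθ : ∀ (p : {σ : G // IsCentralInvolution G σ}) (L : {L : Set G // IsOctagonLine G L}),
    (θ.1 p).1 ∈ (θ.2 L).1 ↔ p.1 ∈ L.1 := hθ
  ext y
  constructor
  · rintro ⟨x, hx, rfl⟩
    have h1 := hG.isCentralInvolution_of_mem _ L.2 x hx
    rw [extendPerm_apply θ.1 ⟨x, h1⟩]
    exact (hθ ⟨x, h1⟩ L).mpr hx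
  · intro hy
    obtain ⟨p, hp⟩ := θ.1.surjective ⟨y, hG.isCentralInvolution_of_mem _ (θ.2 L).2 y hy⟩
    refine ⟨p.1, (hθ p L).mp (by rwa [hp]), ?_⟩
    rw [extendPerm_apply, hp]

theorem exists_isConjugationBy (hG : IsOctagonal G)
    {θ : Equiv.Perm (octagonGeometry G).Point × Equiv.Perm (octagonGeometry G).Line}
    (hθ : θ ∈ (octagonGeometry G).Aut) : ∃ g, IsConjugationBy g θ := by
  have hline : ∀ θ ∈ (octagonGeometry G).Aut, ∀ L, IsOctagonLine G L →
      IsOctagonLine G (extendPerm θ.1 '' L) := fun θ hθ L hL => by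
    rw [extendPerm_image hG hθ ⟨L, hL⟩]
    exact (θ.2 ⟨L, hL⟩).2
  obtain ⟨g, hg⟩ := hG.exists_conj (extendPerm θ.1) (extendPerm θ.1⁻¹) (extendPerm_spec θ.1)
    (fun x hx => extendPerm_spec θ.1⁻¹ x hx) (hline θ hθ)
    (hline θ⁻¹ (inv_mem hθ))
  refine ⟨g, fun p => ?_, fun L => ?_⟩
  · rw [← hg p.1 p.2]
    exact (extendPerm_apply θ.1 p).symm
  · exact (extendPerm_image hG hθ L).symm.trans
      (Set.image_congr fun x hx => hg x (hG.isCentralInvolution_of_mem _ L.2 x hx))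

theorem mem_aut_iff (hG : IsOctagonal G)
    (θ : Equiv.Perm (octagonGeometry G).Point × Equiv.Perm (octagonGeometry G).Line) :
    θ ∈ (octagonGeometry G).Aut ↔ ∃ g : G, IsConjugationBy g θ := by
  have := hG.finite
  refine ⟨hG.exists_isConjugationBy, ?_⟩
  rintro ⟨g, hg⟩
  rw [eq_conj hg]
  exact conj_mem g

theorem nonempty_aut_mulEquiv (hG : IsOctagonal G) : Nonempty ((octagonGeometry G).Aut ≃* G) := by
  have := hG.finite
  refine ⟨(MulEquiv.ofBijective conjHom ⟨hG.conjHom_injective, fun θ => ?_⟩).symm⟩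
  obtain ⟨g, hg⟩ := hG.exists_isConjugationBy θ.2
  exact ⟨g, Subtype.ext (eq_conj hg).symm⟩

end IsOctagonal

instance : FieldFour (GaloisField 2 2) := ⟨GaloisField.card 2 2 two_ne_zero⟩

end NearOctagon

theorem theorem1p3 {G : Type*} [Group G] (hG : Nonempty (G ≃* L34Ext)) :
    Nonempty ((octagonGeometry G).Aut ≃* G) ∧
    (∀ θ : Equiv.Perm (octagonGeometry G).Point × Equiv.Perm (octagonGeometry G).Line,
      θ ∈ (octagonGeometry G).Aut ↔ ∃ g : G, IsConjugationBy g θ) := by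
  obtain ⟨e⟩ := hG
  have h := (NearOctagon.isOctagonal_unimodularCorrelationGroup (GaloisField 2 2)).of_mulEquiv e
  exact ⟨h.nonempty_aut_mulEquiv, h.mem_aut_iff⟩
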